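/- **Setting.** Let $d,N\ge 0$ be integers and let $y_1>\dots>y_d\ge -d$ and $x_1>\dots>x_{d+N}=-d-N$ be integers with $y_1-y_d\le N-1$ (if $d\ge1$). They encode a hexagon $\mathbf P$ with cuts: the $y_j$ are the integer points in the lower cuts (on the line $n=0$), the $x_i$ are the integer points on the line $n=N$ outside $\mathbf P$ (upper cuts and added corner triangles). A red-dot configuration is a family of integer rows $x^{(k)}=(x^{(k)}_1,\dots,x^{(k)}_{d+k})$, $0\le k\le N$, with $x^{(0)}=y$, $x^{(N)}=x$ and $x^{(k)}_{i+1}<x^{(k-1)}_i\le x^{(k)}_i$. Assume that there is at least one configuration (i.e. $\mathbf P$ has a tiling); the uniform red-dot process is the random set $\{(k,x^{(k)}_i)\}$ for a uniformly chosen configuration. Points are $(m,x)\in\mathbb Z^2$ with $0\le m\le N$, and $x\notin\{x_1,\dots,x_{d+N}\}$ if $m=N$ (this includes all integer points of $\mathbf P$). **The $q$-kernel.** For $0<q<1$ put $y_{d+j}=-d-j$ ($1\le j\le N$), $\varphi_k(x,z)=q^{(k-1)(z-x)}\mathbf 1_{x\le z}$, $\varphi_k(\mathrm{virt},z)=q^{(k-1)z}$,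 $\chi_i(z)=\mathbf 1_{z=y_i}$, $H=(h_{x_i-y_j}(q^d,\dots,q^{d+N-1}))_{1\le i,j\le d+N}$ where $\prod_i(1-a_it)^{-1}=\sum_r h_r(a)t^r$ and $h_r=0$ for $r<0$, $\psi_k(z)=\sum_j(H^{-1})_{kj}\mathbf 1_{z=x_j}$ and $\psi^{(m+1)}_k=\varphi_{d+m+1}*\dots*\varphi_{d+N}*\psi_k$ (convolutions are sums over $\mathbb Z$; an empty convolution is the identity). Let $M_{k\ell}=\chi_k*\psi^{(1)}_\ell$ for $k\le d$ and $M_{k\ell}=\varphi_k(\mathrm{virt},\cdot)*\psi_\ell^{(k+1-d)}$ for $d<k\le d+N$. The kernel of the $q$-weighted process is $$\begin{aligned}\mathbb K_q(m,x;n,y)=&-(\varphi_{d+m+1}*\dots*\varphi_{d+n})(x,y)\mathbf 1_{n>m}+\sum_{k=1}^{d+N}\sum_{\ell=1}^{d}\psi^{(m+1)}_k(x)(M^{-1})_{k\ell}(\chi_\ell*\varphi_{d+1}*\dots*\varphi_{d+n})(y)\\&+\sum_{k=1}^{d+N}\sum_{\ell=d+1}^{d+n}\psi^{(m+1)}_k(x)(M^{-1})_{k\ell}(\varphi_\ell(\mathrm{virt},\cdot)*\varphi_{\ell+1}*\dots*\varphi_{d+n})(y).\end{aligned}$$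 **Proposition.** For all points $(m,x),(n,y)$ as above the limit $\mathbb K^{\rm red}(m,x;n,y)=\lim_{q\uparrow1}\mathbb K_q(m,x;n,y)$ exists; $\mathbb K^{\rm red}$ is a correlation kernel of the uniform red-dot process: for distinct points $p_1,\dots,p_k$, the probability that all of them are red dots is $\det(\mathbb K^{\rm red}(p_i;p_j))_{1\le i,j\le k}$; and $\mathbb K^{\rm red}=\mathbb K_0+\mathbb K_1+\mathbb K_2$ with, writing $(a)_k=a(a+1)\cdots(a+k-1)$, $Q(z)=\prod_{i=1}^{d+N}(z-x_i)$, $$\mathbb K_0=-\frac{(y-x+1)_{n-m-1}}{(n-m-1)!}\mathbf 1_{n>m}\mathbf 1_{y\ge x},$$ $$\mathbb K_1=\oint_{\Gamma(x+\mathbb N)}\frac{dv}{2\pi i}\frac{(v-x+1)_{N-m-1}}{(N-m-1)!\,Q(v)}\oint_{\Gamma_\infty}\frac{dz}{2\pi i(z-v)}\frac{(N-n)!\,Q(z)}{(z-y)_{N-n+1}}\frac{\Omega_{\mathcal R}(v,z)}{\Omega_{\mathcal R}(0,0)},$$ $$\mathbb K_2=d\oint_{\Gamma(x+\mathbb N)}\frac{dv}{2\pi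 i}\frac{(v-x+1)_{N-m-1}}{(N-m-1)!\,Q(v)}\oint_{\Gamma_0}\frac{dw}{2\pi i\,w^{y+1}(1-w)^n}\frac{\widetilde\Omega^{(1)}_{\mathcal R}(v,w)}{\Omega_{\mathcal R}(0,0)},$$ where $\mathbb K_1=\mathbb K_2=0$ for $m=N$ (convention $1/(-1)!=0$), $\Delta_d(u)=\prod_{i<j}(u_i-u_j)$, $$\Omega_{\mathcal R}(v,z)=\Big(\prod_{\alpha=1}^d\oint_{\Gamma(\mathcal R)}\frac{du_\alpha}{2\pi i\,Q(u_\alpha)}\frac{v-u_\alpha}{z-u_\alpha}\Big)\Delta_d(u)\det\Big(\frac{(u_\alpha-y_\beta+1)_{N-1}}{(N-1)!}\Big)_{1\le\alpha,\beta\le d},$$ $$\widetilde\Omega^{(1)}_{\mathcal R}(v,w)=\Big(\prod_{\alpha=2}^d\oint_{\Gamma(\mathcal R)}\frac{du_\alpha}{2\pi i\,Q(u_\alpha)}\Big)\Delta_d(v,u_2,\dots,u_d)\det\begin{pmatrix}w^{y_1}&\cdots&w^{y_d}\\ &\Big(\frac{(u_\alpha-y_\beta+1)_{N-1}}{(N-1)!}\Big)_{2\le\alpha\le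 d,\,1\le\beta\le d}\end{pmatrix},$$ $\Omega_{\mathcal R}(0,0)\neq0$ is the integral with the factors $\frac{v-u_\alpha}{z-u_\alpha}$ replaced by $1$; for $d=0$, $\Omega_{\mathcal R}=1$ and $\mathbb K_2=0$. So the kernel is at worst a $(d+2)$-fold integral. Here $\mathcal R=\{x_i: x_i\ge y_d\}$, and the contours are any positively oriented circles such that $\Gamma(\mathcal R)$ encloses $\mathcal R$ and no other $x_i$, $\Gamma(x+\mathbb N)$ encloses the $x_i\ge x$ and no other $x_i$, $\Gamma_\infty$ encloses the closed discs bounded by these two circles and the points $y,y-1,\dots,y-N+n$, and $\Gamma_0$ encloses $0$ but not $1$. Such circles exist for all pairs of points. -/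

import Mathlib

open Filter Topology

noncomputable section

namespace RedDot

/-! ### The polygon, encoded by its cuts -/

/-- The combinatorial data of a hexagon with cuts in its lower edge (level `0`) and in its upper edge
(level `N`), in the coordinates `(n, x)`.  The integer points in the lower cuts are
`y 0 > y 1 > ⋯ > y (d - 1)` (so `d` is the total size of the lower cuts); the integer points at
level `N` outside the polygon (upper cuts and the two added triangles) are
`x 0 > x 1 > ⋯ > x (d + N - 1)`.  The origin is fixed by the requirement that the lower edge of
the completed quadrilateral starts just right of `-d - 1` and its upper edge starts with the
point `-d - N`. -/
structure CutPolygon (d N : ℕ) where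
  y : Fin d → ℤ
  x : Fin (d + N) → ℤ
  y_anti : StrictAnti y
  x_anti : StrictAnti x
  y_left : ∀ j, -(d : ℤ) ≤ y j
  x_last : ∀ i : Fin (d + N), (i : ℕ) + 1 = d + N → x i = -((d : ℤ) + N)
  spread : ∀ i j, y i - y j ≤ (N : ℤ) - 1

namespace CutPolygon

variable {d N : ℕ} (P : CutPolygon d N)

/-- The points `y_1 > ⋯ > y_d`, completed by `y_{d+j} = -d-j` for `1 ≤ j ≤ N`
(here with indices starting at `0`). -/
def yExt (j : Fin (d + N)) : ℤ :=
  if h : (j : ℕ) < d then P.y ⟨j, h⟩ else -((j : ℤ) + 1)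

/-- Integer points `(n, x)` with `0 ≤ n ≤ N`, where on the top line the prescribed points `x_i`
are left out.  Since the points `x_i` lie outside the polygon, every integer point of
the polygon belongs to this set. -/
def points : Set (ℕ × ℤ) :=
  {p | p.1 ≤ N ∧ (p.1 = N → ∀ i, p.2 ≠ P.x i)}

/-! ### Red-dot configurations and the uniform measure -/

/-- Configurations of red dots: rows `X k`, `0 ≤ k ≤ N`, of `d + k` integers, the bottom row being
`y`, the top row being `x`, with the interlacing
`X (k+1) (i+1) < X k i ≤ X (k+1) i`. -/
def configs : Set ((k : Fin (N + 1)) → Fin (d + (k : ℕ)) → ℤ) :=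
  {X | (∀ (i : ℕ) (hi : i < d), X ⟨0, by omega⟩ ⟨i, by simpa using hi⟩ = P.y ⟨i, hi⟩) ∧
    (∀ (i : ℕ) (hi : i < d + N), X ⟨N, by omega⟩ ⟨i, by simpa using hi⟩ = P.x ⟨i, hi⟩) ∧
    ∀ (k : ℕ) (hk : k < N) (i : ℕ) (hi : i < d + k),
      X ⟨k + 1, by omega⟩ ⟨i + 1, by simp only; omega⟩ < X ⟨k, by omega⟩ ⟨i, by simpa using hi⟩ ∧
      X ⟨k, by omega⟩ ⟨i, by simpa using hi⟩ ≤ X ⟨k + 1, by omega⟩ ⟨i, by simp only; omega⟩}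

/-- The configuration `X` has a red dot at `p = (n, x)`. -/
def HasDot (X : (k : Fin (N + 1)) → Fin (d + (k : ℕ)) → ℤ) (p : ℕ × ℤ) : Prop :=
  ∃ (h : p.1 < N + 1) (i : Fin (d + p.1)), X ⟨p.1, h⟩ i = p.2

/-- Probability of an event under the uniform measure on the (finite) set of configurations. -/
def uniformProb (E : Set ((k : Fin (N + 1)) → Fin (d + (k : ℕ)) → ℤ)) : ℝ :=
  ((P.configs ∩ E).ncard : ℝ) / (P.configs.ncard : ℝ)

/-- On the point set `S`, the uniform red-dot process is determinantal with correlation kernel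
`K`. -/
def IsCorrelationKernelOn (S : Set (ℕ × ℤ)) (K : ℕ × ℤ → ℕ × ℤ → ℝ) : Prop :=
  ∀ (k : ℕ) (p : Fin k → ℕ × ℤ), Function.Injective p → (∀ i, p i ∈ S) →
    P.uniformProb {X | ∀ i, HasDot X (p i)} = (Matrix.of fun i j => K (p i) (p j)).det

end CutPolygon

/-! ### The kernel of the `q`-process -/

/-- Complete homogeneous symmetric function `h_r(a)`, through `∏ (1 - a_i t)⁻¹ = ∑ h_r(a) t^r`,
with `h_r = 0` for `r < 0`. -/
def hSym {n : ℕ} (a : Fin n → ℝ) (r : ℤ) : ℝ :=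
  if 0 ≤ r then
    PowerSeries.coeff r.toNat (∏ i, (1 - PowerSeries.C (a i) * PowerSeries.X)⁻¹ : PowerSeries ℝ)
  else 0

/-- `φ_k(x, z) = q^{(k-1)(z-x)} 1_{x ≤ z}` for integers `x`, `z`. -/
def phi (q : ℝ) (k : ℕ) (x z : ℤ) : ℝ :=
  if x ≤ z then q ^ (((k : ℤ) - 1) * (z - x)) else 0

/-- `φ_k(virt, z) = q^{(k-1)z}`, for the virtual point at `-∞`. -/
def phiVirt (q : ℝ) (k : ℕ) (z : ℤ) : ℝ :=
  q ^ (((k : ℤ) - 1) * z)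

/-- The convolution `φ_a ∗ φ_{a+1} ∗ ⋯ ∗ φ_{a+r-1}` of `r` factors (the identity if `r = 0`). -/
def phiConv (q : ℝ) (a : ℕ) : ℕ → ℤ → ℤ → ℝ
  | 0 => fun x z => if x = z then 1 else 0
  | r + 1 => fun x z => ∑' t : ℤ, phiConv q a r x t * phi q (a + r) t z

namespace CutPolygon

variable {d N : ℕ} (P : CutPolygon d N)

/-- `H_{ij} = h_{x_i - y_j}(q^d, …, q^{d+N-1})`. -/
def H (q : ℝ) : Matrix (Fin (d + N)) (Fin (d + N)) ℝ :=
  Matrix.of fun i j => hSym (fun a : Fin N => q ^ (d + (a : ℕ))) (P.x i - P.yExt j)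

/-- `χ_i(z) = 1_{z = y_i}`. -/
def chi (i : Fin d) (z : ℤ) : ℝ := if z = P.y i then 1 else 0

/-- `ψ_k(z) = ∑_j (H⁻¹)_{kj} 1_{z = x_j}`. -/
def psi (q : ℝ) (k : Fin (d + N)) (z : ℤ) : ℝ :=
  ∑ j, (P.H q)⁻¹ k j * (if z = P.x j then 1 else 0)

/-- `psiUp q m k` is the function `ψ_k^{(m+1)} = φ_{d+m+1} ∗ ⋯ ∗ φ_{d+N} ∗ ψ_k`, for
`0 ≤ m ≤ N` (with `ψ_k^{(N+1)} = ψ_k`). -/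
def psiUp (q : ℝ) (m : ℕ) (k : Fin (d + N)) (x : ℤ) : ℝ :=
  ∑' z : ℤ, phiConv q (d + m + 1) (N - m) x z * P.psi q k z

/-- The matrix `M` with (for one-based `k`) `M_{kℓ} = χ_k ∗ ψ_ℓ^{(1)}` if `k ≤ d` and
`M_{kℓ} = φ_k(virt, ·) ∗ ψ_ℓ^{(k+1-d)}` if `k > d`. -/
def M (q : ℝ) : Matrix (Fin (d + N)) (Fin (d + N)) ℝ :=
  Matrix.of fun k l =>
    if h : (k : ℕ) < d then ∑' z : ℤ, P.chi ⟨k, h⟩ z * P.psiUp q 0 l z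
    else ∑' z : ℤ, phiVirt q ((k : ℕ) + 1) z * P.psiUp q ((k : ℕ) + 1 - d) l z

/-- For a (one-based) index `ℓ ≤ d + n`, the function of `y` which multiplies `(M⁻¹)_{kℓ}` in the
kernel: `χ_ℓ ∗ φ_{d+1} ∗ ⋯ ∗ φ_{d+n}` if `ℓ ≤ d`, and
`φ_ℓ(virt, ·) ∗ φ_{ℓ+1} ∗ ⋯ ∗ φ_{d+n}` if `d < ℓ ≤ d + n`.  For `ℓ > d + n` there is no term. -/
def rowFun (q : ℝ) (n : ℕ) (l : Fin (d + N)) (y : ℤ) : ℝ :=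
  if h : (l : ℕ) < d then ∑' z : ℤ, P.chi ⟨l, h⟩ z * phiConv q (d + 1) n z y
  else if (l : ℕ) < d + n then
    ∑' z : ℤ, phiVirt q ((l : ℕ) + 1) z * phiConv q ((l : ℕ) + 2) (d + n - ((l : ℕ) + 1)) z y
  else 0

/-- The kernel `𝕂_q(m, x; n, y)` of the `q`-weighted red-dot process, where `p = (m, x)` and
`p' = (n, y)`. -/
def qKernel (q : ℝ) (p p' : ℕ × ℤ) : ℝ :=
  -(if p.1 < p'.1 then phiConv q (d + p.1 + 1) (p'.1 - p.1) p.2 p'.2 else 0)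
    + ∑ k, ∑ l, P.psiUp q p.1 k p.2 * (P.M q)⁻¹ k l * P.rowFun q p'.1 l p'.2

end CutPolygon

/-! ### The limiting kernel -/

/-- The rising factorial `a (a+1) ⋯ (a+k-1)`. -/
def rising (a : ℂ) (k : ℕ) : ℂ := (ascPochhammer ℂ k).eval a

/-- The Vandermonde product `∏_{i<j} (u_i - u_j)`. -/
def vdm {k : ℕ} (u : Fin k → ℂ) : ℂ := ∏ i, ∏ j ∈ Finset.Ioi i, (u i - u j)

/-- Circular integration contours: `R` for the `u`-integrals, `v` and `inf` for the `v`- and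
`z`-integrals, `zero` for the `w`-integral.  All are oriented counterclockwise. -/
structure Contours where
  cR : ℂ
  rR : ℝ
  cv : ℂ
  rv : ℝ
  cinf : ℂ
  rinf : ℝ
  czero : ℂ
  rzero : ℝ

namespace CutPolygon

variable {d N : ℕ} (P : CutPolygon d N)

/-- `Q(z) = ∏ (z - x_i)`. -/
def Q (z : ℂ) : ℂ := ∏ i, (z - (P.x i : ℂ))

/-- `x_i` belongs to the set `𝓡` of the points `x_i ≥ y_d` (empty if `d = 0`). -/
def InR (i : Fin (d + N)) : Prop := ∃ j, P.y j ≤ P.x i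

/-- The contours are admissible for the kernel at `(m, x; n, y)` (the level `m` plays no role):
`Γ(𝓡)` encloses `𝓡` and no other root of `Q`;
`Γ(x + ℕ)` encloses the roots of `Q` in `x + ℕ` and no other root of `Q`;
`Γ_∞` encloses the two previous contours and the points `y, y - 1, …, y - N + n`;
`Γ_0` encloses `0` but not `1`. -/
def Admissible (Γ : Contours) (x : ℤ) (n : ℕ) (y : ℤ) : Prop :=
  (∀ i, P.InR i → (P.x i : ℂ) ∈ Metric.ball Γ.cR Γ.rR) ∧
  (∀ i, ¬ P.InR i → (P.x i : ℂ) ∉ Metric.closedBall Γ.cR Γ.rR) ∧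
  (∀ i, x ≤ P.x i → (P.x i : ℂ) ∈ Metric.ball Γ.cv Γ.rv) ∧
  (∀ i, P.x i < x → (P.x i : ℂ) ∉ Metric.closedBall Γ.cv Γ.rv) ∧
  Metric.closedBall Γ.cR Γ.rR ⊆ Metric.ball Γ.cinf Γ.rinf ∧
  Metric.closedBall Γ.cv Γ.rv ⊆ Metric.ball Γ.cinf Γ.rinf ∧
  (∀ j : ℕ, j ≤ N - n → ((y : ℂ) - j) ∈ Metric.ball Γ.cinf Γ.rinf) ∧
  (0 : ℂ) ∈ Metric.ball Γ.czero Γ.rzero ∧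
  (1 : ℂ) ∉ Metric.closedBall Γ.czero Γ.rzero ∧
  0 < Γ.rR ∧ 0 < Γ.rv

/-- `Δ_d^{(y_cut)}(u) = det ((u_α - y_β + 1)_{N-1} / (N-1)!)`. -/
def deltaCut (u : Fin d → ℂ) : ℂ :=
  (Matrix.of fun a b : Fin d =>
    rising (u a - (P.y b : ℂ) + 1) (N - 1) / ((N - 1).factorial : ℂ)).det

/-- `Δ̃_d^{(y_cut)}(w; u_2, …, u_d)`: the same determinant, with first row
`(w^{y_1}, …, w^{y_d})`. -/
def deltaCutTilde (w : ℂ) (u : Fin (d - 1) → ℂ) : ℂ :=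
  (Matrix.of fun a b : Fin d =>
    if h : (a : ℕ) = 0 then w ^ P.y b
    else rising (u ⟨(a : ℕ) - 1, by omega⟩ - (P.y b : ℂ) + 1) (N - 1)
      / ((N - 1).factorial : ℂ)).det

/-- The list `(v, u_2, …, u_d)`. -/
def consVar (v : ℂ) (u : Fin (d - 1) → ℂ) : Fin d → ℂ := fun a =>
  if h : (a : ℕ) = 0 then v else u ⟨(a : ℕ) - 1, by omega⟩

/-- The `d`-fold contour integral `Ω_𝓡(v, z)`. -/
def Omega (Γ : Contours) (v z : ℂ) : ℂ :=
  ((2 * Real.pi * Complex.I : ℂ)⁻¹) ^ d *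
    ∯ u in T((fun _ : Fin d => Γ.cR), (fun _ : Fin d => Γ.rR)),
      (∏ a, (1 / P.Q (u a)) * ((v - u a) / (z - u a))) * vdm u * P.deltaCut u

/-- The value `Ω_𝓡(0, 0)`, where the factors `(v - u_α)/(z - u_α)` are equal to `1`. -/
def Omega0 (Γ : Contours) : ℂ :=
  ((2 * Real.pi * Complex.I : ℂ)⁻¹) ^ d *
    ∯ u in T((fun _ : Fin d => Γ.cR), (fun _ : Fin d => Γ.rR)),
      (∏ a, 1 / P.Q (u a)) * vdm u * P.deltaCut u

/-- The `(d-1)`-fold contour integral `Ω̃^{(1)}_𝓡(v, w)`. -/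
def OmegaTilde (Γ : Contours) (v w : ℂ) : ℂ :=
  ((2 * Real.pi * Complex.I : ℂ)⁻¹) ^ (d - 1) *
    ∯ u in T((fun _ : Fin (d - 1) => Γ.cR), (fun _ : Fin (d - 1) => Γ.rR)),
      (∏ a, 1 / P.Q (u a)) * vdm (consVar v u) * P.deltaCutTilde w u

/-- `𝕂_0 = -(y-x+1)_{n-m-1} / (n-m-1)! · 1_{n>m} 1_{y≥x}`. -/
def K0 (p p' : ℕ × ℤ) : ℂ :=
  if p.1 < p'.1 ∧ p.2 ≤ p'.2 then
    -(rising ((p'.2 : ℂ) - p.2 + 1) (p'.1 - p.1 - 1) / ((p'.1 - p.1 - 1).factorial : ℂ))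
  else 0

/-- The factor `(v-x+1)_{N-m-1} / ((N-m-1)! Q(v))`, with the convention `1/(-1)! = 0` if
`m = N`. -/
def vFactor (p : ℕ × ℤ) (v : ℂ) : ℂ :=
  if p.1 < N then
    rising (v - p.2 + 1) (N - p.1 - 1) / (((N - p.1 - 1).factorial : ℂ) * P.Q v)
  else 0

/-- The term `𝕂_1`, a `(d+2)`-fold contour integral. -/
def K1 (Γ : Contours) (p p' : ℕ × ℤ) : ℂ :=
  (2 * Real.pi * Complex.I : ℂ)⁻¹ * ∮ v in C(Γ.cv, Γ.rv), P.vFactor p v *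
    ((2 * Real.pi * Complex.I : ℂ)⁻¹ * ∮ z in C(Γ.cinf, Γ.rinf),
      1 / (z - v) *
        (((N - p'.1).factorial : ℂ) * P.Q z / rising (z - p'.2) (N - p'.1 + 1)) *
        (P.Omega Γ v z / P.Omega0 Γ))

/-- The term `𝕂_2`, a `(d+1)`-fold contour integral. -/
def K2 (Γ : Contours) (p p' : ℕ × ℤ) : ℂ :=
  (2 * Real.pi * Complex.I : ℂ)⁻¹ * ∮ v in C(Γ.cv, Γ.rv), P.vFactor p v *
    ((d : ℂ) * ((2 * Real.pi * Complex.I : ℂ)⁻¹ * ∮ w in C(Γ.czero, Γ.rzero),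
      1 / (w ^ (p'.2 + 1) * (1 - w) ^ p'.1) * (P.OmegaTilde Γ v w / P.Omega0 Γ)))

end CutPolygon

end RedDot

end

noncomputable section

namespace RedDot

/-! ### Complete homogeneous symmetric functions of a geometric progression -/

/-! The proof has three ingredients: the process at `q = 1` is determinantal, the limit `q → 1` can
be taken after `M` is inverted explicitly, and the resulting finite sums are residue sums.

Correlations. Frozen dots at `-(i+1)` complete row `l` to length `d + N`, so that configurations
become interlacing chains from `yExt` to `x`. Summation over an interlacing row turns a determinant
of one-particle flows into another such determinant, by multilinearity and column operations
(`chainWeight_eq_det`). With unit weights this gives `det H = #configs` at `q = 1`, hence `det H ≠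
0`. With weight `1 + τ` at marked points the flow matrix becomes `Hᵀ + τ A C`, and the Sylvester
identity gives `det H * det (1 + τ K)` with `K = kern 1` (`sum_prod_eq_det`). The top coefficient in
`τ` is the joint probability of the marked points, up to the factor `det H`. Marked points on the
top line or to the left of every dot carry no dot; there a row of the kernel matrix vanishes.

The limit. The virtual rows of `M` are exponentials in `x_j` that all degenerate to constants as `q
→ 1`. On the range `r > -N`, however, `h_r` agrees with an exponential polynomial (`homExt`), so the
columns of `H` belonging to the added starting points are explicit combinations of these
exponentials. The coefficients of the combinations form `M⁻¹` (`qKernel_eq_kern`). The exponentials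
then recombine into `homExt`, and what remains, `kern q`, has a limit at `q = 1`.

Contour integrals. In `kern 1` the coefficient of `h_{x_j - x}` is the unique solution of the linear
system with matrix `Hᵀ`. The columns of the added starting points are polynomials of degree below
`N` in `x_j`. Lagrange interpolation at the `x_j` therefore solves those equations and leaves the
freedom to add `p(x_j) / Q'(x_j)` with `deg p < d`. The `d` remaining equations only involve nodes
in `𝓡` and fix `p` through a `d × d` Gram matrix (`coef_eq`). By Andréief's identity `Ω_𝓡(0,0)` is a
nonzero multiple of the determinant of this Gram matrix; `Ω_𝓡(v,z)` is the same for a perturbation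
that is of rank one up to a unipotent factor, and `Ω̃` produces cofactors. Evaluating the `z`- and
`w`-integrals, and then the residues in `v`, gives the same coefficients. -/

/-- `h_k(q^a, …, q^{a+n-1})`. -/
def homSym (q : ℝ) (a : ℕ) : ℕ → ℕ → ℝ
  | 0, 0 => 1
  | 0, _ + 1 => 0
  | _ + 1, 0 => 1
  | n + 1, k + 1 => homSym q a n (k + 1) + q ^ (a + n) * homSym q a (n + 1) k
  termination_by n k => (n, k)

@[simp] lemma homSym_zero_right (q : ℝ) (a n : ℕ) : homSym q a n 0 = 1 := by
  cases n <;> simp [homSym]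

@[simp] lemma homSym_zero_succ (q : ℝ) (a k : ℕ) : homSym q a 0 (k + 1) = 0 := by
  simp [homSym]

lemma homSym_succ_succ (q : ℝ) (a n k : ℕ) :
    homSym q a (n + 1) (k + 1) = homSym q a n (k + 1) + q ^ (a + n) * homSym q a (n + 1) k := by
  rw [homSym]

lemma continuous_homSym (a n k : ℕ) : Continuous fun q => homSym q a n k := by
  induction n generalizing k with
  | zero => cases k <;> simp [continuous_const]
  | succ n ihn =>
    induction k with
    | zero => simp [continuous_const]
    | succ k ihk =>
      simp only [homSym_succ_succ]
      exact (ihn _).add ((continuous_pow _).mul ihk)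

lemma homSym_one (a b n k : ℕ) : homSym 1 a n k = homSym 1 b n k := by
  induction n generalizing k with
  | zero => cases k <;> simp
  | succ n ihn =>
    induction k with
    | zero => simp
    | succ k ihk => simp [homSym_succ_succ, ihn (k + 1), ihk]

lemma homSym_shift {q : ℝ} (a b n k : ℕ) :
    homSym q (a + b) n k = q ^ (b * k) * homSym q a n k := by
  induction n generalizing k with
  | zero => cases k <;> simp
  | succ n ihn =>
    induction k with
    | zero => simp
    | succ k ihk => rw [homSym_succ_succ, homSym_succ_succ, ihn (k + 1), ihk]; ring

lemma homSym_nonneg {q : ℝ} (hq : 0 ≤ q) (a n k : ℕ) : 0 ≤ homSym q a n k := by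
  induction n generalizing k with
  | zero => cases k <;> simp
  | succ n ihn =>
    induction k with
    | zero => simp
    | succ k ihk => rw [homSym_succ_succ]; have := ihn (k + 1); positivity

/-- `h_r(q^a, …, q^{a+n-1})` for an integer `r`; zero for `r < 0`. -/
def homSymInt (q : ℝ) (a n : ℕ) (r : ℤ) : ℝ :=
  if 0 ≤ r then homSym q a n r.toNat else 0

lemma homSymInt_of_neg {q : ℝ} {a n : ℕ} {r : ℤ} (h : r < 0) : homSymInt q a n r = 0 := by
  simp [homSymInt, h]

@[simp] lemma homSymInt_natCast (q : ℝ) (a n k : ℕ) :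
    homSymInt q a n (k : ℤ) = homSym q a n k := by
  simp [homSymInt]

lemma homSymInt_zero (q : ℝ) (a : ℕ) (r : ℤ) :
    homSymInt q a 0 r = if r = 0 then 1 else 0 := by
  rcases lt_or_ge r 0 with h | h
  · rw [homSymInt_of_neg h, if_neg h.ne]
  · lift r to ℕ using h
    cases r
    · simp [homSymInt]
    · rw [homSymInt_natCast]; simp; omega

lemma homSymInt_succ (q : ℝ) (a n : ℕ) (r : ℤ) :
    homSymInt q a (n + 1) r
      = homSymInt q a n r + q ^ (a + n) * homSymInt q a (n + 1) (r - 1) := by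
  rcases lt_or_ge r 0 with h | h
  · simp [homSymInt_of_neg h, homSymInt_of_neg (show r - 1 < 0 by omega)]
  · lift r to ℕ using h
    cases r with
    | zero => simp [homSymInt]
    | succ k =>
      have : ((k + 1 : ℕ) : ℤ) - 1 = k := by push_cast; ring
      rw [this]
      simp only [homSymInt_natCast, homSym_succ_succ]

lemma continuous_homSymInt (a n : ℕ) (r : ℤ) : Continuous fun q => homSymInt q a n r := by
  unfold homSymInt
  split_ifs
  · exact continuous_homSym _ _ _
  · exact continuous_const

lemma homSymInt_one (a b n : ℕ) (r : ℤ) : homSymInt 1 a n r = homSymInt 1 b n r := by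
  unfold homSymInt; rw [homSym_one a b]

lemma homSymInt_one_one (a : ℕ) (r : ℤ) : homSymInt 1 a 1 r = if 0 ≤ r then 1 else 0 := by
  unfold homSymInt
  split_ifs
  · generalize r.toNat = k
    induction k with
    | zero => simp
    | succ k ih => simpa [homSym_succ_succ] using ih
  · rfl

/-- Summation of `h_r` over an interval of integers which contains the support to the left. -/
lemma sum_Icc_homSymInt (q : ℝ) (a n : ℕ) (lo s z : ℤ) (hs : lo ≤ s) :
    ∑ t ∈ Finset.Icc lo z, homSymInt q a n (t - s) * q ^ ((a + n : ℕ) * (z - t) : ℤ)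
      = homSymInt q a (n + 1) (z - s) := by
  rcases lt_or_ge z s with hz | hz
  · rw [homSymInt_of_neg (by omega)]
    refine Finset.sum_eq_zero fun t ht => ?_
    rw [Finset.mem_Icc] at ht
    rw [homSymInt_of_neg (by omega), zero_mul]
  · obtain ⟨k, rfl⟩ : ∃ k : ℕ, z = s + k := ⟨(z - s).toNat, by omega⟩
    induction k with
    | zero =>
      rw [Finset.sum_eq_single s]
      · simp [homSymInt]
      · intro t ht hts
        rw [Finset.mem_Icc] at ht
        rw [homSymInt_of_neg (by push_cast at ht; omega), zero_mul]
      · intro h; exact absurd (Finset.mem_Icc.2 ⟨hs, by simp⟩) h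
    | succ k ih =>
      specialize ih (by omega)
      have h1 : Finset.Icc lo (s + ((k + 1 : ℕ) : ℤ))
          = insert (s + ((k + 1 : ℕ) : ℤ)) (Finset.Icc lo (s + k)) := by
        ext t; simp only [Finset.mem_Icc, Finset.mem_insert]; push_cast; omega
      rw [h1, Finset.sum_insert (by simp)]
      have h2 : ∀ t ∈ Finset.Icc lo (s + (k : ℤ)),
          homSymInt q a n (t - s) * q ^ ((a + n : ℕ) * (s + ((k + 1 : ℕ) : ℤ) - t) : ℤ)
          = q ^ (a + n) *
            (homSymInt q a n (t - s) * q ^ ((a + n : ℕ) * (s + (k : ℤ) - t) : ℤ)) := by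
        intro t ht
        rw [Finset.mem_Icc] at ht
        obtain ⟨j, hj⟩ : ∃ j : ℕ, s + (k : ℤ) - t = j := ⟨(s + k - t).toNat, by omega⟩
        have e1 : s + ((k + 1 : ℕ) : ℤ) - t = ((j + 1 : ℕ) : ℤ) := by push_cast; omega
        rw [e1, hj, ← Nat.cast_mul, ← Nat.cast_mul, zpow_natCast, zpow_natCast]
        ring
      rw [Finset.sum_congr rfl h2, ← Finset.mul_sum, ih,
        homSymInt_succ q a n (s + ((k + 1 : ℕ) : ℤ) - s)]
      have e2 : s + ((k + 1 : ℕ) : ℤ) - s - 1 = s + k - s := by push_cast; ring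
      simp only [sub_self, mul_zero, zpow_zero, mul_one, e2]

/-! ### The extension to all integers -/

/-- The `q`-number `[s] = (1 - q^s) / (1 - q)`, equal to `s` for `q = 1`. -/
def qNum (q : ℝ) (s : ℤ) : ℝ := if q = 1 then (s : ℝ) else (1 - q ^ s) / (1 - q)

lemma qNum_one (s : ℤ) : qNum 1 s = s := by simp [qNum]

@[simp] lemma qNum_zero (q : ℝ) : qNum q 0 = 0 := by simp [qNum]

lemma qNum_add {q : ℝ} (hq : q ≠ 0) (r s : ℤ) :
    qNum q (r + s) = qNum q s + q ^ s * qNum q r := by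
  unfold qNum
  split_ifs with h
  · subst h; push_cast; simp; ring
  · rw [zpow_add₀ hq]
    have : 1 - q ≠ 0 := sub_ne_zero.2 (Ne.symm h)
    field_simp; ring

lemma qNum_pos {q : ℝ} (hq : 0 < q) (hq1 : q ≤ 1) (n : ℕ) : 0 < qNum q ((n : ℤ) + 1) := by
  unfold qNum
  split_ifs with h
  · push_cast; positivity
  · have h1 : q < 1 := lt_of_le_of_ne hq1 h
    have : q ^ ((n : ℤ) + 1) < 1 := by
      rw [show (n : ℤ) + 1 = ((n + 1 : ℕ) : ℤ) by push_cast; ring, zpow_natCast]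
      exact pow_lt_one₀ hq.le h1 (by omega)
    exact div_pos (by linarith) (by linarith)

/-- The limit is the derivative of `q ^ s` at `q = 1`, since `[s]` is a difference quotient. -/
lemma tendsto_qNum (s : ℤ) : Tendsto (fun q => qNum q s) (𝓝[<] 1) (𝓝 (s : ℝ)) := by
  have h := hasDerivAt_zpow s (1 : ℝ) (Or.inl one_ne_zero)
  rw [hasDerivAt_iff_tendsto_slope] at h
  have h2 := h.mono_left (nhdsWithin_mono (1 : ℝ)
    (show Set.Iio (1 : ℝ) ⊆ {1}ᶜ from fun q hq => ne_of_lt hq))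
  simp only [one_zpow, mul_one] at h2
  refine h2.congr' ?_
  filter_upwards [self_mem_nhdsWithin] with q hq
  have hq' : q ≠ 1 := ne_of_lt hq
  rw [qNum, if_neg hq', slope_def_field, one_zpow, ← neg_div_neg_eq]
  congr 1 <;> ring

/-- The extension of `homSymInt q a n` from `r > -n` to all integers, as an exponential
polynomial in `r`. -/
def homExt (q : ℝ) (a : ℕ) : ℕ → ℤ → ℝ
  | 0, _ => 0
  | n + 1, r => q ^ (a * r) * ∏ i ∈ Finset.range n, qNum q (r + i + 1) / qNum q ((i : ℤ) + 1)

/-- The `q`-Pascal rule, from `[r+n+1] = [n+1] + q^(n+1) [r]`. Unlike a truncated function, the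
extension satisfies the recursion of `h_r` for every integer `r`. -/
lemma homExt_succ {q : ℝ} (hq : 0 < q) (hq1 : q ≤ 1) (a n : ℕ) (r : ℤ) :
    homExt q a (n + 1) r = homExt q a n r + q ^ (a + n) * homExt q a (n + 1) (r - 1) := by
  have hshift : q ^ (a : ℕ) * q ^ ((a : ℤ) * (r - 1)) = q ^ ((a : ℤ) * r) := by
    rw [← zpow_natCast, ← zpow_add₀ hq.ne']; congr 1; ring
  cases n with
  | zero => simp [homExt, hshift]
  | succ n =>
    simp only [homExt, Finset.prod_div_distrib]
    rw [Finset.prod_range_succ (fun i : ℕ => qNum q (r + i + 1)),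
      Finset.prod_range_succ' (fun i : ℕ => qNum q (r - 1 + i + 1)),
      Finset.prod_range_succ (fun i : ℕ => qNum q ((i : ℤ) + 1))]
    have e : ∀ i ∈ Finset.range n, qNum q (r - 1 + ((i + 1 : ℕ) : ℤ) + 1) = qNum q (r + i + 1) := by
      intro i _; congr 1; push_cast; ring
    rw [Finset.prod_congr rfl e]
    have hne : ∏ i ∈ Finset.range n, qNum q ((i : ℤ) + 1) ≠ 0 :=
      Finset.prod_ne_zero_iff.2 fun i _ => (qNum_pos hq hq1 i).ne'
    have hne' := (qNum_pos hq hq1 n).ne'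
    have h3 : qNum q (r + n + 1) = qNum q ((n : ℤ) + 1) + q ^ (n + 1) * qNum q r := by
      rw [show r + n + 1 = r + ((n : ℤ) + 1) by ring, qNum_add hq.ne']
      congr 2
    have h4 : qNum q (r - 1 + ((0 : ℕ) : ℤ) + 1) = qNum q r := by congr 1; simp
    rw [h3, h4, pow_add, ← hshift]
    field_simp
    ring

/-- For `-n < r < 0` one of the factors of the product is `[0] = 0`, which matches the truncation.
For `r ≥ 0` both sides satisfy the same recursion. -/
lemma homExt_eq_homSymInt {q : ℝ} (hq : 0 < q) (hq1 : q ≤ 1) (a n : ℕ) (r : ℤ)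
    (hr : -(n : ℤ) < r) : homExt q a n r = homSymInt q a n r := by
  induction n generalizing r with
  | zero =>
    rw [homSymInt_zero, if_neg (by simp at hr; omega)]; rfl
  | succ n ihn =>
    rcases lt_or_ge r 0 with h | h
    · rw [homSymInt_of_neg h, homExt, Finset.prod_eq_zero (i := (-r - 1).toNat), mul_zero]
      · rw [Finset.mem_range]; push_cast at hr; omega
      · rw [show r + ((-r - 1).toNat : ℤ) + 1 = 0 by omega, qNum_zero, zero_div]
    · lift r to ℕ using h
      induction r with
      | zero =>
        simp only [homExt, homSymInt_natCast, homSym_zero_right]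
        simp only [Nat.cast_zero, mul_zero, zpow_zero, one_mul, zero_add]
        exact Finset.prod_eq_one fun i _ => div_self (qNum_pos hq hq1 i).ne'
      | succ k ihk =>
        rw [homExt_succ hq hq1, homSymInt_succ, ihn _ (by push_cast; omega)]
        have : ((k + 1 : ℕ) : ℤ) - 1 = k := by push_cast; ring
        rw [this, ihk (by push_cast; omega)]

lemma tendsto_homExt (a n : ℕ) (r : ℤ) :
    Tendsto (fun q => homExt q a n r) (𝓝[<] 1) (𝓝 (homExt 1 a n r)) := by
  cases n with
  | zero => exact tendsto_const_nhds
  | succ n =>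
    refine Tendsto.mul ?_ (tendsto_finsetProd _ fun i _ => Tendsto.div ?_ ?_ ?_)
    · exact ((continuousAt_zpow₀ 1 _ (Or.inl one_ne_zero)).tendsto).mono_left nhdsWithin_le_nhds
    · rw [qNum_one]; exact tendsto_qNum _
    · rw [qNum_one]; exact tendsto_qNum _
    · rw [qNum_one]; push_cast; positivity

/-- The generating function of complete homogeneous functions of a geometric progression. -/
lemma hSym_eq (q : ℝ) (a n : ℕ) (r : ℤ) :
    hSym (fun i : Fin n => q ^ (a + (i : ℕ))) r = homSymInt q a n r := by
  unfold hSym homSymInt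
  split_ifs
  · generalize r.toNat = k
    induction n generalizing k with
    | zero =>
      cases k
      · simp
      · simp [PowerSeries.coeff_one]
    | succ n ihn =>
      rw [Fin.prod_univ_castSucc]
      simp only [Fin.val_castSucc, Fin.val_last]
      set A := ∏ i : Fin n, (1 - PowerSeries.C (q ^ (a + (i : ℕ))) * PowerSeries.X : PowerSeries ℝ)⁻¹
        with hA
      set B := (1 - PowerSeries.C (q ^ (a + n)) * PowerSeries.X : PowerSeries ℝ) with hB
      have hBB : B⁻¹ * B = 1 := PowerSeries.inv_mul_cancel _ (by simp [hB])
      -- This is `B⁻¹ = 1 + q^(a+n) X B⁻¹` multiplied by `A`; its coefficients give the recursion of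
      -- `homSym`.
      have hrec : A * B⁻¹ = A + PowerSeries.C (q ^ (a + n)) * (A * B⁻¹ * PowerSeries.X) := by
        have : A * B⁻¹ * B = A := by rw [mul_assoc, hBB, mul_one]
        linear_combination this - (A * B⁻¹) * hB
      induction k with
      | zero =>
        have h0 := ihn 0
        rw [hrec]
        simp only [map_add, PowerSeries.coeff_C_mul]
        rw [h0, PowerSeries.coeff_zero_mul_X]; simp
      | succ k ihk =>
        rw [hrec]
        simp only [map_add, PowerSeries.coeff_C_mul, PowerSeries.coeff_succ_mul_X]
        rw [ihk, homSym_succ_succ, hA, ihn]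
  · rfl

/-- The index is `a + 1` because `φ_k` is geometric with ratio `q^(k-1)`. Each convolution is a
finite sum over `[x, z]` and adjoins one more variable to `h`. -/
lemma phiConv_eq (q : ℝ) (a r : ℕ) (x z : ℤ) :
    phiConv q (a + 1) r x z = homSymInt q a r (z - x) := by
  induction r generalizing z with
  | zero =>
    rw [homSymInt_zero]
    simp only [phiConv, sub_eq_zero, eq_comm]
  | succ r ih =>
    simp only [phiConv]
    rw [tsum_eq_sum (s := Finset.Icc x z), ← sum_Icc_homSymInt q a r x x z le_rfl]
    · refine Finset.sum_congr rfl fun t ht => ?_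
      rw [Finset.mem_Icc] at ht
      rw [ih, phi, if_pos ht.2]
      congr 3
      push_cast; ring
    · intro t ht
      rw [Finset.mem_Icc] at ht
      rw [ih, phi]
      by_cases h : x ≤ t
      · rw [if_neg (by omega), mul_zero]
      · rw [homSymInt_of_neg (by omega), zero_mul]

/-! ### The kernel after inversion of `M`, and its limit at `q = 1` -/

namespace CutPolygon

variable {d N : ℕ} (P : CutPolygon d N)

lemma H_apply (q : ℝ) (i j : Fin (d + N)) :
    P.H q i j = homSymInt q d N (P.x i - P.yExt j) := by
  rw [H, Matrix.of_apply, hSym_eq]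

lemma x_ge (i : Fin (d + N)) : -((d : ℤ) + N) ≤ P.x i := by
  have hi := i.2
  have := P.x_last ⟨d + N - 1, by omega⟩ (by simp only; omega)
  rw [← this]
  exact P.x_anti.antitone (by rw [Fin.le_def]; simp only; omega)

lemma yExt_of_lt {j : Fin (d + N)} (h : (j : ℕ) < d) : P.yExt j = P.y ⟨j, h⟩ := by
  simp [yExt, h]

lemma yExt_of_ge {j : Fin (d + N)} (h : d ≤ (j : ℕ)) : P.yExt j = -((j : ℤ) + 1) := by
  simp [yExt, h]

lemma yExt_anti : StrictAnti P.yExt := by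
  intro i j hij
  have hij' : (i : ℕ) < j := hij
  by_cases hj : (j : ℕ) < d
  · rw [P.yExt_of_lt hj, P.yExt_of_lt (hij'.trans hj)]
    exact P.y_anti hij
  · rw [P.yExt_of_ge (not_lt.1 hj)]
    by_cases hi : (i : ℕ) < d
    · rw [P.yExt_of_lt hi]
      have := P.y_left ⟨i, hi⟩
      omega
    · rw [P.yExt_of_ge (not_lt.1 hi)]
      omega

lemma yExt_ge (j : Fin (d + N)) : -((d : ℤ) + N) ≤ P.yExt j := by
  by_cases hj : (j : ℕ) < d
  · rw [P.yExt_of_lt hj]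
    have := P.y_left ⟨j, hj⟩
    omega
  · rw [P.yExt_of_ge (not_lt.1 hj)]
    have := j.2
    omega

/-- The function of the second point in the kernel: the flow of the `k`-th starting point to
level `n`, in its exponential polynomial form for the added starting points. -/
def colFun (q : ℝ) (n : ℕ) (k : Fin (d + N)) (y : ℤ) : ℝ :=
  if (k : ℕ) < d then homSymInt q d n (y - P.yExt k) else homExt q d n (y - P.yExt k)

/-- The kernel of the weighted process with the inverse of `M` carried out. -/
def kern (q : ℝ) (p p' : ℕ × ℤ) : ℝ :=
  -(if p.1 < p'.1 then homSymInt q (d + p.1) (p'.1 - p.1) (p'.2 - p.2) else 0)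
    + ∑ j, ∑ k, homSymInt q (d + p.1) (N - p.1) (P.x j - p.2) * (P.H q)⁻¹ k j
        * P.colFun q p'.1 k p'.2

lemma tendsto_kern (hdet : (P.H 1).det ≠ 0) (p p' : ℕ × ℤ) :
    Tendsto (fun q => P.kern q p p') (𝓝[<] 1) (𝓝 (P.kern 1 p p')) := by
  have hc : ∀ a n r, Tendsto (fun q => homSymInt q a n r) (𝓝[<] 1) (𝓝 (homSymInt 1 a n r)) :=
    fun a n r => (continuous_homSymInt a n r).continuousAt.tendsto.mono_left nhdsWithin_le_nhds
  have hH : Continuous P.H := by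
    refine continuous_matrix fun i j => ?_
    simp only [H_apply]
    exact continuous_homSymInt _ _ _
  have hinv : Tendsto (fun q => (P.H q)⁻¹) (𝓝[<] 1) (𝓝 (P.H 1)⁻¹) := by
    simp only [Matrix.inv_def, Ring.inverse_eq_inv']
    refine Tendsto.mono_left ?_ nhdsWithin_le_nhds
    exact ((hH.matrix_det.continuousAt).inv₀ hdet).smul hH.matrix_adjugate.continuousAt
  refine Tendsto.add (Tendsto.neg ?_) (tendsto_finsetSum _ fun j _ =>
    tendsto_finsetSum _ fun k _ => ((hc _ _ _).mul ?_).mul ?_)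
  · split_ifs
    · exact hc _ _ _
    · exact tendsto_const_nhds
  · exact (tendsto_pi_nhds.1 (tendsto_pi_nhds.1 hinv k) j)
  · unfold colFun
    split_ifs
    · exact hc _ _ _
    · exact tendsto_homExt _ _ _

end CutPolygon

/-! ### Interlacing chains and determinants -/

section Chains

variable {n : ℕ}

/-- The next entry of a decreasing sequence, with `lo - 1` after the last one. -/
def nextEntry (lo : ℤ) (z : Fin n → ℤ) (i : Fin n) : ℤ :=
  if h : (i : ℕ) + 1 < n then z ⟨i + 1, h⟩ else lo - 1

/-- The sequences `x` with `z (i + 1) < x i ≤ z i`, and `lo ≤ x i` for the last index. -/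
def interlacing (lo : ℤ) (z : Fin n → ℤ) : Finset (Fin n → ℤ) :=
  Fintype.piFinset fun i => Finset.Ioc (nextEntry lo z i) (z i)

lemma mem_interlacing {lo : ℤ} {z x : Fin n → ℤ} :
    x ∈ interlacing lo z ↔ ∀ i, nextEntry lo z i < x i ∧ x i ≤ z i := by
  simp [interlacing]

lemma nextEntry_ge {lo : ℤ} {z : Fin n → ℤ} (hlo : ∀ i, lo ≤ z i) (i : Fin n) :
    lo - 1 ≤ nextEntry lo z i := by
  unfold nextEntry
  split_ifs with h
  · have := hlo ⟨i + 1, h⟩; omega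
  · exact le_rfl

lemma nextEntry_lt {lo : ℤ} {z : Fin n → ℤ} (hz : StrictAnti z) (hlo : ∀ i, lo ≤ z i)
    (i : Fin n) : nextEntry lo z i < z i := by
  unfold nextEntry
  split_ifs with h
  · exact hz (by rw [Fin.lt_def]; simp)
  · have := hlo i; omega

lemma interlacing_ge {lo : ℤ} {z x : Fin n → ℤ} (hlo : ∀ i, lo ≤ z i)
    (hx : x ∈ interlacing lo z) (i : Fin n) : lo ≤ x i := by
  have h1 := (mem_interlacing.1 hx i).1
  have h2 := nextEntry_ge hlo i
  omega

lemma strictAnti_of_forall_next {x : Fin n → ℤ}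
    (h : ∀ (i : ℕ) (hi : i + 1 < n), x ⟨i + 1, hi⟩ < x ⟨i, by omega⟩) : StrictAnti x := by
  cases n with
  | zero => intro i; exact i.elim0
  | succ n =>
    refine Fin.strictAnti_iff_succ_lt.2 fun i => ?_
    exact h i (by omega)

lemma interlacing_strictAnti {lo : ℤ} {z x : Fin n → ℤ}
    (hx : x ∈ interlacing lo z) : StrictAnti x := by
  refine strictAnti_of_forall_next fun i hi => ?_
  have h1 := (mem_interlacing.1 hx ⟨i, by omega⟩).1
  have h2 := (mem_interlacing.1 hx ⟨i + 1, hi⟩).2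
  rw [nextEntry, dif_pos (by simpa using hi)] at h1
  exact h2.trans_lt h1

/-- Weighted one-particle flow: the level-`k` function started at the `j`-th point. -/
def flow (lo : ℤ) (y : Fin n → ℤ) (w : ℕ → ℤ → ℝ) : ℕ → Fin n → ℤ → ℝ
  | 0, j, z => if z = y j then 1 else 0
  | k + 1, j, z => ∑ t ∈ Finset.Icc lo z, flow lo y w k j t * w k t

/-- Weighted count of interlacing chains from `y` at level `0` to `z` at level `k`. -/
def chainWeight (lo : ℤ) (y : Fin n → ℤ) (w : ℕ → ℤ → ℝ) : ℕ → (Fin n → ℤ) → ℝ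
  | 0, z => if z = y then 1 else 0
  | k + 1, z => ∑ x ∈ interlacing lo z, chainWeight lo y w k x * ∏ i, w k (x i)

lemma sum_piFinset_det (s : Fin n → Finset ℤ) (g : Fin n → Fin n → ℤ → ℝ) :
    ∑ x ∈ Fintype.piFinset s, (Matrix.of fun j i => g j i (x i)).det
      = (Matrix.of fun j i => ∑ t ∈ s i, g j i t).det := by
  simp only [Matrix.det_apply, Matrix.of_apply]
  rw [Finset.sum_comm]
  refine Finset.sum_congr rfl fun σ _ => ?_
  rw [← Finset.smul_sum, Finset.prod_univ_sum]

/-- Subtracting from each column the next one is right multiplication by a unipotent lower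
triangular matrix. -/
lemma det_sub_next (f : Fin n → Fin n → ℝ) :
    (Matrix.of fun j i : Fin n => f j i - if h : (i : ℕ) + 1 < n then f j ⟨i + 1, h⟩ else 0).det
      = (Matrix.of f).det := by
  set L : Matrix (Fin n) (Fin n) ℝ := Matrix.of fun k i =>
    (if k = i then 1 else 0) - if (k : ℕ) = i + 1 then 1 else 0 with hL
  have h1 : (Matrix.of fun j i : Fin n =>
      f j i - if h : (i : ℕ) + 1 < n then f j ⟨i + 1, h⟩ else 0) = Matrix.of f * L := by
    ext j i
    simp only [Matrix.mul_apply, Matrix.of_apply, hL, mul_sub, mul_ite, mul_one, mul_zero,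
      Finset.sum_sub_distrib, Finset.sum_ite_eq', Finset.mem_univ, if_true]
    congr 1
    split_ifs with h
    · rw [Finset.sum_eq_single ⟨i + 1, h⟩]
      · simp
      · intro k _ hk
        rw [if_neg]
        intro hk'; exact hk (Fin.ext hk')
      · simp
    · symm
      refine Finset.sum_eq_zero fun k _ => if_neg ?_
      have := k.2; omega
  have h2 : L.det = 1 := by
    rw [Matrix.det_of_isLowerTriangular]
    · refine Finset.prod_eq_one fun i _ => ?_
      simp [hL]
    · intro i j hij
      have hij' : (i : ℕ) < j := hij
      simp only [hL, Matrix.of_apply]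
      rw [if_neg (by rintro rfl; omega), if_neg (by omega), sub_zero]
  rw [h1, Matrix.det_mul, h2, mul_one]

/-- Two different strictly decreasing sequences of the same length have different ranges, so some `z
i` is missing from `y` and its column is zero. -/
lemma det_indicator {y z : Fin n → ℤ} (hy : StrictAnti y) (hz : StrictAnti z) :
    (Matrix.of fun j i : Fin n => if z i = y j then (1 : ℝ) else 0).det
      = if z = y then 1 else 0 := by
  split_ifs with h
  · subst h
    convert Matrix.det_one (n := Fin n) (R := ℝ) using 2
    ext j i
    simp [Matrix.one_apply, hz.injective.eq_iff, eq_comm]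
  · have : ∃ i, ∀ j, z i ≠ y j := by
      by_contra! hcon
      refine h ?_
      have hsub : Set.range z ⊆ Set.range y := by
        rintro _ ⟨i, rfl⟩
        obtain ⟨j, hj⟩ := hcon i
        exact ⟨j, hj.symm⟩
      have hcard : Finset.image z Finset.univ = Finset.image y Finset.univ := by
        refine Finset.eq_of_subset_of_card_le ?_ ?_
        · intro t ht
          simp only [Finset.mem_image, Finset.mem_univ, true_and] at ht ⊢
          exact hsub ht
        · rw [Finset.card_image_of_injective _ hz.injective,
            Finset.card_image_of_injective _ hy.injective]
      have hrange : Set.range z = Set.range y := by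
        have := congrArg (fun s : Finset ℤ => (s : Set ℤ)) hcard
        simpa using this
      have hz' : StrictMono (fun i => -z i) := fun i j hij => neg_lt_neg (hz hij)
      have hy' : StrictMono (fun i => -y i) := fun i j hij => neg_lt_neg (hy hij)
      have hr' : Set.range (fun i => -z i) = Set.range (fun i => -y i) := by
        have e : ∀ f : Fin n → ℤ, Set.range (fun i => -f i) = (fun t => -t) '' Set.range f := by
          intro f; rw [← Set.range_comp]; rfl
        rw [e z, e y, hrange]
      have := (StrictMono.range_inj hz' hy').1 hr'
      funext i
      exact neg_injective (congrFun this i)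
    obtain ⟨i, hi⟩ := this
    exact Matrix.det_eq_zero_of_column_eq_zero i fun j => by simp [hi j]

/-- The interlacing row ranges over a product of disjoint intervals, one for each column, so
multilinearity moves the sum into the columns. A sum over `(z (i+1), z i]` is the difference of two
consecutive values of the next flow, and `det_sub_next` removes the subtracted columns. -/
lemma chainWeight_eq_det {lo : ℤ} {y : Fin n → ℤ} (hy : StrictAnti y) (w : ℕ → ℤ → ℝ) (k : ℕ)
    {z : Fin n → ℤ} (hz : StrictAnti z) (hlo : ∀ i, lo ≤ z i) :
    chainWeight lo y w k z = (Matrix.of fun j i => flow lo y w k j (z i)).det := by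
  induction k generalizing z with
  | zero =>
    simp only [chainWeight, flow]
    rw [det_indicator hy hz]
  | succ k ih =>
    rw [chainWeight]
    have h1 : ∀ x ∈ interlacing lo z, chainWeight lo y w k x * ∏ i, w k (x i)
        = (Matrix.of fun j i => flow lo y w k j (x i) * w k (x i)).det := by
      intro x hx
      rw [ih (interlacing_strictAnti hx) (interlacing_ge hlo hx), mul_comm,
        ← Matrix.det_mul_row]
      congr 1
      ext j i
      simp [mul_comm]
    rw [Finset.sum_congr rfl h1, interlacing,
      sum_piFinset_det _ fun j i t => flow lo y w k j t * w k t,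
      ← det_sub_next fun j i => flow lo y w (k + 1) j (z i)]
    congr 1
    ext j i
    simp only [Matrix.of_apply, flow]
    have h2 : ∑ t ∈ Finset.Icc lo (z i), flow lo y w k j t * w k t
        = ∑ t ∈ Finset.Icc lo (nextEntry lo z i), flow lo y w k j t * w k t
          + ∑ t ∈ Finset.Ioc (nextEntry lo z i) (z i), flow lo y w k j t * w k t := by
      rw [← Finset.sum_union]
      · congr 1
        ext t
        have := nextEntry_ge hlo i
        have := nextEntry_lt hz hlo i
        simp only [Finset.mem_union, Finset.mem_Icc, Finset.mem_Ioc]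
        omega
      · rw [Finset.disjoint_left]
        intro t ht ht'
        simp only [Finset.mem_Icc, Finset.mem_Ioc] at ht ht'
        omega
    rw [h2, add_comm, eq_comm, sub_eq_iff_eq_add]
    congr 1
    unfold nextEntry
    split_ifs with h
    · rfl
    · simp

/-- The interlacing chains from `y` at level `0` to `z` at level `k` (constant from there on). -/
def chains (lo : ℤ) (y : Fin n → ℤ) : ℕ → (Fin n → ℤ) → Finset (ℕ → Fin n → ℤ)
  | 0, z => if z = y then {fun _ => z} else ∅
  | k + 1, z => by
    classical
    exact (interlacing lo z).biUnion fun x =>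
      (chains lo y k x).image fun X l => if l ≤ k then X l else z

lemma mem_chains {lo : ℤ} {y : Fin n → ℤ} {k : ℕ} {z : Fin n → ℤ} {X : ℕ → Fin n → ℤ} :
    X ∈ chains lo y k z ↔ X 0 = y ∧ (∀ l, k ≤ l → X l = z) ∧
      ∀ l < k, X l ∈ interlacing lo (X (l + 1)) := by
  induction k generalizing z X with
  | zero =>
    simp only [chains]
    split_ifs with h
    · subst h
      rw [Finset.mem_singleton]
      constructor
      · rintro rfl; simp
      · rintro ⟨_, h2, _⟩
        funext l
        exact h2 l (Nat.zero_le _)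
    · simp only [Finset.notMem_empty, false_iff]
      rintro ⟨h1, h2, _⟩
      exact h ((h2 0 le_rfl).symm.trans h1)
  | succ k ih =>
    simp only [chains, Finset.mem_biUnion, Finset.mem_image]
    constructor
    · rintro ⟨x, hx, X', hX', rfl⟩
      obtain ⟨h1, h2, h3⟩ := ih.1 hX'
      refine ⟨by simpa using h1, fun l hl => if_neg (by omega), fun l hl => ?_⟩
      beta_reduce
      rw [if_pos (show l ≤ k by omega)]
      by_cases hlk : l = k
      · subst hlk
        rw [if_neg (show ¬ l + 1 ≤ l by omega), h2 l le_rfl]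
        exact hx
      · rw [if_pos (show l + 1 ≤ k by omega)]
        exact h3 l (by omega)
    · rintro ⟨h1, h2, h3⟩
      refine ⟨X k, ?_, fun l => X (min l k), ih.2 ⟨by simpa using h1, fun l hl => ?_,
        fun l hl => ?_⟩, ?_⟩
      · have := h3 k (by omega)
        rwa [h2 (k + 1) le_rfl] at this
      · rw [min_eq_right hl]
      · rw [min_eq_left hl.le, min_eq_left hl]
        exact h3 l (by omega)
      · funext l
        split_ifs with h
        · beta_reduce
          rw [min_eq_left h]
        · exact (h2 l (by omega)).symm

lemma sum_chains {lo : ℤ} {y : Fin n → ℤ} (w : ℕ → ℤ → ℝ) (k : ℕ) (z : Fin n → ℤ) :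
    ∑ X ∈ chains lo y k z, ∏ l ∈ Finset.range k, ∏ i, w l (X l i) = chainWeight lo y w k z := by
  induction k generalizing z with
  | zero =>
    simp only [chains, chainWeight]
    split_ifs <;> simp
  | succ k ih =>
    classical
    simp only [chains, chainWeight]
    rw [Finset.sum_biUnion]
    · refine Finset.sum_congr rfl fun x _ => ?_
      rw [Finset.sum_image, ← ih, Finset.sum_mul]
      · refine Finset.sum_congr rfl fun X hX => ?_
        rw [Finset.prod_range_succ]
        congr 1
        · refine Finset.prod_congr rfl fun l hl => ?_
          rw [Finset.mem_range] at hl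
          beta_reduce
          rw [if_pos hl.le]
        · beta_reduce
          rw [if_pos le_rfl, (mem_chains.1 hX).2.1 k le_rfl]
      · intro X hX X' hX' h
        have hX := (mem_chains.1 hX).2.1
        have hX' := (mem_chains.1 hX').2.1
        funext l
        by_cases hl : l ≤ k
        · simpa [hl] using congrFun h l
        · rw [hX l (by omega), hX' l (by omega)]
    · intro x _ x' _ hxx'
      rw [Function.onFun, Finset.disjoint_left]
      intro X hX hX'
      simp only [Finset.mem_image] at hX hX'
      obtain ⟨A, hA, rfl⟩ := hX
      obtain ⟨B, hB, hAB⟩ := hX'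
      apply hxx'
      have := congrFun hAB k
      simp only [le_refl, if_true] at this
      rw [← (mem_chains.1 hA).2.1 k le_rfl, ← (mem_chains.1 hB).2.1 k le_rfl, this]

end Chains

namespace CutPolygon

variable {d N : ℕ} (P : CutPolygon d N)

/-! ### Red-dot configurations as chains of rows of equal length -/

/-- A configuration, extended by frozen dots at `-(i+1)` for the indices `i ≥ d + l` of row `l`,
and by copies of the top row. -/
def extend (X : (k : Fin (N + 1)) → Fin (d + (k : ℕ)) → ℤ) (l : ℕ) (i : Fin (d + N)) : ℤ :=
  if hl : l < N + 1 then
    if hi : (i : ℕ) < d + l then X ⟨l, hl⟩ ⟨i, hi⟩ else -((i : ℤ) + 1)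
  else P.x i

lemma extend_of_lt (X : (k : Fin (N + 1)) → Fin (d + (k : ℕ)) → ℤ) {l : ℕ} {i : Fin (d + N)}
    (hl : l < N + 1) (hi : (i : ℕ) < d + l) : P.extend X l i = X ⟨l, hl⟩ ⟨i, hi⟩ := by
  simp [extend, hl, hi]

lemma extend_of_ge (X : (k : Fin (N + 1)) → Fin (d + (k : ℕ)) → ℤ) {l : ℕ} {i : Fin (d + N)}
    (hl : l < N + 1) (hi : d + l ≤ (i : ℕ)) : P.extend X l i = -((i : ℤ) + 1) := by
  simp [extend, hl, hi]

/-- The last dot of a row lies strictly to the right of the last dot of the next row, and the last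
dot of the top row is at least `-d-N`. This is the inequality needed for interlacing with the first
frozen dot. -/
lemma configs_last_ge {X : (k : Fin (N + 1)) → Fin (d + (k : ℕ)) → ℤ} (hX : X ∈ P.configs)
    (j l : ℕ) (hl : l < N + 1) (hj : l + j = N) (i : ℕ) (hi : i < d + l) (hi' : i + 1 = d + l) :
    -((i : ℤ) + 1) ≤ X ⟨l, hl⟩ ⟨i, hi⟩ := by
  obtain ⟨-, h2, h3⟩ := hX
  induction j generalizing l i with
  | zero =>
    obtain rfl : l = N := by omega
    rw [h2 i (by omega)]
    have := P.x_ge ⟨i, by omega⟩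
    omega
  | succ j ih =>
    have h4 := (h3 l (by omega) i hi).1
    have h5 := ih (l + 1) (by omega) (by omega) (i + 1) (by omega) (by omega)
    push_cast at h5
    omega

lemma extend_mem_chains {X : (k : Fin (N + 1)) → Fin (d + (k : ℕ)) → ℤ} (hX : X ∈ P.configs) :
    P.extend X ∈ chains (-((d : ℤ) + N)) P.yExt N P.x := by
  have hlast := P.configs_last_ge hX
  obtain ⟨h1, h2, h3⟩ := hX
  rw [mem_chains]
  refine ⟨?_, ?_, ?_⟩
  · funext i
    by_cases hi : (i : ℕ) < d
    · rw [P.extend_of_lt X (by omega) (by simpa using hi), h1 i hi, P.yExt_of_lt hi]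
    · rw [P.extend_of_ge X (by omega) (by omega), P.yExt_of_ge (by omega)]
  · intro l hl
    funext i
    rcases hl.eq_or_lt with rfl | hl
    · rw [P.extend_of_lt X (by omega) i.2, h2 i i.2]
    · simp [extend, show ¬ l < N + 1 by omega]
  · intro l hl
    rw [mem_interlacing]
    intro i
    by_cases hi : (i : ℕ) < d + l
    · rw [P.extend_of_lt X (by omega) hi, P.extend_of_lt X (by omega) (by omega)]
      refine ⟨?_, (h3 l hl i hi).2⟩
      rw [nextEntry, dif_pos (by omega), P.extend_of_lt X (by omega) (by simp only; omega)]
      exact (h3 l hl i hi).1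
    · rw [P.extend_of_ge X (by omega) (by omega)]
      constructor
      · unfold nextEntry
        split_ifs with h
        · rw [P.extend_of_ge X (by omega) (by simp only; omega)]
          push_cast; omega
        · have := i.2; omega
      · by_cases hi' : (i : ℕ) = d + l
        · rw [P.extend_of_lt X (by omega) (by omega)]
          exact hlast (N - (l + 1)) (l + 1) (by omega) (by omega) i (by omega) (by omega)
        · rw [P.extend_of_ge X (by omega) (by omega)]

/-- By induction on the level. The new entry `i` is at least the old entry `i`, which is `-(i+1)`,
and is strictly less than the old entry `i-1`, which is `-i`; only one integer is left. -/
lemma chains_frozen {Y : ℕ → Fin (d + N) → ℤ}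
    (hY : Y ∈ chains (-((d : ℤ) + N)) P.yExt N P.x) (l : ℕ) (hl : l ≤ N) (i : Fin (d + N))
    (hi : d + l ≤ (i : ℕ)) : Y l i = -((i : ℤ) + 1) := by
  obtain ⟨h1, -, h3⟩ := mem_chains.1 hY
  induction l generalizing i with
  | zero => rw [h1, P.yExt_of_ge (by omega)]
  | succ l ih =>
    have hiN := i.2
    have h4 := ih (by omega) ⟨i - 1, by omega⟩ (by simp only; omega)
    have h5 := ih (by omega) i (by omega)
    have h6 := mem_interlacing.1 (h3 l (by omega))
    have h7 := (h6 ⟨i - 1, by omega⟩).1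
    have h8 := (h6 i).2
    rw [nextEntry, dif_pos (by simp only; omega)] at h7
    have e : (⟨(i : ℕ) - 1 + 1, by omega⟩ : Fin (d + N)) = i := Fin.ext (by simp only; omega)
    simp only [e] at h7
    simp only at h4
    omega

/-- The configuration cut out of a chain. -/
def cut (Y : ℕ → Fin (d + N) → ℤ) (k : Fin (N + 1)) (i : Fin (d + (k : ℕ))) : ℤ :=
  Y k ⟨i, by omega⟩

lemma extend_cut {Y : ℕ → Fin (d + N) → ℤ}
    (hY : Y ∈ chains (-((d : ℤ) + N)) P.yExt N P.x) : P.extend (cut Y) = Y := by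
  funext l i
  by_cases hl : l < N + 1
  · by_cases hi : (i : ℕ) < d + l
    · rw [P.extend_of_lt _ hl hi]; rfl
    · rw [P.extend_of_ge _ hl (by omega), P.chains_frozen hY l (by omega) i (by omega)]
  · rw [(mem_chains.1 hY).2.1 l (by omega)]
    simp [extend, hl]

lemma cut_mem_configs {Y : ℕ → Fin (d + N) → ℤ}
    (hY : Y ∈ chains (-((d : ℤ) + N)) P.yExt N P.x) : cut Y ∈ P.configs := by
  obtain ⟨h1, h2, h3⟩ := mem_chains.1 hY
  refine ⟨fun i hi => ?_, fun i hi => ?_, fun k hk i hi => ⟨?_, ?_⟩⟩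
  · rw [cut, h1, P.yExt_of_lt (by simpa using hi)]
  · rw [cut, h2 _ le_rfl]
  · have := (mem_interlacing.1 (h3 k hk) ⟨i, by omega⟩).1
    rw [nextEntry, dif_pos (by simp only; omega)] at this
    exact this
  · exact (mem_interlacing.1 (h3 k hk) ⟨i, by omega⟩).2

lemma extend_injective : Function.Injective P.extend := by
  intro X X' h
  funext k i
  have := congrFun (congrFun h k) ⟨i, by omega⟩
  rwa [P.extend_of_lt X k.2 i.2, P.extend_of_lt X' k.2 i.2] at this

/-- The frozen dots of a row lie strictly to the left of `-d - p.1`, so the lower bound on the point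
excludes confusion with them. -/
lemma hasDot_iff {X : (k : Fin (N + 1)) → Fin (d + (k : ℕ)) → ℤ} {p : ℕ × ℤ} (hp : p.1 ≤ N)
    (hp' : -((d : ℤ) + p.1) ≤ p.2) : HasDot X p ↔ ∃ i, P.extend X p.1 i = p.2 := by
  constructor
  · rintro ⟨h, i, hi⟩
    exact ⟨⟨i, by omega⟩, by rw [P.extend_of_lt X h i.2, ← hi]⟩
  · rintro ⟨i, hi⟩
    have h : (i : ℕ) < d + p.1 := by
      by_contra hcon
      rw [P.extend_of_ge X (by omega) (by omega)] at hi
      omega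
    rw [P.extend_of_lt X (by omega) h] at hi
    exact ⟨by omega, ⟨i, h⟩, hi⟩

open Classical in
lemma ncard_configs_inter {k : ℕ} (p : Fin k → ℕ × ℤ) (hp : ∀ i, (p i).1 ≤ N)
    (hp' : ∀ i, -((d : ℤ) + (p i).1) ≤ (p i).2) :
    (P.configs ∩ {X | ∀ i, HasDot X (p i)}).ncard
      = ((chains (-((d : ℤ) + N)) P.yExt N P.x).filter
          fun Y => ∀ i, ∃ j, Y (p i).1 j = (p i).2).card := by
  rw [← Set.ncard_coe_finset]
  refine Set.ncard_congr (fun X _ => P.extend X) ?_ ?_ ?_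
  · rintro X ⟨hX, hX'⟩
    simp only [Finset.coe_filter, Set.mem_ofPred_eq]
    exact ⟨P.extend_mem_chains hX, fun i => (P.hasDot_iff (hp i) (hp' i)).1 (hX' i)⟩
  · intro X X' _ _ h
    exact P.extend_injective h
  · intro Y hY
    simp only [Finset.coe_filter, Set.mem_ofPred_eq] at hY
    refine ⟨cut Y, ⟨P.cut_mem_configs hY.1, fun i => ?_⟩, P.extend_cut hY.1⟩
    rw [P.hasDot_iff (hp i) (hp' i), P.extend_cut hY.1]
    exact hY.2 i

lemma ncard_configs :
    P.configs.ncard = (chains (-((d : ℤ) + N)) P.yExt N P.x).card := by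
  classical
  have := P.ncard_configs_inter (k := 0) Fin.elim0 (fun i => i.elim0) (fun i => i.elim0)
  simpa using this

lemma flow_one (k : ℕ) (j : Fin (d + N)) (z : ℤ) :
    flow (-((d : ℤ) + N)) P.yExt (fun _ _ => 1) k j z = homSymInt 1 0 k (z - P.yExt j) := by
  induction k generalizing z with
  | zero =>
    rw [homSymInt_zero, flow]
    simp only [sub_eq_zero]
  | succ k ih =>
    rw [flow, ← sum_Icc_homSymInt 1 0 k _ _ z (P.yExt_ge j)]
    refine Finset.sum_congr rfl fun t _ => ?_
    rw [ih, one_zpow]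

/-- The number of configurations is a determinant. -/
lemma det_H_one : (P.H 1).det = P.configs.ncard := by
  rw [P.ncard_configs]
  have h := sum_chains (lo := -((d : ℤ) + N)) (y := P.yExt) (fun _ _ => 1) N P.x
  rw [chainWeight_eq_det P.yExt_anti _ _ P.x_anti P.x_ge] at h
  simp only [Finset.prod_const_one, Finset.sum_const, nsmul_eq_mul, mul_one] at h
  rw [h, ← Matrix.det_transpose]
  congr 1
  ext i j
  rw [Matrix.transpose_apply, H_apply, Matrix.of_apply, flow_one, homSymInt_one d 0]

lemma det_H_one_pos (hP : P.configs.Nonempty) : 0 < (P.H 1).det := by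
  rw [P.det_H_one, P.ncard_configs]
  obtain ⟨X, hX⟩ := hP
  exact_mod_cast Finset.card_pos.2 ⟨_, P.extend_mem_chains hX⟩

end CutPolygon

/-! ### The polynomials `binom (r + n - 1) (n - 1)` -/

/-- The polynomial `(X+1)⋯(X+n-1) / (n-1)!`, and `0` for `n = 0`. -/
def binPoly (K : Type*) [Field K] : ℕ → Polynomial K
  | 0 => 0
  | n + 1 => ∏ i ∈ Finset.range n,
      (Polynomial.C ((i : K) + 1)⁻¹ * (Polynomial.X + Polynomial.C ((i : K) + 1)))

lemma homExt_one (a n : ℕ) (r : ℤ) : homExt 1 a n r = (binPoly ℝ n).eval (r : ℝ) := by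
  cases n with
  | zero => simp [homExt, binPoly]
  | succ n =>
    simp only [homExt, binPoly, Polynomial.eval_prod, one_zpow, one_mul]
    refine Finset.prod_congr rfl fun i _ => ?_
    simp [qNum_one, div_eq_inv_mul, add_assoc]

lemma eval_binPoly_ofReal (n : ℕ) (r : ℝ) :
    (((binPoly ℝ n).eval r : ℝ) : ℂ) = (binPoly ℂ n).eval (r : ℂ) := by
  cases n with
  | zero => simp [binPoly]
  | succ n => simp [binPoly, Polynomial.eval_prod]

lemma natDegree_binPoly_le (K : Type*) [Field K] (n : ℕ) :
    (binPoly K n).natDegree ≤ n - 1 := by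
  cases n with
  | zero => simp [binPoly]
  | succ n =>
    rw [binPoly]
    refine (Polynomial.natDegree_prod_le _ _).trans ?_
    refine (Finset.sum_le_card_nsmul _ _ 1 fun i _ => ?_).trans (by simp)
    exact (Polynomial.natDegree_C_mul_le _ _).trans (Polynomial.natDegree_X_add_C _).le

/-! ### The Eynard–Mehta determinant evaluation -/

section Determinant

variable {ι κ : Type*} [Fintype ι] [DecidableEq ι] [Fintype κ] [DecidableEq κ]

/-- By the Sylvester identity the ratio of determinants is `det (1 + τ C G⁻¹ A)`. Multiplying on the
right by `1 - τ L`, of determinant `1`, replaces `A` by `A (1 - τ L) = B` and produces the term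
`-L`. -/
lemma det_add_mul_eq {R : Type*} [Field R] (τ : R) (A B : Matrix ι κ R) (L : Matrix κ κ R)
    (C : Matrix κ ι R) (G : Matrix ι ι R) (hG : G.det ≠ 0) (hA : A = B + τ • (A * L))
    (hL : (1 - τ • L).det = 1) :
    (G + τ • (A * C)).det = G.det * (1 + τ • (C * G⁻¹ * B - L)).det := by
  have hu : IsUnit G.det := isUnit_iff_ne_zero.2 hG
  have h1 : G + τ • (A * C) = G * (1 + (G⁻¹ * A) * (τ • C)) := by
    rw [mul_add, mul_one, ← Matrix.mul_assoc, ← Matrix.mul_assoc, Matrix.mul_nonsing_inv _ hu,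
      Matrix.one_mul, Matrix.mul_smul]
  rw [h1, Matrix.det_mul, Matrix.det_one_add_mul_comm]
  congr 1
  rw [← mul_one (Matrix.det _), ← hL, ← Matrix.det_mul]
  congr 1
  have hB : B = A - τ • (A * L) := eq_sub_of_add_eq hA.symm
  rw [hB]
  simp only [mul_sub, add_mul, mul_one, one_mul, Matrix.smul_mul, Matrix.mul_smul,
    Matrix.mul_assoc, smul_sub, Matrix.mul_sub]
  abel

/-- Nonzero entries of `L` strictly raise the level, so `1 - τ L` is block triangular with identity
blocks. -/
lemma det_one_sub_smul_of_level {R : Type*} [CommRing R] (τ : R) (L : Matrix κ κ R) (lev : κ → ℕ)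
    (hL : ∀ i j, lev j ≤ lev i → L i j = 0) : (1 - τ • L).det = 1 := by
  have hbt : Matrix.BlockTriangular (1 - τ • L) lev := by
    intro i j hij
    have : i ≠ j := by rintro rfl; exact lt_irrefl _ hij
    simp [Matrix.one_apply_ne this, hL i j hij.le]
  rw [hbt.det]
  refine Finset.prod_eq_one fun a _ => ?_
  convert Matrix.det_one (R := R) (n := {i // lev i = a}) using 2
  ext i j
  have := hL i j (by rw [i.2, j.2])
  simp [Matrix.toSquareBlock, Matrix.toSquareBlockProp, Matrix.one_apply, this, Subtype.ext_iff]

end Determinant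

lemma prod_one_add_ite {α R : Type*} [CommSemiring R] (s : Finset α) (Q : α → Prop)
    [DecidablePred Q] (τ : R) [Decidable (∃ a ∈ s, Q a)]
    (h : ∀ a ∈ s, ∀ b ∈ s, Q a → Q b → a = b) :
    ∏ a ∈ s, (1 + τ * if Q a then 1 else 0) = 1 + τ * if ∃ a ∈ s, Q a then 1 else 0 := by
  split_ifs with hex
  · obtain ⟨a, ha, hQ⟩ := hex
    rw [Finset.prod_eq_single_of_mem a ha]
    · rw [if_pos hQ]
    · intro b hb hba
      rw [if_neg fun hQb => hba (h b hb a ha hQb hQ), mul_zero, add_zero]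
  · push Not at hex
    rw [mul_zero, add_zero]
    refine Finset.prod_eq_one fun a ha => ?_
    rw [if_neg (hex a ha), mul_zero, add_zero]

/-! ### The kernel at `q = 1`: linear system, and points without dots -/

namespace CutPolygon

variable {d N : ℕ} (P : CutPolygon d N)

/-- The coefficients `c_j` in `K(m, x; n, y) = -φ + ∑ j, Φ(x, x_j) c_j`. -/
def coef (n : ℕ) (y : ℤ) (j : Fin (d + N)) : ℝ := ∑ k, (P.H 1)⁻¹ k j * P.colFun 1 n k y

lemma kern_one (p p' : ℕ × ℤ) :
    P.kern 1 p p' = -(if p.1 < p'.1 then homSymInt 1 0 (p'.1 - p.1) (p'.2 - p.2) else 0)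
      + ∑ j, homSymInt 1 0 (N - p.1) (P.x j - p.2) * P.coef p'.1 p'.2 j := by
  simp only [kern, coef, Finset.mul_sum, mul_assoc, homSymInt_one (d + p.1) 0]

lemma sum_H_mul_coef (hdet : (P.H 1).det ≠ 0) (n : ℕ) (y : ℤ) (k : Fin (d + N)) :
    ∑ j, P.H 1 j k * P.coef n y j = P.colFun 1 n k y := by
  have h : ∑ j, P.H 1 j k * P.coef n y j
      = ∑ l, ((P.H 1)⁻¹ * P.H 1) l k * P.colFun 1 n l y := by
    simp only [coef, Finset.mul_sum, Matrix.mul_apply, Finset.sum_mul]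
    rw [Finset.sum_comm]
    refine Finset.sum_congr rfl fun l _ => Finset.sum_congr rfl fun j _ => by ring
  rw [h, Matrix.nonsing_inv_mul _ (isUnit_iff_ne_zero.2 hdet)]
  simp [Matrix.one_apply]

/-- For the added starting points `x_j - y_k ≥ -N + 1`, so the polynomial formula holds at every
node without truncation. -/
lemma H_one_of_ge {k : Fin (d + N)} (hk : d ≤ (k : ℕ)) (j : Fin (d + N)) :
    P.H 1 j k = homExt 1 0 N (P.x j + (k + 1)) := by
  rw [H_apply, homSymInt_one d 0, P.yExt_of_ge hk, homExt_eq_homSymInt one_pos le_rfl]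
  · rw [sub_neg_eq_add]
  · have := P.x_ge j
    omega

/-- The equations of the linear system for the added starting points are this identity at `N`
integers `s`. Both sides are polynomials in `s` of degree at most `N - 1`, so it holds for all `s`.
-/
lemma sum_coef_mul_binPoly (hdet : (P.H 1).det ≠ 0) {n : ℕ} (hn : n ≤ N) (y s : ℤ) :
    ∑ j, P.coef n y j * homExt 1 0 N (P.x j + s) = homExt 1 0 n (y + s) := by
  rcases Nat.eq_zero_or_pos N with rfl | hN
  · obtain rfl : n = 0 := by omega
    simp [homExt]
  set F : Polynomial ℝ := (∑ j, Polynomial.C (P.coef n y j) *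
    (binPoly ℝ N).comp (Polynomial.X + Polynomial.C (P.x j : ℝ)))
      - (binPoly ℝ n).comp (Polynomial.X + Polynomial.C (y : ℝ)) with hF
  have heval : ∀ t : ℤ, F.eval (t : ℝ)
      = ∑ j, P.coef n y j * homExt 1 0 N (P.x j + t) - homExt 1 0 n (y + t) := by
    intro t
    simp only [hF, Polynomial.eval_sub, Polynomial.eval_finsetSum, Polynomial.eval_mul,
      Polynomial.eval_C, Polynomial.eval_comp, Polynomial.eval_add, Polynomial.eval_X, homExt_one]
    push_cast
    simp only [add_comm]
  have hdeg1 : ∀ (m : ℕ) (a : ℝ), m ≤ N →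
      ((binPoly ℝ m).comp (Polynomial.X + Polynomial.C a)).natDegree ≤ N - 1 := by
    intro m a hm
    rw [Polynomial.natDegree_comp, Polynomial.natDegree_X_add_C, mul_one]
    exact (natDegree_binPoly_le ℝ m).trans (by omega)
  have hdeg : F.natDegree ≤ N - 1 := by
    refine (Polynomial.natDegree_sub_le _ _).trans (max_le ?_ (hdeg1 n _ hn))
    refine Polynomial.natDegree_sum_le_of_forall_le _ _ fun j _ => ?_
    exact (Polynomial.natDegree_C_mul_le _ _).trans (hdeg1 N _ le_rfl)
  -- The `N` zeros are `s = d+1, …, d+N`, the numbers `-y_k` for the added starting points.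
  have hzero : F = 0 := by
    refine Polynomial.eq_zero_of_natDegree_lt_card_of_eval_eq_zero F
      (f := fun i : Fin N => (((d : ℤ) + i + 1 : ℤ) : ℝ)) ?_ ?_ ?_
    · intro i i' h
      have h' : ((d : ℤ) + i + 1 : ℤ) = (d : ℤ) + i' + 1 := Int.cast_injective (α := ℝ) h
      exact Fin.ext (by omega)
    · intro i
      rw [heval]
      have hk : d ≤ ((⟨d + i, by omega⟩ : Fin (d + N)) : ℕ) := by simp
      have h := P.sum_H_mul_coef hdet n y ⟨d + i, by omega⟩
      rw [colFun, if_neg (by simp), P.yExt_of_ge hk] at h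
      simp only [P.H_one_of_ge hk] at h
      rw [sub_eq_zero]
      convert h using 1
      · refine Finset.sum_congr rfl fun j _ => ?_
        rw [mul_comm]; congr 2
      · rw [homExt_one, homExt_one]; congr 1
    · rw [Fintype.card_fin]; omega
  have := heval s
  rw [hzero, Polynomial.eval_zero] at this
  linarith

/-- A backward difference in `s` lowers the level on both sides at once; for `n ≤ m` the right side
has already become zero. -/
lemma sum_coef_mul_homExt (hdet : (P.H 1).det ≠ 0) {n : ℕ} (hn : n ≤ N) (y : ℤ) (m : ℕ)
    (hm : m ≤ N) (s : ℤ) :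
    ∑ j, P.coef n y j * homExt 1 0 (N - m) (P.x j + s) = homExt 1 0 (n - m) (y + s) := by
  induction m generalizing s with
  | zero => exact P.sum_coef_mul_binPoly hdet hn y s
  | succ m ih =>
    have hrec : ∀ (l : ℕ) (r : ℤ), homExt 1 0 (l - (m + 1)) r
        = homExt 1 0 (l - m) r - homExt 1 0 (l - m) (r - 1) := by
      intro l r
      by_cases hl : m < l
      · have h := homExt_succ one_pos le_rfl 0 (l - (m + 1)) r
        rw [show l - (m + 1) + 1 = l - m by omega, one_pow, one_mul] at h
        linarith
      · rw [show l - (m + 1) = 0 by omega, show l - m = 0 by omega]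
        simp [homExt]
    have h1 := ih (by omega) s
    have h2 := ih (by omega) (s - 1)
    simp only [hrec, mul_sub, Finset.sum_sub_distrib, h1]
    have e : ∀ t : ℤ, t + s - 1 = t + (s - 1) := fun t => by ring
    simp only [e, h2]

/-- At a point to the left of the polygon, the row of the kernel is explicit. -/
lemma kern_one_left (hdet : (P.H 1).det ≠ 0) {p p' : ℕ × ℤ} (hp : p.1 < N) (hp' : p'.1 ≤ N)
    (hleft : p.2 < -((d : ℤ) + p.1)) :
    P.kern 1 p p' = if p.1 < p'.1 ∧ p'.2 < p.2 then
      homExt 1 0 (p'.1 - p.1) (p'.2 - p.2) else 0 := by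
  have h1 : ∑ j, homSymInt 1 0 (N - p.1) (P.x j - p.2) * P.coef p'.1 p'.2 j
      = homExt 1 0 (p'.1 - p.1) (p'.2 - p.2) := by
    -- Here `s = -x`. Since `x < -d-m`, every `x_j - x` exceeds `-(N-m)`, so the truncated functions
    -- may be replaced by polynomials.
    have := P.sum_coef_mul_homExt hdet hp' p'.2 p.1 hp.le (-p.2)
    simp only [← sub_eq_add_neg] at this
    rw [← this]
    refine Finset.sum_congr rfl fun j _ => ?_
    have := P.x_ge j
    rw [homExt_eq_homSymInt one_pos le_rfl _ _ _ (by omega), mul_comm]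
  rw [kern_one, h1]
  by_cases hlt : p.1 < p'.1
  · by_cases hy : p'.2 < p.2
    · rw [if_pos hlt, if_pos ⟨hlt, hy⟩, homSymInt_of_neg (by omega), neg_zero, zero_add]
    · rw [if_pos hlt, if_neg (by tauto), homExt_eq_homSymInt one_pos le_rfl _ _ _ (by omega),
        neg_add_cancel]
  · rw [if_neg hlt, if_neg (by tauto), show p'.1 - p.1 = 0 by omega]
    simp [homExt]

/-- At `m = N` the flow to the top row is a Kronecker delta at `x_j`, and these positions are
excluded from `points`. -/
lemma kern_one_top {p p' : ℕ × ℤ} (hp : p ∈ P.points) (hN : p.1 = N) (hp' : p'.1 ≤ N) :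
    P.kern 1 p p' = 0 := by
  rw [kern_one, if_neg (by omega), neg_zero, zero_add]
  refine Finset.sum_eq_zero fun j _ => ?_
  have := hp.2 hN j
  rw [hN, Nat.sub_self, homSymInt_zero, if_neg (by omega), zero_mul]

lemma colFun_one_of_right {n : ℕ} {y : ℤ} (hy : -((d : ℤ) + n) ≤ y) (k : Fin (d + N)) :
    P.colFun 1 n k y = homSymInt 1 0 n (y - P.yExt k) := by
  unfold colFun
  split_ifs with hk
  · rw [homSymInt_one d 0]
  · rw [homExt_eq_homSymInt one_pos le_rfl, homSymInt_one d 0]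
    rw [P.yExt_of_ge (by omega)]
    omega

/-! ### Generating function of marked dots -/

section Weighted

variable {k : ℕ} (p : Fin k → ℕ × ℤ) (τ : ℝ)

/-- The weight `1 + τ` at the given points, and `1` elsewhere. -/
def dotWeight (l : ℕ) (t : ℤ) : ℝ := 1 + τ * ∑ i, if p i = (l, t) then 1 else 0

lemma dotWeight_eq_prod (hp : Function.Injective p) (l : ℕ) (t : ℤ) :
    dotWeight p τ l t = ∏ i, (1 + τ * if p i = (l, t) then 1 else 0) := by
  classical
  rw [prod_one_add_ite Finset.univ _ τ fun a _ b _ ha hb => hp (ha.trans hb.symm), dotWeight]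
  congr 2
  split_ifs with h
  · obtain ⟨a, -, ha⟩ := h
    rw [Finset.sum_eq_single a, if_pos ha]
    · intro b _ hb
      rw [if_neg fun h => hb (hp (h.trans ha.symm))]
    · simp
  · refine Finset.sum_eq_zero fun i _ => if_neg fun hi => h ⟨i, Finset.mem_univ _, hi⟩

open Classical in
-- A row has at most one dot at a given position, so the weight of a chain collects one factor for
-- each marked point. The flow only weights levels below `N`, whence the restriction on the levels.
lemma prod_dotWeight (hp : Function.Injective p) (hN : ∀ i, (p i).1 < N)
    {Y : ℕ → Fin (d + N) → ℤ} (hY : ∀ l < N, Function.Injective (Y l)) :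
    ∏ l ∈ Finset.range N, ∏ j, dotWeight p τ l (Y l j)
      = ∏ i, (1 + τ * if ∃ j, Y (p i).1 j = (p i).2 then 1 else 0) := by
  simp only [dotWeight_eq_prod p τ hp]
  rw [← Finset.prod_product', Finset.prod_comm]
  refine Finset.prod_congr rfl fun i _ => ?_
  rw [prod_one_add_ite]
  · congr 3
    rw [eq_iff_iff]
    constructor
    · rintro ⟨⟨l, j⟩, -, h⟩
      rw [h]; exact ⟨j, rfl⟩
    · rintro ⟨j, h⟩
      refine ⟨((p i).1, j), ?_, ?_⟩
      · simp [hN i]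
      · rw [h]
  · rintro ⟨l, j⟩ hl ⟨l', j'⟩ - h h'
    rw [h] at h'
    simp only [Prod.mk.injEq] at h' ⊢
    obtain ⟨rfl, h2⟩ := h'
    refine ⟨rfl, hY l ?_ h2⟩
    simpa using hl

/-- Decomposition according to the last marked point whose factor `τ` is used: up to that point the
flow is weighted, afterwards it is free. The weight at level `l` itself is not yet included in the
flow at level `l`, hence the strict inequality of levels. -/
lemma flow_dotWeight (hright : ∀ i, -((d : ℤ) + N) ≤ (p i).2) (l : ℕ) (j : Fin (d + N)) (z : ℤ) :
    flow (-((d : ℤ) + N)) P.yExt (dotWeight p τ) l j z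
      = homSymInt 1 0 l (z - P.yExt j)
        + τ * ∑ i, if (p i).1 < l then
            flow (-((d : ℤ) + N)) P.yExt (dotWeight p τ) (p i).1 j (p i).2
              * homSymInt 1 0 (l - (p i).1) (z - (p i).2) else 0 := by
  have hsum : ∀ (n : ℕ) (s z : ℤ), -((d : ℤ) + N) ≤ s →
      ∑ t ∈ Finset.Icc (-((d : ℤ) + N)) z, homSymInt 1 0 n (t - s)
        = homSymInt 1 0 (n + 1) (z - s) := by
    intro n s z hs
    rw [← sum_Icc_homSymInt 1 0 n _ _ z hs]
    simp
  induction l generalizing z with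
  | zero =>
    rw [homSymInt_zero, flow]
    simp [sub_eq_zero]
  | succ l ih =>
    rw [flow]
    simp only [dotWeight, mul_add, mul_one, Finset.sum_add_distrib]
    change ∑ t ∈ Finset.Icc (-((d : ℤ) + N)) z, flow (-((d : ℤ) + N)) P.yExt (dotWeight p τ) l j t
      + ∑ t ∈ Finset.Icc (-((d : ℤ) + N)) z, flow (-((d : ℤ) + N)) P.yExt (dotWeight p τ) l j t
        * (τ * ∑ i, if p i = (l, t) then 1 else 0) = _
    -- The summand `1` of the weight prolongs the existing free flows by one level.
    have h1 : ∑ t ∈ Finset.Icc (-((d : ℤ) + N)) z,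
          flow (-((d : ℤ) + N)) P.yExt (dotWeight p τ) l j t
        = homSymInt 1 0 (l + 1) (z - P.yExt j)
          + τ * ∑ i, if (p i).1 < l then
            flow (-((d : ℤ) + N)) P.yExt (dotWeight p τ) (p i).1 j (p i).2
              * homSymInt 1 0 (l + 1 - (p i).1) (z - (p i).2) else 0 := by
      simp only [ih, Finset.sum_add_distrib]
      rw [hsum _ _ _ (P.yExt_ge j), ← Finset.mul_sum, Finset.sum_comm]
      congr 2
      refine Finset.sum_congr rfl fun i _ => ?_
      split_ifs with hi
      · rw [← Finset.mul_sum, hsum _ _ _ (hright i), Nat.sub_add_comm hi.le]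
      · simp
    -- The summand with `τ` starts new free flows at the marked points of level `l`.
    have h2 : ∑ t ∈ Finset.Icc (-((d : ℤ) + N)) z,
          flow (-((d : ℤ) + N)) P.yExt (dotWeight p τ) l j t
            * (τ * ∑ i, if p i = (l, t) then 1 else 0)
        = τ * ∑ i, if (p i).1 = l then
            flow (-((d : ℤ) + N)) P.yExt (dotWeight p τ) (p i).1 j (p i).2
              * homSymInt 1 0 1 (z - (p i).2) else 0 := by
      simp only [Finset.mul_sum]
      rw [Finset.sum_comm]
      refine Finset.sum_congr rfl fun i _ => ?_
      split_ifs with hi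
      · rw [homSymInt_one_one]
        by_cases hz : (p i).2 ≤ z
        · rw [Finset.sum_eq_single (p i).2, if_pos (show p i = (l, (p i).2) from Prod.ext hi rfl),
            if_pos (by omega), hi]
          · ring
          · intro t _ ht
            rw [if_neg fun h => ht (by rw [h]), mul_zero, mul_zero]
          · intro h
            exact absurd (Finset.mem_Icc.2 ⟨hright i, hz⟩) h
        · rw [if_neg (by omega), mul_zero, mul_zero]
          refine Finset.sum_eq_zero fun t ht => ?_
          rw [Finset.mem_Icc] at ht
          rw [if_neg, mul_zero, mul_zero]
          intro h
          rw [h] at hz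
          exact hz ht.2
      · rw [mul_zero]
        refine Finset.sum_eq_zero fun t _ => ?_
        rw [if_neg fun h => hi (by rw [h]), mul_zero, mul_zero]
    rw [h1, h2, add_assoc, ← mul_add, ← Finset.sum_add_distrib]
    congr 2
    refine Finset.sum_congr rfl fun i _ => ?_
    rcases lt_trichotomy (p i).1 l with h | h | h
    · rw [if_pos h, if_neg h.ne, if_pos (by omega), add_zero]
    · rw [if_neg (by omega), if_pos h, if_pos (by omega), zero_add,
        show l + 1 - (p i).1 = 1 by omega]
    · rw [if_neg (by omega), if_neg (by omega), if_neg (by omega), add_zero]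

open Classical in
/-- The generating function of the dots at given points, as a determinant. -/
lemma sum_prod_eq_det (hdet : (P.H 1).det ≠ 0) (hp : Function.Injective p)
    (hN : ∀ i, (p i).1 < N) (hright : ∀ i, -((d : ℤ) + (p i).1) ≤ (p i).2) :
    ∑ Y ∈ chains (-((d : ℤ) + N)) P.yExt N P.x,
        ∏ i, (1 + τ * if ∃ j, Y (p i).1 j = (p i).2 then (1 : ℝ) else 0)
      = (P.H 1).det * (1 + τ • Matrix.of fun i j => P.kern 1 (p i) (p j)).det := by
  have hright' : ∀ i, -((d : ℤ) + N) ≤ (p i).2 := fun i => by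
    have := hN i
    have := hright i
    omega
  set A : Matrix (Fin (d + N)) (Fin k) ℝ := Matrix.of fun j i =>
    flow (-((d : ℤ) + N)) P.yExt (dotWeight p τ) (p i).1 j (p i).2 with hA
  set B : Matrix (Fin (d + N)) (Fin k) ℝ := Matrix.of fun j i =>
    homSymInt 1 0 (p i).1 ((p i).2 - P.yExt j) with hB
  set L : Matrix (Fin k) (Fin k) ℝ := Matrix.of fun i i' => if (p i).1 < (p i').1 then
    homSymInt 1 0 ((p i').1 - (p i).1) ((p i').2 - (p i).2) else 0 with hL
  set C : Matrix (Fin k) (Fin (d + N)) ℝ := Matrix.of fun i l =>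
    homSymInt 1 0 (N - (p i).1) (P.x l - (p i).2) with hC
  have hAB : A = B + τ • (A * L) := by
    ext j i
    simp only [hA, hB, hL, Matrix.of_apply, Matrix.add_apply, Matrix.smul_apply,
      Matrix.mul_apply, smul_eq_mul, mul_ite, mul_zero]
    exact P.flow_dotWeight p τ hright' _ _ _
  have hdetL : (1 - τ • L).det = 1 := by
    refine det_one_sub_smul_of_level τ L (fun i => (p i).1) fun i j hij => ?_
    simp only [hL, Matrix.of_apply]
    rw [if_neg (by omega)]
  -- `A` records the weighted flow at the marked points, `B` the free flow, `L` the free flow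
  -- between marked points, and `C` the free flow to the top row. The kernel has the shape required
  -- by `det_add_mul_eq`.
  have hker : (Matrix.of fun i j => P.kern 1 (p i) (p j)) = C * ((P.H 1).transpose)⁻¹ * B - L := by
    ext i j
    simp only [Matrix.of_apply, kern_one, hL, Matrix.sub_apply, Matrix.mul_assoc]
    rw [neg_add_eq_sub, Matrix.mul_apply]
    congr 1
    refine Finset.sum_congr rfl fun l _ => ?_
    rw [Matrix.mul_apply, coef]
    simp only [hC, hB, Matrix.of_apply, ← Matrix.transpose_nonsing_inv, Matrix.transpose_apply,
      P.colFun_one_of_right (hright j)]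
  have hdet' : (P.H 1).transpose.det ≠ 0 := by rwa [Matrix.det_transpose]
  rw [hker, ← Matrix.det_transpose (P.H 1), ← det_add_mul_eq τ A B L C _ hdet' hAB hdetL]
  have hflow : (P.H 1).transpose + τ • (A * C) = Matrix.of fun j i =>
      flow (-((d : ℤ) + N)) P.yExt (dotWeight p τ) N j (P.x i) := by
    ext j i
    rw [Matrix.of_apply, P.flow_dotWeight p τ hright']
    simp only [hA, hC, Matrix.of_apply, Matrix.add_apply, Matrix.smul_apply, Matrix.mul_apply,
      smul_eq_mul, Matrix.transpose_apply, H_apply, homSymInt_one d 0, hN, if_true]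
  rw [hflow, ← chainWeight_eq_det P.yExt_anti _ _ P.x_anti P.x_ge, ← sum_chains]
  refine Finset.sum_congr rfl fun Y hY => ?_
  rw [prod_dotWeight p τ hp hN]
  intro l hl
  exact (interlacing_strictAnti ((mem_chains.1 hY).2.2 l hl)).injective

end Weighted

-- The coefficient of `τ^k` in `sum_prod_eq_det` counts the chains through all marked points. It is
-- extracted with `τ = 1/ε`: after multiplication by `ε^k` both sides are continuous and agree for
-- `ε ≠ 0`, hence at `ε = 0`.
open Classical in
lemma card_filter_eq_det (hdet : (P.H 1).det ≠ 0) {k : ℕ} {p : Fin k → ℕ × ℤ}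
    (hp : Function.Injective p)
    (hN : ∀ i, (p i).1 < N) (hright : ∀ i, -((d : ℤ) + (p i).1) ≤ (p i).2) :
    (((chains (-((d : ℤ) + N)) P.yExt N P.x).filter
        fun Y => ∀ i, ∃ j, Y (p i).1 j = (p i).2).card : ℝ)
      = (P.H 1).det * (Matrix.of fun i j => P.kern 1 (p i) (p j)).det := by
  set S := chains (-((d : ℤ) + N)) P.yExt N P.x
  set K : Matrix (Fin k) (Fin k) ℝ := Matrix.of fun i j => P.kern 1 (p i) (p j) with hK
  set f : ℝ → ℝ := fun ε =>
    ∑ Y ∈ S, ∏ i, (ε + if ∃ j, Y (p i).1 j = (p i).2 then (1 : ℝ) else 0) with hf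
  set g : ℝ → ℝ := fun ε => (P.H 1).det * (ε • (1 : Matrix (Fin k) (Fin k) ℝ) + K).det with hg
  have hfg : ∀ ε, ε ≠ 0 → f ε = g ε := by
    intro ε hε
    have h := P.sum_prod_eq_det p ε⁻¹ hdet hp hN hright
    have h1 : f ε = ε ^ k * ∑ Y ∈ S,
        ∏ i, (1 + ε⁻¹ * if ∃ j, Y (p i).1 j = (p i).2 then (1 : ℝ) else 0) := by
      rw [hf, Finset.mul_sum]
      refine Finset.sum_congr rfl fun Y _ => ?_
      have : ε ^ k = ∏ _i : Fin k, ε := by simp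
      rw [this, ← Finset.prod_mul_distrib]
      refine Finset.prod_congr rfl fun i _ => ?_
      rw [mul_add, mul_one, mul_inv_cancel_left₀ hε]
    have h2 : g ε = ε ^ k * ((P.H 1).det * (1 + ε⁻¹ • K).det) := by
      have : ε • (1 : Matrix (Fin k) (Fin k) ℝ) + K = ε • (1 + ε⁻¹ • K) := by
        rw [smul_add, smul_smul, mul_inv_cancel₀ hε, one_smul]
      rw [hg]
      simp only [this, Matrix.det_smul, Fintype.card_fin]
      ring
    rw [h1, h2, h]
  have hfc : Continuous f := by
    refine continuous_finsetSum _ fun Y _ => continuous_finsetProd _ fun i _ => ?_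
    fun_prop
  have hgc : Continuous g := by
    refine continuous_const.mul (Continuous.matrix_det ?_)
    fun_prop
  have h0 : f 0 = g 0 := by
    have h1 : Tendsto f (𝓝[≠] 0) (𝓝 (f 0)) := hfc.continuousAt.tendsto.mono_left nhdsWithin_le_nhds
    have h2 : Tendsto g (𝓝[≠] 0) (𝓝 (g 0)) := hgc.continuousAt.tendsto.mono_left nhdsWithin_le_nhds
    refine tendsto_nhds_unique h1 (h2.congr' ?_)
    filter_upwards [self_mem_nhdsWithin] with ε hε
    exact (hfg ε hε).symm
  have hf0 : f 0 = ((S.filter fun Y => ∀ i, ∃ j, Y (p i).1 j = (p i).2).card : ℝ) := by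
    simp only [hf, zero_add]
    rw [Finset.card_filter, Nat.cast_sum]
    refine Finset.sum_congr rfl fun Y _ => ?_
    split_ifs with h
    · simp [h]
    · push Not at h
      obtain ⟨i, hi⟩ := h
      rw [Nat.cast_zero]
      refine Finset.prod_eq_zero (Finset.mem_univ i) (if_neg ?_)
      push Not
      exact hi
  rw [← hf0, h0, hg]
  simp

/-- The extended row is strictly decreasing, and its first frozen entry, just after the last dot, is
`-d-l-1`. -/
lemma config_ge {X : (k : Fin (N + 1)) → Fin (d + (k : ℕ)) → ℤ} (hX : X ∈ P.configs)
    (l : ℕ) (hl : l < N) (i : Fin (d + l)) :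
    -((d : ℤ) + l) ≤ X ⟨l, by omega⟩ i := by
  have h1 := P.extend_mem_chains hX
  have h2 := interlacing_strictAnti ((mem_chains.1 h1).2.2 l hl)
  have h3 : P.extend X l ⟨d + l, by omega⟩ < P.extend X l ⟨i, by omega⟩ :=
    h2 (by rw [Fin.lt_def]; exact i.2)
  rw [P.extend_of_ge X (by omega) le_rfl, P.extend_of_lt X (by omega) i.2] at h3
  simp only at h3
  push_cast at h3
  have e : (⟨(i : ℕ), i.2⟩ : Fin (d + l)) = i := rfl
  rw [e] at h3
  omega

/-- The limiting kernel is a correlation kernel of the uniform red-dot process. -/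
lemma isCorrelationKernelOn (hP : P.configs.Nonempty) :
    P.IsCorrelationKernelOn P.points (P.kern 1) := by
  have hdet := (P.det_H_one_pos hP).ne'
  intro k p hp hS
  by_cases htop : ∃ i, (p i).1 = N
  · obtain ⟨i, hi⟩ := htop
    rw [Matrix.det_eq_zero_of_row_eq_zero i fun j =>
      P.kern_one_top (hS i) hi (hS j).1, uniformProb]
    have : P.configs ∩ {X | ∀ i, HasDot X (p i)} = ∅ := by
      rw [Set.eq_empty_iff_forall_notMem]
      rintro X ⟨hX, hX'⟩
      obtain ⟨h, j, hj⟩ := hX' i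
      have hj' : (j : ℕ) < d + N := by have := j.2; omega
      refine (hS i).2 hi ⟨j, hj'⟩ ?_
      rw [← hj, ← hX.2.1 j hj']
      generalize p i = pi at *
      obtain ⟨a, b⟩ := pi
      simp only at hi
      subst hi
      rfl
    rw [this, Set.ncard_empty, Nat.cast_zero, zero_div]
  push Not at htop
  have hN : ∀ i, (p i).1 < N := fun i => lt_of_le_of_ne (hS i).1 (htop i)
  by_cases hleft : ∃ i, (p i).2 < -((d : ℤ) + (p i).1)
  · classical
    -- The row of a left point vanishes except possibly at points of higher level lying further to
    -- the left; choosing a left point of maximal level leaves only columns of points that are not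
    -- on the left.
    obtain ⟨i, hi, hmax⟩ := Finset.exists_max_image
      (Finset.univ.filter fun i => (p i).2 < -((d : ℤ) + (p i).1)) (fun i => (p i).1)
      (by obtain ⟨i, hi⟩ := hleft; exact ⟨i, by simpa using hi⟩)
    rw [Finset.mem_filter] at hi
    rw [Matrix.det_eq_zero_of_row_eq_zero i, uniformProb]
    · have : P.configs ∩ {X | ∀ i, HasDot X (p i)} = ∅ := by
        rw [Set.eq_empty_iff_forall_notMem]
        rintro X ⟨hX, hX'⟩
        obtain ⟨h, j, hj⟩ := hX' i
        have := P.config_ge hX _ (hN i) j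
        rw [hj] at this
        omega
      rw [this, Set.ncard_empty, Nat.cast_zero, zero_div]
    · intro j
      rw [Matrix.of_apply, P.kern_one_left hdet (hN i) (hS j).1 hi.2]
      split_ifs with h
      · have hj : ¬ (p j).2 < -((d : ℤ) + (p j).1) := fun hj => by
          have := hmax j (by simpa using hj)
          omega
        -- The difference of positions is negative but larger than minus the difference of levels,
        -- which is where the polynomial vanishes.
        rw [homExt_eq_homSymInt one_pos le_rfl _ _ _ (by omega), homSymInt_of_neg (by omega)]
      · rfl
  push Not at hleft
  rw [uniformProb, P.ncard_configs_inter p (fun i => (hN i).le) hleft,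
    P.card_filter_eq_det hdet hp hN hleft, ← P.det_H_one, mul_div_cancel_left₀ _ hdet]

end CutPolygon

/-! ### The `q`-kernel in closed form -/

/-- The sum of all complete homogeneous functions of `q, …, q^r`. -/
def homTotal (q : ℝ) (r : ℕ) : ℝ := ∑' s, homSym q 1 r s

/-- The recursion bounds a partial sum `S` by `homTotal q r + q^(1+r) S`, and `q^(1+r) < 1`. -/
lemma summable_homSym {q : ℝ} (hq : 0 < q) (hq1 : q < 1) (r : ℕ) :
    Summable (homSym q 1 r) := by
  induction r with
  | zero =>
    refine summable_of_ne_finset_zero (s := {0}) fun s hs => ?_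
    cases s
    · simp at hs
    · simp
  | succ r ih =>
    have hlt : q ^ (1 + r) < 1 := pow_lt_one₀ hq.le hq1 (by omega)
    have hle : ∀ n, ∑ i ∈ Finset.range n, homSym q 1 (r + 1) i
        ≤ homTotal q r + q ^ (1 + r) * ∑ i ∈ Finset.range n, homSym q 1 (r + 1) i := by
      intro n
      cases n with
      | zero =>
        simp only [Finset.range_zero, Finset.sum_empty, mul_zero, add_zero]
        exact tsum_nonneg fun s => homSym_nonneg hq.le _ _ _
      | succ n =>
        have h1 : ∑ i ∈ Finset.range (n + 1), homSym q 1 (r + 1) i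
            = ∑ i ∈ Finset.range (n + 1), homSym q 1 r i
              + q ^ (1 + r) * ∑ i ∈ Finset.range n, homSym q 1 (r + 1) i := by
          rw [Finset.sum_range_succ' _ n, Finset.sum_range_succ' _ n]
          simp only [homSym_succ_succ, Finset.sum_add_distrib, Finset.mul_sum, homSym_zero_right]
          ring
        have h2 : ∑ i ∈ Finset.range (n + 1), homSym q 1 r i ≤ homTotal q r :=
          ih.sum_le_tsum _ fun s _ => homSym_nonneg hq.le _ _ _
        have h3 : ∑ i ∈ Finset.range n, homSym q 1 (r + 1) i
            ≤ ∑ i ∈ Finset.range (n + 1), homSym q 1 (r + 1) i := by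
          rw [Finset.sum_range_succ]
          linarith [homSym_nonneg hq.le 1 (r + 1) n]
        have h4 := mul_le_mul_of_nonneg_left h3 (pow_nonneg hq.le (1 + r))
        rw [h1] at h4 ⊢
        linarith
    refine summable_of_sum_range_le (c := homTotal q r / (1 - q ^ (1 + r)))
      (fun s => homSym_nonneg hq.le _ _ _) fun n => ?_
    rw [le_div_iff₀ (by linarith)]
    linarith [hle n]

lemma homTotal_succ {q : ℝ} (hq : 0 < q) (hq1 : q < 1) (r : ℕ) :
    homTotal q (r + 1) * (1 - q ^ (r + 1)) = homTotal q r := by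
  have h1 := (summable_homSym hq hq1 (r + 1)).tsum_eq_zero_add
  have h2 := (summable_homSym hq hq1 r).tsum_eq_zero_add
  have hs := (summable_nat_add_iff 1).2 (summable_homSym hq hq1 r)
  simp only [homSym_succ_succ, homSym_zero_right] at h1 h2
  rw [hs.tsum_add ((summable_homSym hq hq1 (r + 1)).mul_left _), tsum_mul_left] at h1
  unfold homTotal
  rw [add_comm 1 r] at h1
  linarith

lemma homTotal_ne_zero {q : ℝ} (hq : 0 < q) (hq1 : q < 1) (r : ℕ) : homTotal q r ≠ 0 := by
  have h := (summable_homSym hq hq1 r).le_tsum 0 fun s _ => homSym_nonneg hq.le _ _ _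
  rw [homSym_zero_right] at h
  exact (lt_of_lt_of_le one_pos h).ne'

/-- With `z = x - s` the factor `q^(-ks)` of the virtual function cancels the factor `q^(ks)` from
the homogeneity of `h_s(q^(k+1), …)`. An exponential in `x` remains, times a constant. -/
lemma tsum_phiVirt_mul {q : ℝ} (hq : 0 < q) (hq1 : q < 1) (k r : ℕ) (x : ℤ) :
    HasSum (fun z : ℤ => phiVirt q (k + 1) z * homSymInt q (k + 1) r (x - z))
      (q ^ ((k : ℤ) * x) * homTotal q r) := by
  have hinj : Function.Injective fun s : ℕ => x - (s : ℤ) := fun s s' h => by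
    simp only at h; omega
  rw [← hinj.hasSum_iff]
  · have h := (summable_homSym hq hq1 r).hasSum.mul_left (q ^ ((k : ℤ) * x))
    have e : (fun z : ℤ => phiVirt q (k + 1) z * homSymInt q (k + 1) r (x - z)) ∘
        (fun s : ℕ => x - (s : ℤ)) = fun s => q ^ ((k : ℤ) * x) * homSym q 1 r s := by
      funext s
      simp only [Function.comp, phiVirt, sub_sub_cancel, homSymInt_natCast]
      rw [add_comm k 1, homSym_shift, ← mul_assoc, ← zpow_natCast q (k * s), ← zpow_add₀ hq.ne']
      congr 2
      push_cast; ring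
    rw [e]
    exact h
  · intro z hz
    rw [homSymInt_of_neg, mul_zero]
    by_contra! h
    exact hz ⟨(x - z).toNat, by simp only; omega⟩

/-- The product of `q`-numbers is a polynomial of degree below `N` in `q ^ r`; the `e i` are its
coefficients. -/
lemma exists_homExt_eq_sum {q : ℝ} (hq : 0 < q) (hq1 : q < 1) (a N : ℕ) :
    ∃ e : ℕ → ℝ, ∀ r : ℤ, homExt q a N r = ∑ i ∈ Finset.range N, e i * q ^ (((a + i : ℕ) : ℤ) * r) := by
  cases N with
  | zero => exact ⟨0, fun r => by simp [homExt]⟩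
  | succ N =>
    set W : Polynomial ℝ := ∏ i ∈ Finset.range N, (Polynomial.C (1 - q ^ ((i : ℤ) + 1))⁻¹ *
      (Polynomial.C 1 - Polynomial.C (q ^ ((i : ℤ) + 1)) * Polynomial.X)) with hW
    have hdeg : W.natDegree < N + 1 := by
      refine Nat.lt_succ_of_le ((Polynomial.natDegree_prod_le _ _).trans ?_)
      refine (Finset.sum_le_card_nsmul _ _ 1 fun i _ => ?_).trans (by simp)
      refine (Polynomial.natDegree_C_mul_le _ _).trans ?_
      refine (Polynomial.natDegree_sub_le _ _).trans (max_le (by simp) ?_)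
      exact (Polynomial.natDegree_C_mul_le _ _).trans Polynomial.natDegree_X_le
    refine ⟨W.coeff, fun r => ?_⟩
    have h1 : homExt q a (N + 1) r = q ^ ((a : ℤ) * r) * W.eval (q ^ r) := by
      rw [homExt, hW, Polynomial.eval_prod]
      congr 1
      refine Finset.prod_congr rfl fun i _ => ?_
      have h1q : 1 - q ≠ 0 := by linarith
      simp only [qNum, if_neg hq1.ne, Polynomial.eval_mul, Polynomial.eval_C, Polynomial.eval_sub,
        Polynomial.eval_X]
      rw [div_div_div_cancel_right₀ h1q, div_eq_inv_mul, add_assoc, zpow_add₀ hq.ne' r, mul_comm (q ^ r)]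
    rw [h1, Polynomial.eval_eq_sum_range' hdeg, Finset.mul_sum]
    refine Finset.sum_congr rfl fun i _ => ?_
    push_cast
    rw [add_mul, zpow_add₀ hq.ne', ← zpow_natCast, ← zpow_mul, mul_comm r]
    ring

namespace CutPolygon

variable {d N : ℕ} (P : CutPolygon d N)

/-- Passing from level `n + 1` to level `n` multiplies the `i`-th exponential by `1 - q^(n-i)`. This
is the ratio of consecutive values of `homTotal`, and it kills `i = n`. The same coefficients thus
serve all levels, up to the constants produced by the virtual rows. -/
lemma homExt_eq_sum_of_le {q : ℝ} (hq : 0 < q) (hq1 : q < 1) (a : ℕ) {N : ℕ} {e : ℕ → ℝ}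
    (he : ∀ r : ℤ, homExt q a N r = ∑ i ∈ Finset.range N, e i * q ^ (((a + i : ℕ) : ℤ) * r))
    (m n : ℕ) (hm : n + m = N) (r : ℤ) :
    homExt q a n r = ∑ i ∈ Finset.range N, (if i < n then
      e i / homTotal q (N - (i + 1)) * homTotal q (n - (i + 1)) * q ^ (((a + i : ℕ) : ℤ) * r)
      else 0) := by
  induction m generalizing n r with
  | zero =>
    obtain rfl : n = N := by omega
    rw [he]
    refine Finset.sum_congr rfl fun i hi => ?_
    rw [if_pos (Finset.mem_range.1 hi), div_mul_cancel₀ _ (homTotal_ne_zero hq hq1 _)]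
  | succ m ih =>
    have h1 := homExt_succ hq hq1.le a n r
    rw [ih (n + 1) (by omega), ih (n + 1) (by omega), ← sub_eq_iff_eq_add, Finset.mul_sum,
      ← Finset.sum_sub_distrib] at h1
    rw [← h1]
    refine Finset.sum_congr rfl fun i _ => ?_
    have hshift : i < n + 1 → q ^ (a + n) * q ^ (((a + i : ℕ) : ℤ) * (r - 1))
        = q ^ (n - i) * q ^ (((a + i : ℕ) : ℤ) * r) := by
      intro hi
      rw [← zpow_natCast, ← zpow_natCast, ← zpow_add₀ hq.ne', ← zpow_add₀ hq.ne']
      congr 1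
      push_cast [show i ≤ n by omega]
      ring
    rcases lt_trichotomy i n with h | h | h
    · rw [if_pos (by omega), if_pos (by omega), if_pos h]
      have hC := homTotal_succ hq hq1 (n - (i + 1))
      rw [show n - (i + 1) + 1 = n - i by omega] at hC
      rw [show n + 1 - (i + 1) = n - i by omega, ← hC]
      linear_combination (-(e i / homTotal q (N - (i + 1)) * homTotal q (n - i))) * hshift (by omega)
    · rw [if_pos (by omega), if_pos (by omega), if_neg (by omega)]
      have := hshift (by omega)
      rw [h, Nat.sub_self, pow_zero, one_mul] at this
      subst h
      linear_combination (-(e i / homTotal q (N - (i + 1)) * homTotal q (i + 1 - (i + 1)))) * this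
    · rw [if_neg (by omega), if_neg (by omega), if_neg (by omega)]
      simp

lemma psiUp_eq (q : ℝ) (m : ℕ) (l : Fin (d + N)) (z : ℤ) :
    P.psiUp q m l z = ∑ j, (P.H q)⁻¹ l j * homSymInt q (d + m) (N - m) (P.x j - z) := by
  unfold psiUp psi
  simp only [Finset.mul_sum]
  have hsingle : ∀ j, HasSum (fun t : ℤ => phiConv q (d + m + 1) (N - m) z t
      * ((P.H q)⁻¹ l j * if t = P.x j then 1 else 0))
      ((P.H q)⁻¹ l j * homSymInt q (d + m) (N - m) (P.x j - z)) := by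
    intro j
    convert hasSum_single (P.x j) ?_ using 1
    · rw [phiConv_eq, if_pos rfl]; ring
    · intro t ht
      rw [if_neg ht, mul_zero, mul_zero]
  exact (hasSum_sum fun j _ => hsingle j).tsum_eq

lemma tsum_chi_mul (i : Fin d) (f : ℤ → ℝ) : ∑' z, P.chi i z * f z = f (P.y i) := by
  rw [tsum_eq_single (P.y i)]
  · simp [chi]
  · intro z hz
    simp [chi, hz]

/-- The matrix of the flows of the starting points and virtual points to the end points `x_j`. -/
def flowMatrix (q : ℝ) : Matrix (Fin (d + N)) (Fin (d + N)) ℝ :=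
  Matrix.of fun k j => if (k : ℕ) < d then P.H q j k
    else q ^ (((k : ℕ) : ℤ) * P.x j) * homTotal q (N - ((k : ℕ) + 1 - d))

lemma M_eq {q : ℝ} (hq : 0 < q) (hq1 : q < 1) :
    P.M q = P.flowMatrix q * ((P.H q)⁻¹).transpose := by
  ext k l
  rw [M, Matrix.of_apply, Matrix.mul_apply]
  simp only [flowMatrix, Matrix.of_apply, Matrix.transpose_apply]
  split_ifs with hk
  · rw [tsum_chi_mul, psiUp_eq]
    refine Finset.sum_congr rfl fun j _ => ?_
    rw [H_apply, P.yExt_of_lt hk, mul_comm]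
    rfl
  · simp only [psiUp_eq, Finset.mul_sum]
    rw [show d + ((k : ℕ) + 1 - d) = k + 1 by omega]
    have h : ∀ j, HasSum (fun z : ℤ => phiVirt q ((k : ℕ) + 1) z * ((P.H q)⁻¹ l j *
        homSymInt q (k + 1) (N - ((k : ℕ) + 1 - d)) (P.x j - z)))
        (q ^ (((k : ℕ) : ℤ) * P.x j) * homTotal q (N - ((k : ℕ) + 1 - d)) * (P.H q)⁻¹ l j) := by
      intro j
      have h := (tsum_phiVirt_mul hq hq1 k (N - ((k : ℕ) + 1 - d)) (P.x j)).mul_left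
        ((P.H q)⁻¹ l j)
      simpa only [mul_assoc, mul_comm, mul_left_comm] using h
    exact (hasSum_sum fun j _ => h j).tsum_eq

lemma rowFun_of_lt (q : ℝ) (n : ℕ) {l : Fin (d + N)} (hl : (l : ℕ) < d) (y : ℤ) :
    P.rowFun q n l y = P.colFun q n l y := by
  rw [rowFun, dif_pos hl, tsum_chi_mul, phiConv_eq, colFun, if_pos hl, P.yExt_of_lt hl]

lemma rowFun_of_ge {q : ℝ} (hq : 0 < q) (hq1 : q < 1) (n : ℕ) {l : Fin (d + N)}
    (hl : d ≤ (l : ℕ)) (y : ℤ) :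
    P.rowFun q n l y = if (l : ℕ) < d + n then
      q ^ (((l : ℕ) : ℤ) * y) * homTotal q (d + n - ((l : ℕ) + 1)) else 0 := by
  rw [rowFun, dif_neg (by omega)]
  split_ifs
  · rw [← (tsum_phiVirt_mul hq hq1 l (d + n - ((l : ℕ) + 1)) y).tsum_eq]
    simp only [← phiConv_eq]
  · rfl

/-- `E` is the change of basis from starting points and virtual exponentials to the columns of `H`:
the identity on the original starting points, and the expansion of `homExt` at `y_k = -(k+1)` on the
added ones. It carries `flowMatrix` to `Hᵀ`, hence is the inverse of `M`, and it carries `rowFun` to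
`colFun` at every level. -/
lemma qKernel_eq_kern {q : ℝ} (hq : 0 < q) (hq1 : q < 1) (hdet : (P.H q).det ≠ 0)
    (p : ℕ × ℤ) {p' : ℕ × ℤ} (hp' : p'.1 ≤ N) : P.qKernel q p p' = P.kern q p p' := by
  obtain ⟨e, he⟩ := exists_homExt_eq_sum hq hq1 d N
  set E : Matrix (Fin (d + N)) (Fin (d + N)) ℝ := Matrix.of fun k l =>
    if (k : ℕ) < d then (if k = l then 1 else 0)
    else if (l : ℕ) < d then 0
    else e (l - d) / homTotal q (N - ((l : ℕ) + 1 - d)) * q ^ (((l : ℕ) : ℤ) * (k + 1)) with hE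
  have hrow : ∀ k y n, n ≤ N → ∑ l, E k l * P.rowFun q n l y = P.colFun q n k y := by
    intro k y n hn
    by_cases hk : (k : ℕ) < d
    · simp only [hE, Matrix.of_apply, if_pos hk, ite_mul, one_mul, zero_mul,
        Finset.sum_ite_eq, Finset.mem_univ, if_true]
      exact P.rowFun_of_lt q n hk y
    · rw [Fin.sum_univ_add]
      simp only [hE, Matrix.of_apply, if_neg hk, Fin.val_castAdd, Fin.is_lt, if_true, zero_mul,
        Finset.sum_const_zero, zero_add, Fin.val_natAdd, add_tsub_cancel_left]
      rw [colFun, if_neg hk, P.yExt_of_ge (by omega),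
        homExt_eq_sum_of_le hq hq1 d he (N - n) n (by omega), ← Fin.sum_univ_eq_sum_range
          (fun i => if i < n then e i / homTotal q (N - (i + 1)) * homTotal q (n - (i + 1)) *
            q ^ (((d + i : ℕ) : ℤ) * (y - -(((k : ℕ) : ℤ) + 1))) else 0)]
      refine Finset.sum_congr rfl fun i _ => ?_
      rw [if_neg (by omega), P.rowFun_of_ge hq hq1 n (by simp), Fin.val_natAdd]
      by_cases hi : (i : ℕ) < n
      · rw [if_pos (by omega), if_pos hi, show d + (i : ℕ) + 1 - d = i + 1 by omega,
          show d + n - (d + (i : ℕ) + 1) = n - (i + 1) by omega,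
          show ((d + (i : ℕ) : ℕ) : ℤ) * (y - -(((k : ℕ) : ℤ) + 1))
            = ((d + (i : ℕ) : ℕ) : ℤ) * ((k : ℕ) + 1) + ((d + (i : ℕ) : ℕ) : ℤ) * y by ring,
          zpow_add₀ hq.ne']
        ring
      · rw [if_neg (by omega), if_neg hi, mul_zero]
  have hEA : E * P.flowMatrix q = (P.H q).transpose := by
    ext k j
    rw [Matrix.mul_apply, Matrix.transpose_apply]
    by_cases hk : (k : ℕ) < d
    · simp only [hE, Matrix.of_apply, if_pos hk, ite_mul, one_mul, zero_mul,
        Finset.sum_ite_eq, Finset.mem_univ, if_true]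
      rw [flowMatrix, Matrix.of_apply, if_pos hk]
    · rw [Fin.sum_univ_add]
      simp only [hE, Matrix.of_apply, if_neg hk, Fin.val_castAdd, Fin.is_lt, if_true, zero_mul,
        Finset.sum_const_zero, zero_add, Fin.val_natAdd, add_tsub_cancel_left]
      have hx := P.x_ge j
      rw [H_apply, P.yExt_of_ge (by omega), ← homExt_eq_homSymInt hq hq1.le _ _ _ (by omega), he,
        ← Fin.sum_univ_eq_sum_range
          (fun i => e i * q ^ (((d + i : ℕ) : ℤ) * (P.x j - -(((k : ℕ) : ℤ) + 1))))]
      refine Finset.sum_congr rfl fun i _ => ?_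
      rw [if_neg (by omega), flowMatrix, Matrix.of_apply, if_neg (by simp), Fin.val_natAdd,
        show ((d + (i : ℕ) : ℕ) : ℤ) * (P.x j - -(((k : ℕ) : ℤ) + 1))
          = ((d + (i : ℕ) : ℕ) : ℤ) * ((k : ℕ) + 1) + ((d + (i : ℕ) : ℕ) : ℤ) * P.x j by ring,
        zpow_add₀ hq.ne']
      have := homTotal_ne_zero hq hq1 (N - (d + (i : ℕ) + 1 - d))
      field_simp
  have hinv : (P.M q)⁻¹ = E := by
    refine Matrix.inv_eq_left_inv ?_
    rw [P.M_eq hq hq1, ← Matrix.mul_assoc, hEA, ← Matrix.transpose_mul,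
      Matrix.nonsing_inv_mul _ (isUnit_iff_ne_zero.2 hdet), Matrix.transpose_one]
  rw [qKernel, kern, hinv, phiConv_eq]
  congr 1
  have hk : ∀ k, ∑ l, P.psiUp q p.1 k p.2 * E k l * P.rowFun q p'.1 l p'.2
      = P.psiUp q p.1 k p.2 * P.colFun q p'.1 k p'.2 := fun k => by
    simp only [mul_assoc, ← Finset.mul_sum, hrow _ _ _ hp']
  simp only [hk]
  simp only [psiUp_eq, Finset.sum_mul]
  rw [Finset.sum_comm]
  refine Finset.sum_congr rfl fun j _ => Finset.sum_congr rfl fun k _ => ?_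
  ring

lemma tendsto_qKernel (hP : P.configs.Nonempty) (p : ℕ × ℤ) {p' : ℕ × ℤ} (hp' : p'.1 ≤ N) :
    Tendsto (fun q => P.qKernel q p p') (𝓝[<] 1) (𝓝 (P.kern 1 p p')) := by
  have hdet := (P.det_H_one_pos hP).ne'
  refine (P.tendsto_kern hdet p p').congr' ?_
  have hH : Continuous fun q => (P.H q).det := by
    refine Continuous.matrix_det (continuous_matrix fun i j => ?_)
    simp only [H_apply]
    exact continuous_homSymInt _ _ _
  have h1 : ∀ᶠ q in 𝓝[<] (1 : ℝ), (P.H q).det ≠ 0 :=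
    (hH.continuousAt.eventually_ne hdet).filter_mono nhdsWithin_le_nhds
  have h2 : ∀ᶠ q in 𝓝[<] (1 : ℝ), 0 < q :=
    (eventually_gt_nhds one_pos).filter_mono nhdsWithin_le_nhds
  filter_upwards [h1, h2, self_mem_nhdsWithin] with q h1 h2 h3
  exact (P.qKernel_eq_kern h2 h3 h1 p hp').symm

end CutPolygon

/-! ### Lagrange interpolation sums -/

section Lagrange

variable {ι : Type*} [Fintype ι] [DecidableEq ι]

/-- The weight `1 / Q'(x_i)` of the node `x_i`. -/
def nodeWeight (x : ι → ℂ) (i : ι) : ℂ := Lagrange.nodalWeight Finset.univ x i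

/-- The product `∏ (z - x_l)` over `l ≠ i`. -/
def nodeProd (x : ι → ℂ) (i : ι) (z : ℂ) : ℂ := ∏ l ∈ Finset.univ.erase i, (z - x l)

lemma nodeWeight_ne_zero {x : ι → ℂ} (hx : Function.Injective x) (i : ι) : nodeWeight x i ≠ 0 :=
  Lagrange.nodalWeight_ne_zero hx.injOn (Finset.mem_univ i)

lemma mul_nodeProd (x : ι → ℂ) (i : ι) (z : ℂ) :
    (z - x i) * nodeProd x i z = ∏ l, (z - x l) :=
  Finset.mul_prod_erase Finset.univ (fun l => z - x l) (Finset.mem_univ i)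

lemma differentiable_nodeProd (x : ι → ℂ) (i : ι) : Differentiable ℂ (nodeProd x i) := by
  unfold nodeProd
  fun_prop

lemma sum_nodeWeight_mul_nodeProd {x : ι → ℂ} (hx : Function.Injective x) {p : Polynomial ℂ}
    (hp : p.degree < Fintype.card ι) (z : ℂ) :
    ∑ i, nodeWeight x i * p.eval (x i) * nodeProd x i z = p.eval z := by
  have h := Lagrange.eq_interpolate (s := Finset.univ) (v := x) hx.injOn
    (f := p) (by rwa [Finset.card_univ])
  conv_rhs => rw [h]
  rw [Lagrange.interpolate_apply, Polynomial.eval_finsetSum]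
  refine Finset.sum_congr rfl fun i _ => ?_
  rw [Lagrange.basis_eq_prod_sub_inv_mul_nodal_div (Finset.mem_univ i),
    ← Lagrange.nodal_erase_eq_nodal_div (Finset.mem_univ i)]
  simp only [Polynomial.eval_mul, Polynomial.eval_C, Lagrange.eval_nodal, nodeWeight, nodeProd]
  ring

/-- The residue theorem for `p / Q` when the residue at infinity vanishes. Algebraically, `p * (X -
z)` still has degree below the number of nodes, and its Lagrange interpolation is evaluated at its
zero `z`, away from the nodes. -/
lemma sum_nodeWeight_mul_eval {x : ι → ℂ} (hx : Function.Injective x) {p : Polynomial ℂ}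
    (hp : p.natDegree + 1 < Fintype.card ι) : ∑ i, nodeWeight x i * p.eval (x i) = 0 := by
  obtain ⟨z, hz⟩ : ∃ z, z ∉ Set.range x := (Set.finite_range x).exists_notMem
  have hne : ∏ l, (z - x l) ≠ 0 :=
    Finset.prod_ne_zero_iff.2 fun l _ => sub_ne_zero.2 fun h => hz ⟨l, h.symm⟩
  have hdeg : (p * (Polynomial.X - Polynomial.C z)).degree < (Fintype.card ι : WithBot ℕ) := by
    refine lt_of_le_of_lt Polynomial.degree_le_natDegree ?_
    have h1 := Polynomial.natDegree_mul_le (p := p) (q := Polynomial.X - Polynomial.C z)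
    rw [Polynomial.natDegree_X_sub_C] at h1
    exact_mod_cast h1.trans_lt hp
  have h := sum_nodeWeight_mul_nodeProd hx hdeg z
  simp only [Polynomial.eval_mul, Polynomial.eval_sub, Polynomial.eval_X, Polynomial.eval_C,
    sub_self, mul_zero] at h
  have h2 : (∑ i, nodeWeight x i * p.eval (x i)) * ∏ l, (z - x l) = 0 := by
    rw [← neg_eq_zero, ← h, Finset.sum_mul, ← Finset.sum_neg_distrib]
    refine Finset.sum_congr rfl fun i _ => ?_
    rw [← mul_nodeProd x i z]
    ring
  exact (mul_eq_zero.1 h2).resolve_right hne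

lemma inv_prod_eq_sum {x : ι → ℂ} [Nonempty ι] (hx : Function.Injective x) {z : ℂ}
    (hz : ∀ i, z ≠ x i) : (∏ l, (z - x l))⁻¹ = ∑ i, (z - x i)⁻¹ * nodeWeight x i := by
  have hne : ∏ l, (z - x l) ≠ 0 :=
    Finset.prod_ne_zero_iff.2 fun l _ => sub_ne_zero.2 (hz l)
  have h := sum_nodeWeight_mul_nodeProd hx (p := 1)
    (by rw [Polynomial.degree_one]; exact_mod_cast Fintype.card_pos) z
  rw [Polynomial.eval_one] at h
  rw [inv_eq_iff_eq_inv, ← mul_left_inj' hne, ← mul_right_inj' (inv_ne_zero hne)]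
  have h2 : (∑ i, (z - x i)⁻¹ * nodeWeight x i) * ∏ l, (z - x l) = 1 := by
    rw [← h, Finset.sum_mul]
    refine Finset.sum_congr rfl fun i _ => ?_
    have := sub_ne_zero.2 (hz i)
    rw [← mul_nodeProd x i z, Polynomial.eval_one]
    field_simp
  rw [eq_div_of_mul_eq hne h2]
  field_simp

end Lagrange

/-! ### Residue computations on circles -/

/-- The normalized contour integral over a circle. -/
def cint (c : ℂ) (r : ℝ) (f : ℂ → ℂ) : ℂ := (2 * Real.pi * Complex.I : ℂ)⁻¹ * ∮ z in C(c, r), f z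

lemma cint_congr {c : ℂ} {r : ℝ} (hr : 0 ≤ r) {f g : ℂ → ℂ}
    (h : ∀ z ∈ Metric.sphere c r, f z = g z) : cint c r f = cint c r g := by
  unfold cint
  rw [circleIntegral.integral_congr hr h]

lemma cint_sum {c : ℂ} {r : ℝ} (hr : 0 ≤ r) {ι : Type*} (s : Finset ι) {f : ι → ℂ → ℂ}
    (h : ∀ i ∈ s, ContinuousOn (f i) (Metric.sphere c r)) :
    cint c r (fun z => ∑ i ∈ s, f i z) = ∑ i ∈ s, cint c r (f i) := by
  unfold cint
  rw [circleIntegral.integral_fun_sum fun i hi => (h i hi).circleIntegrable hr, Finset.mul_sum]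

lemma cint_sub {c : ℂ} {r : ℝ} (hr : 0 ≤ r) {f g : ℂ → ℂ}
    (hf : ContinuousOn f (Metric.sphere c r)) (hg : ContinuousOn g (Metric.sphere c r)) :
    cint c r (fun z => f z - g z) = cint c r f - cint c r g := by
  unfold cint
  rw [circleIntegral.integral_sub (hf.circleIntegrable hr) (hg.circleIntegrable hr), mul_sub]

lemma cint_const_mul (c : ℂ) (r : ℝ) (a : ℂ) (f : ℂ → ℂ) :
    cint c r (fun z => a * f z) = a * cint c r f := by
  unfold cint
  rw [circleIntegral.integral_const_mul, mul_left_comm]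

lemma cint_sub_inv_mul {c w : ℂ} {r : ℝ} {f : ℂ → ℂ}
    (hf : DifferentiableOn ℂ f (Metric.closedBall c r)) (hw : w ∈ Metric.ball c r) :
    cint c r (fun z => (z - w)⁻¹ * f z) = f w := by
  have h := hf.circleIntegral_sub_inv_smul hw
  simp only [smul_eq_mul] at h
  rw [cint, h, inv_mul_cancel_left₀ Complex.two_pi_I_ne_zero]

lemma cint_eq_zero {c : ℂ} {r : ℝ} (hr : 0 ≤ r) {f : ℂ → ℂ}
    (hf : DifferentiableOn ℂ f (Metric.closedBall c r)) : cint c r f = 0 := by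
  rw [cint, (hf.mono Metric.closure_ball_subset_closedBall).diffContOnCl.circleIntegral_eq_zero hr,
    mul_zero]

lemma ne_of_mem_sphere_of_mem_ball {c z w : ℂ} {r : ℝ} (hz : z ∈ Metric.sphere c r)
    (hw : w ∈ Metric.ball c r) : z ≠ w := by
  rintro rfl
  rw [Metric.mem_sphere] at hz
  rw [Metric.mem_ball] at hw
  exact hw.ne hz

lemma cint_div_prod {ι : Type*} [Fintype ι] [DecidableEq ι] [Nonempty ι] {x : ι → ℂ}
    (hx : Function.Injective x) {c : ℂ} {r : ℝ} (hr : 0 < r) (I : ι → Prop) [DecidablePred I]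
    (hin : ∀ i, I i → x i ∈ Metric.ball c r) (hout : ∀ i, ¬ I i → x i ∉ Metric.closedBall c r)
    {f : ℂ → ℂ} (hf : DifferentiableOn ℂ f (Metric.closedBall c r)) :
    cint c r (fun z => f z / ∏ l, (z - x l))
      = ∑ i, if I i then nodeWeight x i * f (x i) else 0 := by
  have hne : ∀ z ∈ Metric.sphere c r, ∀ i, z ≠ x i := by
    intro z hz i
    by_cases hi : I i
    · exact ne_of_mem_sphere_of_mem_ball hz (hin i hi)
    · rintro rfl
      exact hout i hi (Metric.sphere_subset_closedBall hz)
  have hfc : ContinuousOn f (Metric.sphere c r) :=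
    hf.continuousOn.mono Metric.sphere_subset_closedBall
  have h1 : cint c r (fun z => f z / ∏ l, (z - x l))
      = cint c r (fun z => ∑ i, nodeWeight x i * ((z - x i)⁻¹ * f z)) := by
    refine cint_congr hr.le fun z hz => ?_
    rw [div_eq_mul_inv, inv_prod_eq_sum hx (hne z hz), Finset.mul_sum]
    refine Finset.sum_congr rfl fun i _ => ?_
    ring
  rw [h1, cint_sum hr.le]
  · refine Finset.sum_congr rfl fun i _ => ?_
    rw [cint_const_mul]
    split_ifs with hi
    · rw [cint_sub_inv_mul hf (hin i hi)]
    · rw [cint_eq_zero hr.le, mul_zero]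
      refine DifferentiableOn.mul (DifferentiableOn.inv (by fun_prop) fun z hz => ?_) hf
      refine sub_ne_zero.2 ?_
      rintro rfl
      exact hout i hi hz
  · intro i _
    refine continuousOn_const.mul (ContinuousOn.mul (ContinuousOn.inv₀ (by fun_prop) ?_) hfc)
    exact fun z hz => sub_ne_zero.2 (hne z hz i)

/-- Iterated backward differences. -/
def nabla : ℕ → (ℂ → ℂ) → ℂ → ℂ
  | 0, f, z => f z
  | r + 1, f, z => nabla r f z - nabla r f (z - 1)

lemma nabla_sum {ι : Type*} (s : Finset ι) (a : ι → ℂ) (f : ι → ℂ → ℂ) (r : ℕ) (z : ℂ) :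
    nabla r (fun t => ∑ i ∈ s, a i * f i t) z = ∑ i ∈ s, a i * nabla r (f i) z := by
  induction r generalizing z with
  | zero => rfl
  | succ r ih => simp only [nabla, ih, mul_sub, Finset.sum_sub_distrib]

lemma rising_eq_prod (a : ℂ) (k : ℕ) : rising a k = ∏ j ∈ Finset.range k, (a + j) := by
  induction k with
  | zero => simp [rising]
  | succ k ih =>
    rw [Finset.prod_range_succ, ← ih, rising, ascPochhammer_succ_eval, rising]

/-- Induction through `r!/(a)_{r+1} - r!/(a+1)_{r+1} = (r+1)!/(a)_{r+2}` with `a = z - y`: the poles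
at `y, …, y - r` encode an iterated backward difference. -/
lemma cint_div_rising {c : ℂ} {R : ℝ} {f : ℂ → ℂ} (hf : Differentiable ℂ f) (r : ℕ) (y : ℂ)
    (hy : ∀ j : ℕ, j ≤ r → y - j ∈ Metric.ball c R) :
    cint c R (fun z => (r.factorial : ℂ) * f z / rising (z - y) (r + 1)) = nabla r f y := by
  induction r generalizing y with
  | zero =>
    have h0 : y ∈ Metric.ball c R := by simpa using hy 0 le_rfl
    rw [nabla, ← cint_sub_inv_mul hf.differentiableOn h0]
    congr 1
    funext z
    simp [rising_eq_prod, div_eq_inv_mul]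
  | succ r ih =>
    have h0 : y ∈ Metric.ball c R := by simpa using hy 0 (Nat.zero_le _)
    have hR : 0 ≤ R := dist_nonneg.trans (Metric.mem_ball.1 h0).le
    have hy1 : ∀ j : ℕ, j ≤ r → y - 1 - j ∈ Metric.ball c R := fun j hj => by
      have := hy (j + 1) (by omega)
      rw [show y - 1 - j = y - ((j + 1 : ℕ) : ℂ) by push_cast; ring]
      exact this
    have hne : ∀ z ∈ Metric.sphere c R, ∀ j : ℕ, j ≤ r + 1 → z - y + j ≠ 0 := by
      intro z hz j hj h
      exact ne_of_mem_sphere_of_mem_ball hz (hy j hj) (by linear_combination h)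
    rw [nabla, ← ih y fun j hj => hy j (by omega), ← ih (y - 1) hy1, ← cint_sub hR]
    · refine cint_congr hR fun z hz => ?_
      simp only [rising_eq_prod]
      rw [Finset.prod_range_succ _ (r + 1), Finset.prod_range_succ' (fun j : ℕ => z - y + j) r]
      have e : ∀ j : ℕ, z - (y - 1) + j = z - y + ((j + 1 : ℕ) : ℂ) := fun j => by push_cast; ring
      simp only [e]
      rw [Finset.prod_range_succ (fun j : ℕ => z - y + ((j + 1 : ℕ) : ℂ)) r]
      have h1 : ∏ j ∈ Finset.range r, (z - y + ((j + 1 : ℕ) : ℂ)) ≠ 0 :=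
        Finset.prod_ne_zero_iff.2 fun j hj => hne z hz _ (by
          have := Finset.mem_range.1 hj; omega)
      have h2 := hne z hz 0 (by omega)
      have h3 := hne z hz (r + 1) le_rfl
      rw [Nat.factorial_succ]
      push_cast at h1 h2 h3 ⊢
      field_simp
      ring
    · refine ContinuousOn.div (continuous_const.mul hf.continuous).continuousOn ?_ ?_
      · simp only [rising_eq_prod]; fun_prop
      · intro z hz
        rw [rising_eq_prod]
        refine Finset.prod_ne_zero_iff.2 fun j hj => hne z hz j ?_
        have := Finset.mem_range.1 hj
        omega
    · refine ContinuousOn.div (continuous_const.mul hf.continuous).continuousOn ?_ ?_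
      · simp only [rising_eq_prod]; fun_prop
      · intro z hz
        rw [rising_eq_prod]
        refine Finset.prod_ne_zero_iff.2 fun j hj => ?_
        have := hne z hz (j + 1) (by have := Finset.mem_range.1 hj; omega)
        push_cast at this
        intro h
        exact this (by linear_combination h)

/-- The integral is the Taylor coefficient of `w^r` in `(1-w)^(-n)`. For `r < 0` the integrand has
no pole inside, and multiplication by `1 - w` gives the recursion of `h_r`. -/
lemma cint_zpow {c : ℂ} {R : ℝ} (h0 : (0 : ℂ) ∈ Metric.ball c R)
    (h1 : (1 : ℂ) ∉ Metric.closedBall c R) (n : ℕ) (r : ℤ) :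
    cint c R (fun w => (w ^ (r + 1) * (1 - w) ^ n)⁻¹) = (homSymInt 1 0 n r : ℂ) := by
  have hR : 0 ≤ R := dist_nonneg.trans (Metric.mem_ball.1 h0).le
  have hw0 : ∀ w ∈ Metric.sphere c R, w ≠ 0 := fun w hw => ne_of_mem_sphere_of_mem_ball hw h0
  have hw1 : ∀ w ∈ Metric.closedBall c R, 1 - w ≠ 0 := fun w hw h => by
    rw [sub_eq_zero] at h
    exact h1 (h ▸ hw)
  have hcont : ∀ (n : ℕ) (r : ℤ), ContinuousOn (fun w : ℂ => (w ^ r * (1 - w) ^ n)⁻¹)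
      (Metric.sphere c R) := by
    intro n r
    refine ContinuousOn.inv₀ (ContinuousOn.mul (ContinuousOn.zpow₀ continuousOn_id _ ?_)
      (by fun_prop)) ?_
    · exact fun w hw => Or.inl (hw0 w hw)
    · exact fun w hw => mul_ne_zero (zpow_ne_zero _ (hw0 w hw))
        (pow_ne_zero _ (hw1 w (Metric.sphere_subset_closedBall hw)))
  have hneg : ∀ (n : ℕ) (r : ℤ), r < 0 →
      cint c R (fun w => (w ^ (r + 1) * (1 - w) ^ n)⁻¹) = 0 := by
    intro n r hr
    obtain ⟨k, hk⟩ : ∃ k : ℕ, r + 1 = -(k : ℤ) := ⟨(-(r + 1)).toNat, by omega⟩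
    have : (fun w : ℂ => (w ^ (r + 1) * (1 - w) ^ n)⁻¹) = fun w => w ^ k * ((1 - w) ^ n)⁻¹ := by
      funext w
      rw [hk, mul_inv, zpow_neg, inv_inv, zpow_natCast]
    rw [this]
    refine cint_eq_zero hR (DifferentiableOn.mul (by fun_prop) (DifferentiableOn.inv (by fun_prop) ?_))
    exact fun w hw => pow_ne_zero _ (hw1 w hw)
  induction n generalizing r with
  | zero =>
    rw [homSymInt_zero]
    by_cases hr : r = 0
    · subst hr
      have := cint_sub_inv_mul (w := 0) (f := fun _ => (1 : ℂ)) (c := c) (r := R)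
        (differentiableOn_const _) h0
      simpa using this
    · have h := circleIntegral.integral_sub_zpow_of_ne (n := -(r + 1)) (by omega) c 0 R
      simp only [sub_zero, zpow_neg] at h
      simp [cint, h, hr]
  | succ n ih =>
    have hstep : ∀ r : ℤ, cint c R (fun w => (w ^ (r + 1) * (1 - w) ^ (n + 1))⁻¹)
        = homSymInt 1 0 n r + cint c R (fun w => (w ^ (r - 1 + 1) * (1 - w) ^ (n + 1))⁻¹) := by
      intro r
      rw [← ih r, ← sub_eq_iff_eq_add, ← cint_sub hR (hcont _ _) (hcont _ _)]
      refine cint_congr hR fun w hw => ?_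
      have e0 := hw0 w hw
      have e1 := hw1 w (Metric.sphere_subset_closedBall hw)
      rw [sub_add_cancel, zpow_add_one₀ e0, pow_succ]
      have e2 := zpow_ne_zero r e0
      field_simp
    rcases lt_or_ge r 0 with hr | hr
    · rw [hneg _ _ hr, homSymInt_of_neg hr, Complex.ofReal_zero]
    · lift r to ℕ using hr
      induction r with
      | zero =>
        rw [hstep, hneg _ _ (by simp), add_zero]
        simp [homSymInt]
      | succ k ihk =>
        rw [hstep, homSymInt_succ 1 0 n]
        have e : ((k + 1 : ℕ) : ℤ) - 1 = k := by push_cast; ring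
        rw [e, ihk]
        simp

lemma differentiableOn_cint_cauchy {c : ℂ} {R : ℝ} (hR : 0 < R) {f : ℂ → ℂ}
    (hf : ContinuousOn f (Metric.sphere c R)) :
    DifferentiableOn ℂ (fun w => cint c R fun z => (z - w)⁻¹ * f z) (Metric.ball c R) := by
  lift R to NNReal using hR.le
  have h := hasFPowerSeriesOn_cauchy_integral (hf.circleIntegrable R.2) (by exact_mod_cast hR)
  have h2 := h.differentiableOn
  rw [Metric.eball_coe] at h2
  exact h2

/-! ### Determinantal integrals over tori -/

lemma torusIntegral_prod {k : ℕ} (c : ℂ) (r : ℝ) (f : Fin k → ℂ → ℂ) :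
    (∯ u in T((fun _ : Fin k => c), (fun _ : Fin k => r)), ∏ a, f a (u a))
      = ∏ a, ∮ z in C(c, r), f a z := by
  rw [torusIntegral, ← Set.pi_univ_Icc, MeasureTheory.volume_pi, MeasureTheory.Measure.restrict_pi_pi]
  simp only [circleIntegral_def_Icc]
  rw [← MeasureTheory.integral_fintype_prod_eq_prod]
  congr 1
  funext θ
  rw [smul_eq_mul, ← Finset.prod_mul_distrib]
  refine Finset.prod_congr rfl fun a _ => ?_
  simp [torusMap, circleMap]

lemma torusIntegrable_prod {k : ℕ} {c : ℂ} {r : ℝ} (hr : 0 ≤ r) {f : Fin k → ℂ → ℂ}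
    (hf : ∀ a, ContinuousOn (f a) (Metric.sphere c r)) :
    TorusIntegrable (fun u => ∏ a, f a (u a)) (fun _ : Fin k => c) (fun _ : Fin k => r) := by
  rw [TorusIntegrable]
  refine ContinuousOn.integrableOn_compact isCompact_Icc (Continuous.continuousOn ?_)
  refine continuous_finsetProd _ fun a _ => ?_
  have : Continuous fun θ : ℝ => f a (circleMap c r θ) :=
    (hf a).comp_continuous (continuous_circleMap c r) fun θ => circleMap_mem_sphere c hr θ
  exact this.comp (continuous_apply a)

lemma torusIntegral_finset_sum {k : ℕ} {c : Fin k → ℂ} {r : Fin k → ℝ} {ι : Type*} (s : Finset ι)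
    {f : ι → (Fin k → ℂ) → ℂ} (hf : ∀ i ∈ s, TorusIntegrable (f i) c r) :
    (∯ u in T(c, r), ∑ i ∈ s, f i u) = ∑ i ∈ s, ∯ u in T(c, r), f i u := by
  simp only [torusIntegral, Finset.smul_sum]
  exact MeasureTheory.integral_finsetSum _ fun i hi => (hf i hi).function_integrable

/-! ### Andréief's identity on tori -/

lemma torusIntegrable_finset_sum {k : ℕ} {c : Fin k → ℂ} {r : Fin k → ℝ} {ι : Type*}
    (s : Finset ι) {f : ι → (Fin k → ℂ) → ℂ} (hf : ∀ i ∈ s, TorusIntegrable (f i) c r) :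
    TorusIntegrable (fun u => ∑ i ∈ s, f i u) c r :=
  MeasureTheory.integrable_finsetSum _ hf

section Andreief

variable {k : ℕ} {c : ℂ} {r : ℝ} {w : ℂ → ℂ} {A B : Fin k → ℂ → ℂ}

lemma prod_mul_det_mul_det (w : ℂ → ℂ) (A B : Fin k → ℂ → ℂ) (u : Fin k → ℂ) :
    (∏ a, w (u a)) * (Matrix.of fun i j => A i (u j)).det * (Matrix.of fun i j => B i (u j)).det
      = ∑ σ : Equiv.Perm (Fin k), ∑ τ : Equiv.Perm (Fin k),
        (((Equiv.Perm.sign σ : ℤ) : ℂ) * ((Equiv.Perm.sign τ : ℤ) : ℂ))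
          * ∏ a, (w (u a) * A (σ a) (u a) * B (τ a) (u a)) := by
  rw [Matrix.det_apply', Matrix.det_apply', mul_assoc, Finset.sum_mul_sum, Finset.mul_sum]
  refine Finset.sum_congr rfl fun σ _ => ?_
  rw [Finset.mul_sum]
  refine Finset.sum_congr rfl fun τ _ => ?_
  simp only [Matrix.of_apply, Finset.prod_mul_distrib]
  ring

lemma torusIntegrable_det_mul_det (hr : 0 ≤ r)
    (h : ∀ i j, ContinuousOn (fun z => w z * A i z * B j z) (Metric.sphere c r)) :
    TorusIntegrable (fun u => (∏ a, w (u a)) * (Matrix.of fun i j => A i (u j)).det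
      * (Matrix.of fun i j => B i (u j)).det) (fun _ : Fin k => c) (fun _ : Fin k => r) := by
  simp only [prod_mul_det_mul_det]
  refine MeasureTheory.integrable_finsetSum _ fun σ _ =>
    MeasureTheory.integrable_finsetSum _ fun τ _ => ?_
  exact (torusIntegrable_prod hr (f := fun a z => w z * A (σ a) z * B (τ a) z)
    fun a => h _ _).const_mul _

/-- Both determinants are expanded. For fixed `σ` the sum over `τ` is the determinant of the moment
matrix with rows permuted by `σ`; its sign cancels that of `σ`, so all `k!` permutations contribute
equally. -/
lemma torusIntegral_det_mul_det (hr : 0 ≤ r)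
    (h : ∀ i j, ContinuousOn (fun z => w z * A i z * B j z) (Metric.sphere c r)) :
    ((2 * Real.pi * Complex.I : ℂ)⁻¹) ^ k *
      (∯ u in T((fun _ : Fin k => c), (fun _ : Fin k => r)),
        (∏ a, w (u a)) * (Matrix.of fun i j => A i (u j)).det
          * (Matrix.of fun i j => B i (u j)).det)
      = (k.factorial : ℂ) *
        (Matrix.of fun i j => cint c r fun z => w z * A i z * B j z).det := by
  have hint : ∀ σ τ : Equiv.Perm (Fin k), TorusIntegrable
      (fun u => (((Equiv.Perm.sign σ : ℤ) : ℂ) * ((Equiv.Perm.sign τ : ℤ) : ℂ))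
          * ∏ a, (w (u a) * A (σ a) (u a) * B (τ a) (u a)))
      (fun _ : Fin k => c) (fun _ : Fin k => r) := fun σ τ =>
    (torusIntegrable_prod hr (f := fun a z => w z * A (σ a) z * B (τ a) z)
      fun a => h _ _).const_mul _
  simp only [prod_mul_det_mul_det]
  rw [torusIntegral_finset_sum _ fun σ _ =>
    torusIntegrable_finset_sum _ fun τ _ => hint σ τ, Finset.mul_sum]
  set G : Matrix (Fin k) (Fin k) ℂ :=
    Matrix.of fun i j => cint c r fun z => w z * A i z * B j z with hG
  have hσ : ∀ σ : Equiv.Perm (Fin k), ((2 * Real.pi * Complex.I : ℂ)⁻¹) ^ k *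
      (∯ u in T((fun _ : Fin k => c), (fun _ : Fin k => r)),
        ∑ τ : Equiv.Perm (Fin k), (((Equiv.Perm.sign σ : ℤ) : ℂ) * ((Equiv.Perm.sign τ : ℤ) : ℂ))
          * ∏ a, (w (u a) * A (σ a) (u a) * B (τ a) (u a))) = G.det := by
    intro σ
    rw [torusIntegral_finset_sum _ fun τ _ => hint σ τ, Finset.mul_sum]
    have h1 : ∀ τ : Equiv.Perm (Fin k), ((2 * Real.pi * Complex.I : ℂ)⁻¹) ^ k *
        (∯ u in T((fun _ : Fin k => c), (fun _ : Fin k => r)),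
          (((Equiv.Perm.sign σ : ℤ) : ℂ) * ((Equiv.Perm.sign τ : ℤ) : ℂ))
          * ∏ a, (w (u a) * A (σ a) (u a) * B (τ a) (u a)))
        = ((Equiv.Perm.sign σ : ℤ) : ℂ) * (((Equiv.Perm.sign τ : ℤ) : ℂ) *
          ∏ a, G (σ a) (τ a)) := by
      intro τ
      rw [torusIntegral_const_mul,
        torusIntegral_prod c r fun a z => w z * A (σ a) z * B (τ a) z]
      simp only [hG, Matrix.of_apply, cint, Finset.prod_mul_distrib, Finset.prod_const,
        Finset.card_univ, Fintype.card_fin]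
      ring
    simp only [h1]
    rw [← Finset.mul_sum]
    have h2 : ∑ τ : Equiv.Perm (Fin k), ((Equiv.Perm.sign τ : ℤ) : ℂ) * ∏ a, G (σ a) (τ a)
        = (G.submatrix σ id).transpose.det := by
      rw [Matrix.det_apply']
      rfl
    rw [h2, Matrix.det_transpose, Matrix.det_permute, ← mul_assoc]
    have h3 : ((Equiv.Perm.sign σ : ℤ) : ℂ) * ((Equiv.Perm.sign σ : ℤ) : ℂ) = 1 := by
      rw [← Int.cast_mul, ← Units.val_mul, Int.units_mul_self]
      simp
    rw [h3, one_mul]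
  rw [Finset.sum_congr rfl fun σ _ => hσ σ]
  simp [Fintype.card_perm]

end Andreief

/-- Andréief's identity with one of the variables frozen. -/
lemma torusIntegral_det_cons_mul_det_cons {k : ℕ} {c : ℂ} {r : ℝ} (hr : 0 ≤ r) {w : ℂ → ℂ}
    {A B : Fin (k + 1) → ℂ → ℂ} (α β : Fin (k + 1) → ℂ)
    (h : ∀ i j, ContinuousOn (fun z => w z * A i z * B j z) (Metric.sphere c r)) :
    ((2 * Real.pi * Complex.I : ℂ)⁻¹) ^ k *
      (∯ u in T((fun _ : Fin k => c), (fun _ : Fin k => r)),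
        (∏ a, w (u a))
          * (Matrix.of fun i j => (Fin.cons (α i) (fun a => A i (u a)) : Fin (k + 1) → ℂ) j).det
          * (Matrix.of fun i j => (Fin.cons (β i) (fun a => B i (u a)) : Fin (k + 1) → ℂ) j).det)
      = (k.factorial : ℂ) * ∑ i, ∑ j, α i * β j *
        (Matrix.of fun i j => cint c r fun z => w z * A i z * B j z).adjugate j i := by
  set G : Matrix (Fin (k + 1)) (Fin (k + 1)) ℂ :=
    Matrix.of fun i j => cint c r fun z => w z * A i z * B j z with hG
  have hexp : ∀ u : Fin k → ℂ, (∏ a, w (u a))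
        * (Matrix.of fun i j => (Fin.cons (α i) (fun a => A i (u a)) : Fin (k + 1) → ℂ) j).det
        * (Matrix.of fun i j => (Fin.cons (β i) (fun a => B i (u a)) : Fin (k + 1) → ℂ) j).det
      = ∑ i : Fin (k + 1), ∑ j : Fin (k + 1), ((-1) ^ (i : ℕ) * α i * ((-1) ^ (j : ℕ) * β j)) *
        ((∏ a, w (u a)) * (Matrix.of fun i' j' => A (i.succAbove i') (u j')).det
          * (Matrix.of fun i' j' => B (j.succAbove i') (u j')).det) := by
    intro u
    -- Expansion of both determinants along the frozen first column; the products of minors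
    -- integrate to minors of `G`, and the two signs make them entries of the adjugate.
    rw [Matrix.det_succ_column_zero, Matrix.det_succ_column_zero, mul_assoc, Finset.sum_mul_sum,
      Finset.mul_sum]
    refine Finset.sum_congr rfl fun i _ => ?_
    rw [Finset.mul_sum]
    refine Finset.sum_congr rfl fun j _ => ?_
    have hA : (Matrix.of fun i j => (Fin.cons (α i) (fun a => A i (u a)) : Fin (k + 1) → ℂ) j).submatrix
        i.succAbove Fin.succ = Matrix.of fun i' j' => A (i.succAbove i') (u j') := by
      ext; simp
    have hB : (Matrix.of fun i j => (Fin.cons (β i) (fun a => B i (u a)) : Fin (k + 1) → ℂ) j).submatrix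
        j.succAbove Fin.succ = Matrix.of fun i' j' => B (j.succAbove i') (u j') := by
      ext; simp
    rw [hA, hB]
    simp only [Matrix.of_apply, Fin.cons_zero]
    ring
  have hint : ∀ i j : Fin (k + 1), TorusIntegrable (fun u : Fin k → ℂ =>
      ((-1) ^ (i : ℕ) * α i * ((-1) ^ (j : ℕ) * β j)) *
        ((∏ a, w (u a)) * (Matrix.of fun i' j' => A (i.succAbove i') (u j')).det
          * (Matrix.of fun i' j' => B (j.succAbove i') (u j')).det))
      (fun _ : Fin k => c) (fun _ : Fin k => r) := fun i j =>
    (torusIntegrable_det_mul_det hr (A := fun i' => A (i.succAbove i'))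
      (B := fun i' => B (j.succAbove i')) fun _ _ => h _ _).const_mul _
  simp only [hexp]
  rw [torusIntegral_finset_sum _ fun i _ =>
    torusIntegrable_finset_sum _ fun j _ => hint i j, Finset.mul_sum, Finset.mul_sum]
  refine Finset.sum_congr rfl fun i _ => ?_
  rw [torusIntegral_finset_sum _ fun j _ => hint i j, Finset.mul_sum, Finset.mul_sum]
  refine Finset.sum_congr rfl fun j _ => ?_
  rw [torusIntegral_const_mul, mul_left_comm,
    torusIntegral_det_mul_det hr (A := fun i' => A (i.succAbove i'))
      (B := fun i' => B (j.succAbove i')) fun _ _ => h _ _,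
    Matrix.adjugate_fin_succ_eq_det_submatrix]
  have : (Matrix.of fun i' j' => cint c r fun z => w z * A (i.succAbove i') z
      * B (j.succAbove j') z) = G.submatrix i.succAbove j.succAbove := rfl
  rw [this, pow_add]
  ring

/-- The sign relating `vdm` to the determinant of powers. -/
def vdmSign (k : ℕ) : ℂ := ∏ i : Fin k, ∏ _j ∈ Finset.Ioi i, (-1 : ℂ)

lemma vdmSign_ne_zero (k : ℕ) : vdmSign k ≠ 0 :=
  Finset.prod_ne_zero_iff.2 fun _ _ => Finset.prod_ne_zero_iff.2 fun _ _ => by norm_num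

lemma vdm_eq_det {k : ℕ} (u : Fin k → ℂ) :
    vdm u = vdmSign k * (Matrix.of fun i j : Fin k => u j ^ (i : ℕ)).det := by
  have h : (Matrix.of fun i j : Fin k => u j ^ (i : ℕ)) = (Matrix.vandermonde u).transpose := by
    ext i j
    simp [Matrix.vandermonde]
  rw [h, Matrix.det_transpose, Matrix.det_vandermonde, vdmSign, vdm, ← Finset.prod_mul_distrib]
  refine Finset.prod_congr rfl fun i _ => ?_
  rw [← Finset.prod_mul_distrib]
  refine Finset.prod_congr rfl fun j _ => ?_
  ring

/-! ### The Gram matrix on `𝓡` and its rank-one perturbation -/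

namespace CutPolygon

variable {d N : ℕ} (P : CutPolygon d N)

/-- The points `x_i` as complex numbers. -/
def xC (i : Fin (d + N)) : ℂ := (P.x i : ℂ)

lemma xC_injective : Function.Injective P.xC := fun i j h =>
  P.x_anti.injective (by unfold xC at h; exact_mod_cast h)

lemma Q_eq (z : ℂ) : P.Q z = ∏ i, (z - P.xC i) := rfl

/-- The weight `1 / Q'(x_i)`. -/
def weight (i : Fin (d + N)) : ℂ := nodeWeight P.xC i

/-- The polynomial `(z - y_b + 1)_{N-1} / (N-1)!`. -/
def cutPoly (b : Fin d) (z : ℂ) : ℂ := (binPoly ℂ N).eval (z - (P.y b : ℂ))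

lemma eval_binPoly_eq_rising {n : ℕ} (hn : 0 < n) (z : ℂ) :
    (binPoly ℂ n).eval z = rising (z + 1) (n - 1) / ((n - 1).factorial : ℂ) := by
  obtain ⟨n, rfl⟩ : ∃ m, n = m + 1 := ⟨n - 1, by omega⟩
  rw [binPoly, Polynomial.eval_prod, rising_eq_prod, add_tsub_cancel_right,
    ← Finset.prod_range_add_one_eq_factorial, Nat.cast_prod, ← Finset.prod_div_distrib]
  refine Finset.prod_congr rfl fun i _ => ?_
  simp only [Polynomial.eval_mul, Polynomial.eval_C, Polynomial.eval_add, Polynomial.eval_X]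
  push_cast
  rw [div_eq_inv_mul]
  ring

/-- The spread condition with equal indices reads `0 ≤ N - 1`. -/
lemma N_pos (P : CutPolygon d N) (b : Fin d) : 0 < N := by
  have := P.spread b b
  omega

lemma cutPoly_eq (b : Fin d) (z : ℂ) :
    P.cutPoly b z = rising (z - (P.y b : ℂ) + 1) (N - 1) / ((N - 1).factorial : ℂ) :=
  eval_binPoly_eq_rising (P.N_pos b) _

lemma differentiable_cutPoly (b : Fin d) : Differentiable ℂ (P.cutPoly b) := by
  unfold cutPoly
  fun_prop

open Classical in
/-- The set of indices with `x_i ∈ 𝓡`. -/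
def setR : Finset (Fin (d + N)) := Finset.univ.filter P.InR

/-- The matrix of moments `∑_{𝓡} x_i^a (x_i - y_b + 1)_{N-1} / ((N-1)! Q'(x_i))`. -/
def gram : Matrix (Fin d) (Fin d) ℂ :=
  Matrix.of fun a b => ∑ i ∈ P.setR, P.weight i * (P.xC i ^ (a : ℕ) * P.cutPoly b (P.xC i))

/-- The moments with the additional factor `(v - u) / (z - u)`. -/
def gramShift (v z : ℂ) : Matrix (Fin d) (Fin d) ℂ :=
  Matrix.of fun a b => ∑ i ∈ P.setR, P.weight i *
    ((v - P.xC i) / (z - P.xC i) * P.xC i ^ (a : ℕ) * P.cutPoly b (P.xC i))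

/-- `∑_{𝓡} (x_i - y_b + 1)_{N-1} / ((N-1)! Q'(x_i) (z - x_i))`. -/
def stieltjes (b : Fin d) (z : ℂ) : ℂ :=
  ∑ i ∈ P.setR, P.weight i * P.cutPoly b (P.xC i) * (z - P.xC i)⁻¹

/-- The polynomials of degree less than `d` which are dual to the cut polynomials. -/
def dualPoly (b : Fin d) (v : ℂ) : ℂ := ∑ a : Fin d, v ^ (a : ℕ) * (P.gram)⁻¹ b a

/-- The factor `(v-u)/(z-u) = 1 - (z-v)/(z-u)` is expanded using the geometric sums for `(u^a -
z^a)/(u-z)` and `(v^a - z^a)/(v-z)`. Up to a unipotent lower triangular row operation, the Gram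
matrix then changes by a matrix of rank one only. -/
lemma gramShift_eq {v z : ℂ} (hz : ∀ i ∈ P.setR, z ≠ P.xC i) :
    P.gramShift v z = (1 + (z - v) • Matrix.of fun a k : Fin d =>
        if (k : ℕ) < a then z ^ ((a : ℕ) - 1 - k) else 0)
      * (P.gram + Matrix.replicateCol Unit (fun a : Fin d => -(z - v) * v ^ (a : ℕ))
        * Matrix.replicateRow Unit fun b => P.stieltjes b z) := by
  set S : Fin d → ℂ → ℂ := fun a t =>
    ∑ k : Fin d, (if (k : ℕ) < a then z ^ ((a : ℕ) - 1 - k) else 0) * t ^ (k : ℕ) with hS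
  have hSt : ∀ a t, S a t * (t - z) = t ^ (a : ℕ) - z ^ (a : ℕ) := by
    intro a t
    rw [← geom_sum₂_mul]
    congr 1
    rw [hS]
    simp only [ite_mul, zero_mul]
    rw [Fin.sum_univ_eq_sum_range (fun k => if k < (a : ℕ) then z ^ ((a : ℕ) - 1 - k) * t ^ k else 0) d,
      ← Finset.sum_filter]
    have : Finset.filter (fun k => k < (a : ℕ)) (Finset.range d) = Finset.range a := by
      ext k
      have := a.2
      simp only [Finset.mem_filter, Finset.mem_range]
      omega
    rw [this]
    exact Finset.sum_congr rfl fun k _ => mul_comm _ _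
  have hX : ∀ k b, (P.gram + Matrix.replicateCol Unit (fun a : Fin d => -(z - v) * v ^ (a : ℕ))
        * Matrix.replicateRow Unit fun b => P.stieltjes b z) k b
      = ∑ i ∈ P.setR, P.weight i * P.cutPoly b (P.xC i) *
        (P.xC i ^ (k : ℕ) - (z - v) * v ^ (k : ℕ) * (z - P.xC i)⁻¹) := by
    intro k b
    simp only [Matrix.add_apply, Matrix.mul_apply, Matrix.replicateCol_apply,
      Matrix.replicateRow_apply, Finset.univ_unique, Finset.sum_singleton, gram, Matrix.of_apply,
      stieltjes, Finset.mul_sum, ← Finset.sum_add_distrib]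
    refine Finset.sum_congr rfl fun i _ => ?_
    ring
  ext a b
  rw [add_mul, one_mul, Matrix.smul_mul, Matrix.add_apply, Matrix.smul_apply, Matrix.mul_apply, hX]
  simp only [hX, Matrix.of_apply, smul_eq_mul, Finset.mul_sum]
  rw [Finset.sum_comm, ← Finset.sum_add_distrib, gramShift, Matrix.of_apply]
  refine Finset.sum_congr rfl fun i hi => ?_
  have h1 : ∑ k : Fin d, (z - v) * ((if (k : ℕ) < a then z ^ ((a : ℕ) - 1 - k) else 0) *
      (P.weight i * P.cutPoly b (P.xC i) *
        (P.xC i ^ (k : ℕ) - (z - v) * v ^ (k : ℕ) * (z - P.xC i)⁻¹)))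
      = (z - v) * (P.weight i * P.cutPoly b (P.xC i)) *
        (S a (P.xC i) - (z - v) * (z - P.xC i)⁻¹ * S a v) := by
    rw [hS]
    simp only [mul_sub, Finset.mul_sum, ← Finset.sum_sub_distrib]
    refine Finset.sum_congr rfl fun k _ => ?_
    ring
  rw [h1]
  have hne : z - P.xC i ≠ 0 := sub_ne_zero.2 (hz i hi)
  have e1 := hSt a (P.xC i)
  have e2 := hSt a v
  field_simp
  linear_combination (P.weight i * P.cutPoly b (P.xC i) * (z - v)) * e1
    - (P.weight i * P.cutPoly b (P.xC i) * (z - v)) * e2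

lemma det_gramShift (hG : P.gram.det ≠ 0) {v z : ℂ} (hz : ∀ i ∈ P.setR, z ≠ P.xC i) :
    (P.gramShift v z).det
      = P.gram.det * (1 - (z - v) * ∑ b, P.dualPoly b v * P.stieltjes b z) := by
  rw [P.gramShift_eq hz, Matrix.det_mul,
    Matrix.det_add_replicateCol_mul_replicateRow (isUnit_iff_ne_zero.2 hG)]
  have h1 : (1 + (z - v) • Matrix.of fun a k : Fin d =>
      if (k : ℕ) < a then z ^ ((a : ℕ) - 1 - k) else 0).det = 1 := by
    rw [Matrix.det_of_isLowerTriangular]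
    · refine Finset.prod_eq_one fun i _ => ?_
      simp
    · intro i j hij
      have hij' : (i : ℕ) < j := hij
      have : i ≠ j := by rintro rfl; omega
      simp [Matrix.one_apply_ne this, show ¬ j < i from fun h => by omega]
  rw [h1, one_mul]
  congr 1
  have h2 : (Matrix.replicateRow Unit (fun b => P.stieltjes b z) * P.gram⁻¹ *
      Matrix.replicateCol Unit fun a : Fin d => -(z - v) * v ^ (a : ℕ)) default default
      = -((z - v) * ∑ b, P.dualPoly b v * P.stieltjes b z) := by
    simp only [Matrix.mul_apply, Matrix.replicateCol_apply, Matrix.replicateRow_apply, dualPoly,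
      Finset.sum_mul, Finset.mul_sum]
    rw [Finset.sum_comm, ← Finset.sum_neg_distrib]
    refine Finset.sum_congr rfl fun b _ => ?_
    rw [← Finset.sum_neg_distrib]
    refine Finset.sum_congr rfl fun a _ => ?_
    ring
  rw [Matrix.det_unique, Matrix.add_apply, Matrix.one_apply_eq, h2, ← sub_eq_add_neg]

lemma sum_weight_cutPoly_dualPoly (hG : P.gram.det ≠ 0) (b k : Fin d) :
    ∑ i ∈ P.setR, P.weight i * P.cutPoly k (P.xC i) * P.dualPoly b (P.xC i)
      = if b = k then 1 else 0 := by
  have h : ((P.gram)⁻¹ * P.gram) b k = if b = k then 1 else 0 := by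
    rw [Matrix.nonsing_inv_mul _ (isUnit_iff_ne_zero.2 hG), Matrix.one_apply]
  rw [← h, Matrix.mul_apply]
  simp only [dualPoly, gram, Matrix.of_apply, Finset.mul_sum]
  rw [Finset.sum_comm]
  refine Finset.sum_congr rfl fun a _ => Finset.sum_congr rfl fun i _ => ?_
  ring

/-! ### The linear system characterizing the coefficients -/

lemma eq_zero_of_sum_H (hdet : (P.H 1).det ≠ 0) {c : Fin (d + N) → ℂ}
    (h : ∀ k, ∑ j, (P.H 1 j k : ℂ) * c j = 0) : c = 0 := by
  have hdet' : ((P.H 1).map Complex.ofRealHom).det ≠ 0 := by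
    rw [← RingHom.mapMatrix_apply, ← RingHom.map_det]
    simpa using hdet
  refine Matrix.eq_zero_of_vecMul_eq_zero hdet' ?_
  funext k
  rw [Matrix.vecMul_eq_sum, Finset.sum_apply]
  rw [Pi.zero_apply, ← h k]
  refine Finset.sum_congr rfl fun j _ => ?_
  simp [mul_comm]

lemma coef_unique (hdet : (P.H 1).det ≠ 0) {n : ℕ} {y : ℤ} {c : Fin (d + N) → ℂ}
    (h : ∀ k, ∑ j, (P.H 1 j k : ℂ) * c j = (P.colFun 1 n k y : ℂ)) (j : Fin (d + N)) :
    (P.coef n y j : ℂ) = c j := by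
  have h1 := P.eq_zero_of_sum_H hdet (c := fun j => (P.coef n y j : ℂ) - c j) fun k => by
    simp only [mul_sub, Finset.sum_sub_distrib, h]
    rw [← P.sum_H_mul_coef hdet n y k]
    push_cast
    exact sub_self _
  exact sub_eq_zero.1 (congrFun h1 j)

/-- Outside `𝓡` the point `x_j` is to the left of every `y_b`, so the entry is zero. On `𝓡` some
`y_i ≤ x_j`, and the spread condition gives `x_j - y_b > -N`, where `h` is the polynomial `cutPoly`.
-/
lemma sum_H_of_lt (b : Fin d) (c : Fin (d + N) → ℂ) :
    ∑ j, (P.H 1 j (Fin.castAdd N b) : ℂ) * c j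
      = ∑ j ∈ P.setR, P.cutPoly b (P.xC j) * c j := by
  classical
  rw [setR, Finset.sum_filter]
  refine Finset.sum_congr rfl fun j _ => ?_
  have hy : P.yExt (Fin.castAdd N b) = P.y b := P.yExt_of_lt (by simp)
  rw [H_apply, hy]
  split_ifs with hj
  · obtain ⟨i, hi⟩ := hj
    have := P.spread b i
    rw [← homExt_eq_homSymInt one_pos le_rfl _ _ _ (by omega), homExt_one, eval_binPoly_ofReal,
      cutPoly, xC]
    push_cast
    rfl
  · have : P.x j < P.y b := by
      by_contra hcon
      exact hj ⟨b, not_lt.1 hcon⟩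
    rw [homSymInt_of_neg (by omega)]
    simp

lemma H_one_natAdd (j : Fin (d + N)) (k : Fin N) :
    (P.H 1 j (Fin.natAdd d k) : ℂ) = (binPoly ℂ N).eval (P.xC j + ((d + k : ℕ) + 1 : ℂ)) := by
  rw [P.H_one_of_ge (by simp), homExt_one, eval_binPoly_ofReal, xC, Fin.val_natAdd]
  push_cast
  rfl

lemma natDegree_binPoly_comp_le (a : ℂ) :
    ((binPoly ℂ N).comp (Polynomial.X + Polynomial.C a)).natDegree ≤ N - 1 := by
  rw [Polynomial.natDegree_comp, Polynomial.natDegree_X_add_C, mul_one]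
  exact natDegree_binPoly_le ℂ N

/-- A left null vector is a polynomial `p` of degree below `d`. Then `p(x_j)/Q'(x_j)` solves the
homogeneous system: the cut equations are the null condition, and the others hold because `deg (g p)
< d + N - 1`. Hence `p` vanishes at all `d + N` nodes. -/
lemma det_gram_ne_zero (hdet : (P.H 1).det ≠ 0) : P.gram.det ≠ 0 := by
  intro hG
  obtain ⟨r, hr, hr0⟩ := Matrix.exists_vecMul_eq_zero_iff.2 hG
  set p : Polynomial ℂ := ∑ a : Fin d, Polynomial.C (r a) * Polynomial.X ^ (a : ℕ) with hp
  have hpe : ∀ z, p.eval z = ∑ a : Fin d, r a * z ^ (a : ℕ) := fun z => by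
    simp [hp, Polynomial.eval_finsetSum]
  have hd : 0 < d := by
    by_contra hcon
    apply hr
    funext a
    exact absurd a.2 (by omega)
  have hN := P.N_pos ⟨0, hd⟩
  have hpdeg : p.natDegree ≤ d - 1 := by
    refine Polynomial.natDegree_sum_le_of_forall_le _ _ fun a _ => ?_
    exact (Polynomial.natDegree_C_mul_X_pow_le _ _).trans (by omega)
  have hc := P.eq_zero_of_sum_H hdet (c := fun j => P.weight j * p.eval (P.xC j)) fun k => by
    refine Fin.addCases (fun b => ?_) (fun k => ?_) k
    · rw [P.sum_H_of_lt b]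
      have := congrFun hr0 b
      rw [Matrix.vecMul_eq_sum, Finset.sum_apply] at this
      rw [Pi.zero_apply] at this
      rw [← this]
      simp only [hpe, gram, Matrix.of_apply, Pi.smul_apply, smul_eq_mul, Finset.mul_sum]
      rw [Finset.sum_comm]
      refine Finset.sum_congr rfl fun a _ => Finset.sum_congr rfl fun i _ => ?_
      ring
    · set g := (binPoly ℂ N).comp (Polynomial.X + Polynomial.C ((d + k : ℕ) + 1 : ℂ)) with hg
      have h := sum_nodeWeight_mul_eval P.xC_injective (p := g * p) (by
        have h1 := Polynomial.natDegree_mul_le (p := g) (q := p)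
        have h2 : g.natDegree ≤ N - 1 := natDegree_binPoly_comp_le _
        rw [Fintype.card_fin]
        omega)
      rw [← h]
      refine Finset.sum_congr rfl fun j _ => ?_
      rw [H_one_natAdd, hg, weight]
      simp only [Polynomial.eval_mul, Polynomial.eval_comp, Polynomial.eval_add, Polynomial.eval_X,
        Polynomial.eval_C]
      ring
  have hp0 : p = 0 := by
    refine Polynomial.eq_zero_of_natDegree_lt_card_of_eval_eq_zero p P.xC_injective (fun j => ?_) ?_
    · have := congrFun hc j
      exact (mul_eq_zero.1 this).resolve_left (nodeWeight_ne_zero P.xC_injective j)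
    · rw [Fintype.card_fin]; omega
  apply hr
  funext a
  have h1 : p.coeff a = r a := by
    simp only [hp, Polynomial.finsetSum_coeff, Polynomial.coeff_C_mul, Polynomial.coeff_X_pow]
    rw [Finset.sum_eq_single a]
    · simp
    · intro b _ hb
      rw [if_neg fun h => hb (Fin.ext h.symm), mul_zero]
    · simp
  rw [← h1, hp0]
  simp

lemma nabla_binPoly (r n : ℕ) (a z : ℂ) :
    nabla r (fun t => (binPoly ℂ (n + r)).eval (t + a)) z = (binPoly ℂ n).eval (z + a) := by
  have hrec : ∀ (n : ℕ) (z : ℂ), (binPoly ℂ (n + 1)).eval z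
      - (binPoly ℂ (n + 1)).eval (z - 1) = (binPoly ℂ n).eval z := by
    intro n z
    cases n with
    | zero => simp [binPoly]
    | succ n =>
      rw [eval_binPoly_eq_rising (by omega), eval_binPoly_eq_rising (by omega),
        eval_binPoly_eq_rising (by omega)]
      simp only [rising_eq_prod, add_tsub_cancel_right]
      rw [Finset.prod_range_succ, Finset.prod_range_succ' (fun j : ℕ => z - 1 + 1 + (j : ℂ))]
      have e : ∀ j : ℕ, z - 1 + 1 + ((j + 1 : ℕ) : ℂ) = z + 1 + j := fun j => by push_cast; ring
      simp only [e]
      have h1 : (n.factorial : ℂ) ≠ 0 := by exact_mod_cast n.factorial_ne_zero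
      have h2 : (n : ℂ) + 1 ≠ 0 := by exact_mod_cast n.succ_ne_zero
      rw [Nat.factorial_succ]
      push_cast
      field_simp
      ring
  induction r generalizing n z with
  | zero => rfl
  | succ r ih =>
    rw [nabla]
    have h := fun z => ih (n + 1) z
    rw [show n + 1 + r = n + (r + 1) by ring] at h
    rw [h, h, ← hrec n (z + a)]
    congr 2
    ring

/-- The iterated backward difference `∇^{N-n} (Q / (· - x_i)) (y)`. -/
def topCoef (n : ℕ) (y : ℤ) (i : Fin (d + N)) : ℂ := nabla (N - n) (nodeProd P.xC i) (y : ℂ)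

/-- Closed form of the coefficients of the kernel. -/
lemma coef_eq (hdet : (P.H 1).det ≠ 0) {n : ℕ} (hn : n ≤ N) (y : ℤ) (j : Fin (d + N)) :
    (P.coef n y j : ℂ) = P.weight j * (P.topCoef n y j
      - ∑ b, P.dualPoly b (P.xC j) *
          ∑ l ∈ P.setR, P.weight l * P.cutPoly b (P.xC l) * P.topCoef n y l
      + ∑ b, P.dualPoly b (P.xC j) * (homSymInt 1 0 n (y - P.y b) : ℂ)) := by
  have hG := P.det_gram_ne_zero hdet
  revert j
  refine P.coef_unique hdet fun k => ?_
  refine Fin.addCases (fun k => ?_) (fun k => ?_) k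
  · rw [P.sum_H_of_lt k, colFun, if_pos (by simp), P.yExt_of_lt (by simp), homSymInt_one d 0]
    set T : Fin d → ℂ := fun b =>
      ∑ l ∈ P.setR, P.weight l * P.cutPoly b (P.xC l) * P.topCoef n y l with hT
    set F : Fin d → ℂ := fun b => (homSymInt 1 0 n (y - P.y b) : ℂ) with hF
    -- By biorthogonality of the dual and cut polynomials, the corrections replace the value `T k`
    -- left by interpolation with the required `F k`.
    have h1 : ∀ V : Fin d → ℂ, ∑ j ∈ P.setR, P.cutPoly k (P.xC j) *
        (P.weight j * ∑ b, P.dualPoly b (P.xC j) * V b) = V k := by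
      intro V
      have : ∀ j ∈ P.setR, P.cutPoly k (P.xC j) *
          (P.weight j * ∑ b, P.dualPoly b (P.xC j) * V b)
          = ∑ b, P.weight j * P.cutPoly k (P.xC j) * P.dualPoly b (P.xC j) * V b := by
        intro j _
        rw [Finset.mul_sum, Finset.mul_sum]
        refine Finset.sum_congr rfl fun b _ => ?_
        ring
      rw [Finset.sum_congr rfl this, Finset.sum_comm]
      simp only [← Finset.sum_mul, P.sum_weight_cutPoly_dualPoly hG]
      simp
    simp only [mul_add, mul_sub, Finset.sum_add_distrib, Finset.sum_sub_distrib]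
    rw [h1 T, h1 F]
    have h2 : ∑ j ∈ P.setR, P.cutPoly k (P.xC j) * (P.weight j * P.topCoef n y j) = T k := by
      rw [hT]
      refine Finset.sum_congr rfl fun l _ => ?_
      ring
    rw [h2, sub_self, zero_add]
    rfl
  · obtain ⟨g, hg⟩ : ∃ g, g = (binPoly ℂ N).comp
        (Polynomial.X + Polynomial.C ((d + k : ℕ) + 1 : ℂ)) := ⟨_, rfl⟩
    have hkN := k.2
    have hgdeg : g.natDegree ≤ N - 1 := hg ▸ natDegree_binPoly_comp_le _
    have hge : ∀ z, g.eval z = (binPoly ℂ N).eval (z + ((d + k : ℕ) + 1 : ℂ)) := fun z => by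
      simp [hg]
    have hH : ∀ j, (P.H 1 j (Fin.natAdd d k) : ℂ) = g.eval (P.xC j) := fun j => by
      rw [H_one_natAdd, hge]
    simp only [hH]
    -- The corrections have degree below `d` and `deg g < N`, so they do not disturb the equations
    -- of the added starting points.
    have h1 : ∀ V : Fin d → ℂ, ∑ j, g.eval (P.xC j) *
        (P.weight j * ∑ b, P.dualPoly b (P.xC j) * V b) = 0 := by
      intro V
      set D : Fin d → Polynomial ℂ := fun b =>
        ∑ a : Fin d, Polynomial.C ((P.gram)⁻¹ b a) * Polynomial.X ^ (a : ℕ) with hD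
      have hDe : ∀ b z, P.dualPoly b z = (D b).eval z := fun b z => by
        simp only [hD, dualPoly, Polynomial.eval_finsetSum, Polynomial.eval_mul,
          Polynomial.eval_C, Polynomial.eval_pow, Polynomial.eval_X]
        exact Finset.sum_congr rfl fun a _ => mul_comm _ _
      have h0 : ∀ b, ∑ j, P.weight j * (g * D b).eval (P.xC j) = 0 := by
        intro b
        refine sum_nodeWeight_mul_eval P.xC_injective ?_
        have h1 := Polynomial.natDegree_mul_le (p := g) (q := D b)
        have h2 : (D b).natDegree ≤ d - 1 := by
          refine Polynomial.natDegree_sum_le_of_forall_le _ _ fun a _ => ?_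
          exact (Polynomial.natDegree_C_mul_X_pow_le _ _).trans (by omega)
        have := b.2
        rw [Fintype.card_fin]
        omega
      have : ∀ j, g.eval (P.xC j) * (P.weight j * ∑ b, P.dualPoly b (P.xC j) * V b)
          = ∑ b, P.weight j * (g * D b).eval (P.xC j) * V b := by
        intro j
        rw [Finset.mul_sum, Finset.mul_sum]
        refine Finset.sum_congr rfl fun b _ => ?_
        rw [hDe, Polynomial.eval_mul]
        ring
      simp only [this]
      rw [Finset.sum_comm]
      simp only [← Finset.sum_mul, h0, zero_mul, Finset.sum_const_zero]
    simp only [mul_add, mul_sub, Finset.sum_add_distrib, Finset.sum_sub_distrib, h1, sub_zero,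
      add_zero]
    -- Lagrange interpolation reproduces `g`; taking `∇^(N-n)` at `y` lowers the binomial polynomial
    -- from level `N` to level `n`.
    have h2 : (fun z => ∑ j, P.weight j * g.eval (P.xC j) * nodeProd P.xC j z) = fun z => g.eval z := by
      funext z
      refine sum_nodeWeight_mul_nodeProd P.xC_injective ?_ z
      refine lt_of_le_of_lt Polynomial.degree_le_natDegree ?_
      rw [Fintype.card_fin]
      exact_mod_cast (show g.natDegree < d + N by omega)
    have h3 := nabla_sum Finset.univ (fun j => P.weight j * g.eval (P.xC j)) (nodeProd P.xC) (N - n)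
      (y : ℂ)
    rw [h2] at h3
    have h4 := nabla_binPoly (N - n) n ((d + k : ℕ) + 1 : ℂ) (y : ℂ)
    rw [show n + (N - n) = N by omega] at h4
    rw [funext hge, h4] at h3
    rw [colFun, if_neg (by simp), P.yExt_of_ge (by simp), homExt_one, eval_binPoly_ofReal]
    have e : (((y - -(((Fin.natAdd d k : Fin (d + N)) : ℕ) + 1 : ℤ) : ℤ) : ℝ) : ℂ)
        = (y : ℂ) + ((d + k : ℕ) + 1) := by
      rw [Fin.val_natAdd]; push_cast; ring
    rw [e, h3]
    refine Finset.sum_congr rfl fun j _ => ?_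
    rw [hge, topCoef]
    ring

end CutPolygon

namespace CutPolygon

variable {d N : ℕ} (P : CutPolygon d N)

/-! ### Residues at the roots of `Q` -/

lemma Q_ne_zero_of_mem_sphere {c : ℂ} {r : ℝ} {I : Fin (d + N) → Prop}
    (hin : ∀ i, I i → (P.x i : ℂ) ∈ Metric.ball c r)
    (hout : ∀ i, ¬ I i → (P.x i : ℂ) ∉ Metric.closedBall c r) {u : ℂ}
    (hu : u ∈ Metric.sphere c r) : P.Q u ≠ 0 := by
  rw [Q, Finset.prod_ne_zero_iff]
  intro i _
  rw [sub_ne_zero]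
  by_cases hi : I i
  · exact ne_of_mem_sphere_of_mem_ball hu (hin i hi)
  · rintro rfl
    exact hout i hi (Metric.sphere_subset_closedBall hu)

lemma differentiable_Q : Differentiable ℂ P.Q := by
  unfold Q
  fun_prop

open Classical in
lemma cint_mul_inv_Q (hne : 0 < d + N) {c : ℂ} {r : ℝ} (hr : 0 < r) {I : Fin (d + N) → Prop}
    (hin : ∀ i, I i → (P.x i : ℂ) ∈ Metric.ball c r)
    (hout : ∀ i, ¬ I i → (P.x i : ℂ) ∉ Metric.closedBall c r) {f : ℂ → ℂ}
    (hf : DifferentiableOn ℂ f (Metric.closedBall c r)) :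
    cint c r (fun u => 1 / P.Q u * f u) = ∑ i, if I i then P.weight i * f (P.xC i) else 0 := by
  have : Nonempty (Fin (d + N)) := ⟨⟨0, hne⟩⟩
  have h := cint_div_prod P.xC_injective hr I hin hout hf
  simp only [← Q_eq] at h
  unfold weight
  rw [← h]
  refine cint_congr hr.le fun z _ => ?_
  rw [one_div, div_eq_inv_mul]

variable {Γ : Contours}

/-- The contour `Γ(𝓡)` encloses the points of `𝓡` and no other root of `Q`. -/
def EnclosesR (Γ : Contours) : Prop :=
  0 < Γ.rR ∧ (∀ i, P.InR i → (P.x i : ℂ) ∈ Metric.ball Γ.cR Γ.rR) ∧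
    ∀ i, ¬ P.InR i → (P.x i : ℂ) ∉ Metric.closedBall Γ.cR Γ.rR

variable {P}

lemma mem_setR {i : Fin (d + N)} : i ∈ P.setR ↔ P.InR i := by
  simp [setR]

lemma EnclosesR.cint_eq (h : P.EnclosesR Γ) (hne : 0 < d + N) {f : ℂ → ℂ}
    (hf : DifferentiableOn ℂ f (Metric.closedBall Γ.cR Γ.rR)) :
    cint Γ.cR Γ.rR (fun u => 1 / P.Q u * f u) = ∑ i ∈ P.setR, P.weight i * f (P.xC i) := by
  rw [P.cint_mul_inv_Q hne h.1 h.2.1 h.2.2 hf, setR, Finset.sum_filter]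

lemma EnclosesR.continuousOn_inv_Q (h : P.EnclosesR Γ) :
    ContinuousOn (fun u => 1 / P.Q u) (Metric.sphere Γ.cR Γ.rR) :=
  continuousOn_const.div P.differentiable_Q.continuous.continuousOn fun _ hu =>
    P.Q_ne_zero_of_mem_sphere h.2.1 h.2.2 hu

/-! ### The multiple integrals -/

lemma deltaCut_eq (u : Fin d → ℂ) :
    P.deltaCut u = (Matrix.of fun i j => P.cutPoly i (u j)).det := by
  rw [← Matrix.det_transpose, deltaCut]
  congr 1
  ext a b
  rw [Matrix.transpose_apply, Matrix.of_apply, Matrix.of_apply, cutPoly_eq]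

lemma EnclosesR.torusIntegral_eq (h : P.EnclosesR Γ) {g : ℂ → ℂ}
    (hg : DifferentiableOn ℂ g (Metric.closedBall Γ.cR Γ.rR)) :
    ((2 * Real.pi * Complex.I : ℂ)⁻¹) ^ d *
      (∯ u in T((fun _ : Fin d => Γ.cR), (fun _ : Fin d => Γ.rR)),
        (∏ a, (1 / P.Q (u a)) * g (u a)) * vdm u * P.deltaCut u)
      = vdmSign d * ((d.factorial : ℂ) * (Matrix.of fun a b : Fin d => ∑ i ∈ P.setR,
        P.weight i * (g (P.xC i) * P.xC i ^ (a : ℕ) * P.cutPoly b (P.xC i))).det) := by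
  have h1 : ∀ u : Fin d → ℂ, (∏ a, (1 / P.Q (u a)) * g (u a)) * vdm u * P.deltaCut u
      = vdmSign d * ((∏ a, (1 / P.Q (u a)) * g (u a))
        * (Matrix.of fun i j : Fin d => u j ^ (i : ℕ)).det
        * (Matrix.of fun i j => P.cutPoly i (u j)).det) := fun u => by
    rw [vdm_eq_det, deltaCut_eq]; ring
  simp only [h1]
  have h2 := torusIntegral_det_mul_det (k := d) h.1.le (w := fun t => 1 / P.Q t * g t)
    (A := fun i t => t ^ (i : ℕ)) (B := P.cutPoly) fun i j =>
      ((h.continuousOn_inv_Q.mul (hg.continuousOn.mono Metric.sphere_subset_closedBall)).mul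
        (continuous_pow _).continuousOn).mul (P.differentiable_cutPoly j).continuous.continuousOn
  rw [torusIntegral_const_mul, mul_left_comm, h2]
  congr 3
  ext a b
  rw [Matrix.of_apply, Matrix.of_apply, ← h.cint_eq (a.pos.trans_le (by omega))
    (f := fun t => g t * t ^ (a : ℕ) * P.cutPoly b t)
    ((hg.mul (differentiable_pow _).differentiableOn).mul
      (P.differentiable_cutPoly b).differentiableOn)]
  simp only [mul_assoc]

lemma EnclosesR.Omega_eq (h : P.EnclosesR Γ) {v z : ℂ}
    (hz : z ∉ Metric.closedBall Γ.cR Γ.rR) :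
    P.Omega Γ v z = vdmSign d * ((d.factorial : ℂ) * (P.gramShift v z).det) := by
  refine h.torusIntegral_eq (g := fun u => (v - u) / (z - u)) ?_
  refine DifferentiableOn.div (by fun_prop) (by fun_prop) fun u hu => ?_
  rw [sub_ne_zero]
  rintro rfl
  exact hz hu

lemma EnclosesR.Omega0_eq (h : P.EnclosesR Γ) :
    P.Omega0 Γ = vdmSign d * ((d.factorial : ℂ) * P.gram.det) := by
  have h1 := h.torusIntegral_eq (g := fun _ => 1) (differentiableOn_const 1)
  simp only [mul_one, one_mul] at h1
  exact h1

lemma EnclosesR.Omega0_ne_zero (h : P.EnclosesR Γ) (hG : P.gram.det ≠ 0) : P.Omega0 Γ ≠ 0 := by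
  rw [h.Omega0_eq]
  exact mul_ne_zero (vdmSign_ne_zero d)
    (mul_ne_zero (by exact_mod_cast d.factorial_ne_zero) hG)

lemma EnclosesR.Omega_div_Omega0 (h : P.EnclosesR Γ) (hG : P.gram.det ≠ 0) {v z : ℂ}
    (hz : z ∉ Metric.closedBall Γ.cR Γ.rR) :
    P.Omega Γ v z / P.Omega0 Γ = 1 - (z - v) * ∑ b, P.dualPoly b v * P.stieltjes b z := by
  rw [div_eq_iff (h.Omega0_ne_zero hG), h.Omega_eq hz, h.Omega0_eq, P.det_gramShift hG]
  · ring
  · intro i hi hzi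
    exact hz (hzi ▸ Metric.ball_subset_closedBall (h.2.1 i (mem_setR.1 hi)))

lemma consVar_succ {k : ℕ} (v : ℂ) (u : Fin k → ℂ) :
    consVar (d := k + 1) v u = Fin.cons v u := by
  funext a
  refine Fin.cases ?_ (fun a => ?_) a
  · simp [consVar]
  · simp [consVar]

lemma deltaCutTilde_succ {k N : ℕ} (P : CutPolygon (k + 1) N) (w : ℂ) (u : Fin k → ℂ) :
    P.deltaCutTilde w u = (Matrix.of fun i j =>
      (Fin.cons (w ^ P.y i) (fun a => P.cutPoly i (u a)) : Fin (k + 1) → ℂ) j).det := by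
  rw [← Matrix.det_transpose, deltaCutTilde]
  congr 1
  ext a b
  rw [Matrix.transpose_apply, Matrix.of_apply, Matrix.of_apply]
  refine Fin.cases ?_ (fun a => ?_) a
  · simp
  · rw [dif_neg (by simp), Fin.cons_succ, cutPoly_eq]
    rfl

/-- The factor `d` turns the `(d-1)!` of the frozen Andréief identity into `d!`, which cancels
against `Omega0`; it also disposes of `d = 0`. -/
lemma EnclosesR.natCast_mul_OmegaTilde (h : P.EnclosesR Γ) (v w : ℂ) :
    (d : ℂ) * P.OmegaTilde Γ v w = vdmSign d * ((d.factorial : ℂ) *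
      ∑ a : Fin d, ∑ b, v ^ (a : ℕ) * w ^ P.y b * P.gram.adjugate b a) := by
  cases d with
  | zero => simp
  | succ k =>
    have h1 : ∀ u : Fin k → ℂ,
        (∏ a, 1 / P.Q (u a)) * vdm (consVar (d := k + 1) v u) * P.deltaCutTilde w u
        = vdmSign (k + 1) * ((∏ a, 1 / P.Q (u a))
          * (Matrix.of fun i j : Fin (k + 1) => (Fin.cons (v ^ (i : ℕ)) (fun a => u a ^ (i : ℕ)) :
            Fin (k + 1) → ℂ) j).det
          * (Matrix.of fun i j => (Fin.cons (w ^ P.y i) (fun a => P.cutPoly i (u a)) :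
            Fin (k + 1) → ℂ) j).det) := fun u => by
      rw [vdm_eq_det, deltaCutTilde_succ, consVar_succ]
      have : (Matrix.of fun i j : Fin (k + 1) => (Fin.cons v u : Fin (k + 1) → ℂ) j ^ (i : ℕ))
          = Matrix.of fun i j : Fin (k + 1) => (Fin.cons (v ^ (i : ℕ)) (fun a => u a ^ (i : ℕ)) :
            Fin (k + 1) → ℂ) j := by
        ext i j
        refine Fin.cases ?_ (fun j => ?_) j <;> simp
      rw [this]
      ring
    have h2 := torusIntegral_det_cons_mul_det_cons (k := k) h.1.le (w := fun t => 1 / P.Q t)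
      (A := fun i t => t ^ (i : ℕ)) (B := P.cutPoly) (fun i => v ^ (i : ℕ)) (fun i => w ^ P.y i)
      fun i j => (h.continuousOn_inv_Q.mul (continuous_pow _).continuousOn).mul
        (P.differentiable_cutPoly j).continuous.continuousOn
    have h3 : (Matrix.of fun i j : Fin (k + 1) => cint Γ.cR Γ.rR
        fun z => 1 / P.Q z * z ^ (i : ℕ) * P.cutPoly j z) = P.gram := by
      ext a b
      rw [Matrix.of_apply, gram, Matrix.of_apply, ← h.cint_eq (by omega)
        (f := fun t => t ^ (a : ℕ) * P.cutPoly b t)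
        ((differentiable_pow _).differentiableOn.mul (P.differentiable_cutPoly b).differentiableOn)]
      simp only [mul_assoc]
    rw [h3] at h2
    have h4 : P.OmegaTilde Γ v w = vdmSign (k + 1) * ((k.factorial : ℂ) *
        ∑ a : Fin (k + 1), ∑ b, v ^ (a : ℕ) * w ^ P.y b * P.gram.adjugate b a) := by
      rw [← h2, mul_left_comm, ← torusIntegral_const_mul]
      exact congrArg (fun F => ((2 * Real.pi * Complex.I : ℂ)⁻¹) ^ k *
        torusIntegral F (fun _ : Fin k => Γ.cR) (fun _ : Fin k => Γ.rR)) (funext h1)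
    rw [h4, Nat.factorial_succ]
    push_cast
    ring

lemma EnclosesR.natCast_mul_OmegaTilde_div_Omega0 (h : P.EnclosesR Γ) (hG : P.gram.det ≠ 0)
    (v w : ℂ) :
    (d : ℂ) * P.OmegaTilde Γ v w / P.Omega0 Γ = ∑ b, P.dualPoly b v * w ^ P.y b := by
  rw [div_eq_iff (h.Omega0_ne_zero hG), h.natCast_mul_OmegaTilde, h.Omega0_eq, Finset.sum_comm]
  simp only [dualPoly, Matrix.inv_def, Ring.inverse_eq_inv', Matrix.smul_apply, smul_eq_mul,
    Finset.sum_mul, Finset.mul_sum]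
  refine Finset.sum_congr rfl fun b _ => Finset.sum_congr rfl fun a _ => ?_
  field_simp

end CutPolygon

lemma homSymInt_one_eq_rising {n : ℕ} (hn : 0 < n) (r : ℤ) :
    (homSymInt 1 0 n r : ℂ)
      = if 0 ≤ r then rising ((r : ℂ) + 1) (n - 1) / ((n - 1).factorial : ℂ) else 0 := by
  split_ifs with h
  · rw [← homExt_eq_homSymInt one_pos le_rfl _ _ _ (by omega), homExt_one,
      eval_binPoly_ofReal, CutPolygon.eval_binPoly_eq_rising hn]
    push_cast
    rfl
  · rw [homSymInt_of_neg (not_le.1 h), Complex.ofReal_zero]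

/-- There is a circle which separates the points `x_i ≥ t` from the others. -/
lemma exists_circle_separating {ι : Type*} [Finite ι] (x : ι → ℤ) (t : ℤ) :
    ∃ (c : ℂ) (r : ℝ), 0 < r ∧ (∀ i, t ≤ x i → (x i : ℂ) ∈ Metric.ball c r) ∧
      ∀ i, x i < t → (x i : ℂ) ∉ Metric.closedBall c r := by
  obtain ⟨M, hM⟩ := (Set.finite_range x).bddAbove
  have hM : ∀ i, x i ≤ max M t := fun i => (hM ⟨i, rfl⟩).trans (le_max_left _ _)
  have hMt : (t : ℝ) ≤ (max M t : ℤ) := by exact_mod_cast le_max_right M t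
  set s : ℤ := max M t
  have hd : ∀ z : ℤ, dist (z : ℂ) ((((t : ℝ) + s) / 2 : ℝ) : ℂ) = |(z : ℝ) - ((t : ℝ) + s) / 2| := by
    intro z
    rw [Complex.dist_eq, ← Complex.ofReal_intCast, ← Complex.ofReal_sub, Complex.norm_real,
      Real.norm_eq_abs]
  -- The circle meets the real axis at `t - 1/2` and `s + 1/2`, and therefore avoids all integers.
  refine ⟨(((t : ℝ) + s) / 2 : ℝ), ((s : ℝ) - t) / 2 + 1 / 2, by linarith, fun i hi => ?_,
    fun i hi => ?_⟩
  · have h1 : (t : ℝ) ≤ x i := by exact_mod_cast hi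
    have h2 : (x i : ℝ) ≤ s := by exact_mod_cast hM i
    rw [Metric.mem_ball, hd, abs_lt]
    constructor <;> linarith
  · have h1 : (x i : ℝ) + 1 ≤ t := by exact_mod_cast hi
    rw [Metric.mem_closedBall, hd, abs_le]
    intro h
    linarith [h.1]

namespace CutPolygon

variable {d N : ℕ} {P : CutPolygon d N} {Γ : Contours}

/-! ### Existence of admissible contours -/

variable (P) in
lemma exists_inR_iff : ∃ t : ℤ, ∀ i, P.InR i ↔ t ≤ P.x i := by
  rcases Nat.eq_zero_or_pos d with rfl | hd
  · obtain ⟨M, hM⟩ := (Set.finite_range P.x).bddAbove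
    refine ⟨M + 1, fun i => ⟨fun ⟨j, _⟩ => j.elim0, fun h => ?_⟩⟩
    have := hM ⟨i, rfl⟩
    omega
  · refine ⟨P.y ⟨d - 1, by omega⟩, fun i => ⟨fun ⟨j, hj⟩ => le_trans ?_ hj, fun h => ⟨_, h⟩⟩⟩
    exact P.y_anti.antitone (Fin.le_def.2 (by have := j.2; simp only; omega))

variable (P) in
lemma exists_admissible (x : ℤ) (n : ℕ) (y : ℤ) : ∃ Γ : Contours, P.Admissible Γ x n y := by
  obtain ⟨t, ht⟩ := P.exists_inR_iff
  obtain ⟨cR, rR, hR, hR1, hR2⟩ := exists_circle_separating P.x t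
  obtain ⟨cv, rv, hv, hv1, hv2⟩ := exists_circle_separating P.x x
  refine ⟨⟨cR, rR, cv, rv, 0, ‖cR‖ + rR + (‖cv‖ + rv) + (‖(y : ℂ)‖ + N + 1), 0, 1 / 2⟩,
    fun i hi => hR1 i ((ht i).1 hi), fun i hi => hR2 i (not_le.1 fun h => hi ((ht i).2 h)),
    hv1, hv2, fun z hz => ?_, fun z hz => ?_, fun j hj => ?_, ?_, ?_, hR, hv⟩
  · rw [mem_ball_zero_iff]
    rw [mem_closedBall_iff_norm] at hz
    have := norm_le_norm_add_norm_sub' z cR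
    have := norm_nonneg cv
    have := norm_nonneg (y : ℂ)
    have : (0 : ℝ) ≤ N := N.cast_nonneg
    simp only at hz ⊢
    linarith
  · rw [mem_ball_zero_iff]
    rw [mem_closedBall_iff_norm] at hz
    have := norm_le_norm_add_norm_sub' z cv
    have := norm_nonneg cR
    have := norm_nonneg (y : ℂ)
    have : (0 : ℝ) ≤ N := N.cast_nonneg
    simp only at hz ⊢
    linarith
  · rw [mem_ball_zero_iff]
    have h1 := norm_sub_le (y : ℂ) (j : ℂ)
    rw [Complex.norm_natCast] at h1
    have := norm_nonneg cR
    have := norm_nonneg cv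
    have : (j : ℝ) ≤ N := by exact_mod_cast hj.trans (Nat.sub_le _ _)
    simp only
    linarith
  · simp
  · simp only [mem_closedBall_zero_iff, norm_one]
    norm_num

/-! ### The inner integrals -/

lemma Admissible.enclosesR {x : ℤ} {n : ℕ} {y : ℤ} (h : P.Admissible Γ x n y) : P.EnclosesR Γ :=
  ⟨h.2.2.2.2.2.2.2.2.2.1, h.1, h.2.1⟩

variable (P) in
/-- The function `(N-n)! Q(z) / (z-y)_{N-n+1}`. -/
def outer (n : ℕ) (y : ℤ) (z : ℂ) : ℂ :=
  ((N - n).factorial : ℂ) * P.Q z / rising (z - y) (N - n + 1)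

variable (P) in
/-- The Cauchy transform of `outer`. -/
def outerCauchy (Γ : Contours) (n : ℕ) (y : ℤ) (v : ℂ) : ℂ :=
  cint Γ.cinf Γ.rinf fun z => (z - v)⁻¹ * P.outer n y z

lemma Admissible.continuousOn_outer {x : ℤ} {n : ℕ} {y : ℤ} (h : P.Admissible Γ x n y) :
    ContinuousOn (P.outer n y) (Metric.sphere Γ.cinf Γ.rinf) := by
  obtain ⟨-, -, -, -, -, -, hy, -, -, -⟩ := h
  have hrising : ∀ z : ℂ, rising (z - y) (N - n + 1)
      = ∏ j ∈ Finset.range (N - n + 1), (z - y + j) := fun z => rising_eq_prod _ _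
  unfold outer
  simp only [hrising]
  refine ContinuousOn.div ?_ (by fun_prop) fun z hz => Finset.prod_ne_zero_iff.2 fun j hj => ?_
  · exact (continuous_const.mul P.differentiable_Q.continuous).continuousOn
  · have hj' := Finset.mem_range.1 hj
    have := ne_of_mem_sphere_of_mem_ball hz (hy j (by omega))
    intro h0
    exact this (by linear_combination h0)

lemma Admissible.rinf_pos {x : ℤ} {n : ℕ} {y : ℤ} (h : P.Admissible Γ x n y) : 0 < Γ.rinf := by
  obtain ⟨-, -, -, -, -, -, hy, -, -, -⟩ := h
  exact dist_nonneg.trans_lt (Metric.mem_ball.1 (hy 0 (Nat.zero_le _)))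

/-- At a root the Cauchy kernel cancels one factor of `Q`, so only the poles of the rising factorial
remain. -/
lemma Admissible.outerCauchy_root {x : ℤ} {n : ℕ} {y : ℤ} (h : P.Admissible Γ x n y)
    {i : Fin (d + N)} (hi : P.xC i ∈ Metric.ball Γ.cinf Γ.rinf) :
    P.outerCauchy Γ n y (P.xC i) = P.topCoef n y i := by
  have hr := h.rinf_pos
  obtain ⟨-, -, -, -, -, -, hy, -, -, -⟩ := h
  rw [topCoef, ← cint_div_rising (differentiable_nodeProd P.xC i) (N - n) (y : ℂ) hy, outerCauchy]
  refine cint_congr hr.le fun z hz => ?_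
  have hne : z - P.xC i ≠ 0 := sub_ne_zero.2 (ne_of_mem_sphere_of_mem_ball hz hi)
  rw [outer, Q_eq, ← mul_nodeProd P.xC i z]
  field_simp

lemma Admissible.differentiableOn_outerCauchy {x : ℤ} {n : ℕ} {y : ℤ}
    (h : P.Admissible Γ x n y) :
    DifferentiableOn ℂ (P.outerCauchy Γ n y) (Metric.closedBall Γ.cv Γ.rv) :=
  (differentiableOn_cint_cauchy h.rinf_pos h.continuousOn_outer).mono h.2.2.2.2.2.1

/-- In `1 - (z-v) ∑ …` the factor `z - v` cancels the Cauchy kernel at `v`, and the Stieltjes sums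
supply Cauchy kernels at the roots in `𝓡`. -/
lemma Admissible.cint_inf {x : ℤ} {n : ℕ} {y : ℤ} (h : P.Admissible Γ x n y)
    (hG : P.gram.det ≠ 0) {v : ℂ} (hv : v ∈ Metric.closedBall Γ.cv Γ.rv) :
    cint Γ.cinf Γ.rinf (fun z => 1 / (z - v) *
        (((N - n).factorial : ℂ) * P.Q z / rising (z - y) (N - n + 1)) *
        (P.Omega Γ v z / P.Omega0 Γ))
      = P.outerCauchy Γ n y v - ∑ b, P.dualPoly b v *
          ∑ l ∈ P.setR, P.weight l * P.cutPoly b (P.xC l) * P.topCoef n y l := by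
  have hr := h.rinf_pos
  have hv' : v ∈ Metric.ball Γ.cinf Γ.rinf := h.2.2.2.2.2.1 hv
  have hR : Metric.closedBall Γ.cR Γ.rR ⊆ Metric.ball Γ.cinf Γ.rinf := h.2.2.2.2.1
  have hmem : ∀ l ∈ P.setR, P.xC l ∈ Metric.ball Γ.cinf Γ.rinf := fun l hl =>
    hR (Metric.ball_subset_closedBall (h.1 l (mem_setR.1 hl)))
  have hinv : ∀ w ∈ Metric.ball Γ.cinf Γ.rinf,
      ContinuousOn (fun z => (z - w)⁻¹ * P.outer n y z) (Metric.sphere Γ.cinf Γ.rinf) :=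
    fun w hw => ContinuousOn.mul (ContinuousOn.inv₀ (by fun_prop) fun z hz =>
      sub_ne_zero.2 (ne_of_mem_sphere_of_mem_ball hz hw)) h.continuousOn_outer
  have hl : ∀ b, ∀ l ∈ P.setR, ContinuousOn (fun z => P.weight l * P.cutPoly b (P.xC l) *
      ((z - P.xC l)⁻¹ * P.outer n y z)) (Metric.sphere Γ.cinf Γ.rinf) := fun b l hl =>
    continuousOn_const.mul (hinv _ (hmem l hl))
  have hb : ∀ b ∈ Finset.univ, ContinuousOn (fun z => P.dualPoly b v * ∑ l ∈ P.setR,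
      P.weight l * P.cutPoly b (P.xC l) * ((z - P.xC l)⁻¹ * P.outer n y z))
      (Metric.sphere Γ.cinf Γ.rinf) := fun b _ =>
    continuousOn_const.mul (continuousOn_finsetSum _ (hl b))
  have hcongr : ∀ z ∈ Metric.sphere Γ.cinf Γ.rinf, 1 / (z - v) *
        (((N - n).factorial : ℂ) * P.Q z / rising (z - y) (N - n + 1)) *
        (P.Omega Γ v z / P.Omega0 Γ)
      = (z - v)⁻¹ * P.outer n y z - ∑ b, P.dualPoly b v * ∑ l ∈ P.setR,
        P.weight l * P.cutPoly b (P.xC l) * ((z - P.xC l)⁻¹ * P.outer n y z) := by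
    intro z hz
    have hzR : z ∉ Metric.closedBall Γ.cR Γ.rR := fun hz' =>
      ne_of_mem_sphere_of_mem_ball hz (hR hz') rfl
    have hne : z - v ≠ 0 := sub_ne_zero.2 (ne_of_mem_sphere_of_mem_ball hz hv')
    rw [h.enclosesR.Omega_div_Omega0 hG hzR, ← outer]
    have : ∑ b, P.dualPoly b v * ∑ l ∈ P.setR,
        P.weight l * P.cutPoly b (P.xC l) * ((z - P.xC l)⁻¹ * P.outer n y z)
        = (∑ b, P.dualPoly b v * P.stieltjes b z) * P.outer n y z := by
      simp only [stieltjes, Finset.sum_mul, Finset.mul_sum, mul_assoc]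
    rw [this]
    field_simp
  rw [cint_congr hr.le hcongr, cint_sub hr.le (hinv v hv') (continuousOn_finsetSum _ hb),
    cint_sum hr.le _ hb, outerCauchy]
  congr 1
  refine Finset.sum_congr rfl fun b _ => ?_
  rw [cint_const_mul, cint_sum hr.le _ (hl b)]
  congr 1
  refine Finset.sum_congr rfl fun l hl => ?_
  rw [cint_const_mul, ← h.outerCauchy_root (hmem l hl), outerCauchy]

lemma Admissible.cint_zero {x : ℤ} {n : ℕ} {y : ℤ} (h : P.Admissible Γ x n y)
    (hG : P.gram.det ≠ 0) (v : ℂ) :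
    (d : ℂ) * cint Γ.czero Γ.rzero (fun w => 1 / (w ^ (y + 1) * (1 - w) ^ n) *
        (P.OmegaTilde Γ v w / P.Omega0 Γ))
      = ∑ b, P.dualPoly b v * (homSymInt 1 0 n (y - P.y b) : ℂ) := by
  have h0 : (0 : ℂ) ∈ Metric.ball Γ.czero Γ.rzero := h.2.2.2.2.2.2.2.1
  have h1 : (1 : ℂ) ∉ Metric.closedBall Γ.czero Γ.rzero := h.2.2.2.2.2.2.2.2.1
  have hr : 0 ≤ Γ.rzero := dist_nonneg.trans (Metric.mem_ball.1 h0).le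
  have hne0 : ∀ w ∈ Metric.sphere Γ.czero Γ.rzero, w ≠ 0 := fun w hw =>
    ne_of_mem_sphere_of_mem_ball hw h0
  have hne1 : ∀ w ∈ Metric.sphere Γ.czero Γ.rzero, 1 - w ≠ 0 := fun w hw hw1 => by
    rw [sub_eq_zero] at hw1
    exact h1 (hw1 ▸ Metric.sphere_subset_closedBall hw)
  have hcongr : ∀ w ∈ Metric.sphere Γ.czero Γ.rzero,
      (d : ℂ) * (1 / (w ^ (y + 1) * (1 - w) ^ n) * (P.OmegaTilde Γ v w / P.Omega0 Γ))
      = ∑ b, P.dualPoly b v * (w ^ (y - P.y b + 1) * (1 - w) ^ n)⁻¹ := by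
    intro w hw
    have h2 := h.enclosesR.natCast_mul_OmegaTilde_div_Omega0 hG v w
    rw [mul_left_comm, ← mul_div_assoc, h2, Finset.mul_sum]
    refine Finset.sum_congr rfl fun b _ => ?_
    have e : w ^ (y + 1) = w ^ (y - P.y b + 1) * w ^ P.y b := by
      rw [← zpow_add₀ (hne0 w hw)]
      congr 1
      ring
    rw [e]
    have := zpow_ne_zero (P.y b) (hne0 w hw)
    have := zpow_ne_zero (y - P.y b + 1) (hne0 w hw)
    have := pow_ne_zero n (hne1 w hw)
    field_simp
  rw [← cint_const_mul, cint_congr hr hcongr, cint_sum hr]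
  · refine Finset.sum_congr rfl fun b _ => ?_
    rw [cint_const_mul, cint_zpow h0 h1]
  · intro b _
    refine continuousOn_const.mul (ContinuousOn.inv₀ (ContinuousOn.mul ?_ (by fun_prop))
      fun w hw => mul_ne_zero (zpow_ne_zero _ (hne0 w hw)) (pow_ne_zero n (hne1 w hw)))
    exact continuousOn_id.zpow₀ _ fun w hw => Or.inl (hne0 w hw)

/-! ### The contour integral form of the kernel -/

variable (P) in
lemma differentiable_dualPoly (b : Fin d) : Differentiable ℂ (P.dualPoly b) := by
  unfold dualPoly
  fun_prop

/-- Only the roots `x_j ≥ x` contribute residues; there the rising factorial is `h_{x_j - x}`, which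
is zero at the other roots. -/
lemma Admissible.cint_vFactor {p : ℕ × ℤ} {n : ℕ} {y : ℤ} (h : P.Admissible Γ p.2 n y)
    (hp : p.1 < N) {f : ℂ → ℂ} (hf : DifferentiableOn ℂ f (Metric.closedBall Γ.cv Γ.rv)) :
    cint Γ.cv Γ.rv (fun v => P.vFactor p v * f v)
      = ∑ j, (homSymInt 1 0 (N - p.1) (P.x j - p.2) : ℂ) * (P.weight j * f (P.xC j)) := by
  classical
  obtain ⟨-, -, hin, hout, -, -, -, -, -, -, hr⟩ := h
  have hrising : ∀ v : ℂ, rising (v - p.2 + 1) (N - p.1 - 1)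
      = ∏ j ∈ Finset.range (N - p.1 - 1), (v - p.2 + 1 + j) := fun z => rising_eq_prod _ _
  have hd : Differentiable ℂ fun v => rising (v - p.2 + 1) (N - p.1 - 1)
      / ((N - p.1 - 1).factorial : ℂ) := by
    simp only [hrising]
    fun_prop
  have h1 := P.cint_mul_inv_Q (by omega) hr (I := fun i => p.2 ≤ P.x i) hin
    (fun i hi => hout i (not_le.1 hi)) (hd.differentiableOn.fun_mul hf)
  have h2 : (fun v => P.vFactor p v * f v) = fun v => 1 / P.Q v *
      (rising (v - p.2 + 1) (N - p.1 - 1) / ((N - p.1 - 1).factorial : ℂ) * f v) := by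
    funext v
    rw [vFactor, if_pos hp, div_mul_eq_div_div]
    ring
  rw [h2]
  refine Eq.trans h1 (Finset.sum_congr rfl fun j _ => ?_)
  rw [homSymInt_one_eq_rising (by omega)]
  simp only [sub_nonneg]
  split_ifs with hj
  · rw [xC]
    push_cast
    ring
  · rw [zero_mul]

/-- The kernel at `q = 1` in contour integral form. -/
lemma Admissible.kern_eq {p p' : ℕ × ℤ} (h : P.Admissible Γ p.2 p'.1 p'.2)
    (hdet : (P.H 1).det ≠ 0) (hp : p ∈ P.points) (hp' : p'.1 ≤ N) :
    (P.kern 1 p p' : ℂ) = K0 p p' + P.K1 Γ p p' + P.K2 Γ p p' := by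
  have hG := P.det_gram_ne_zero hdet
  have hpN : p.1 ≤ N := hp.1
  rcases hpN.eq_or_lt with hN | hN
  · have hv : P.vFactor p = fun _ => 0 := funext fun v => if_neg (by omega)
    rw [P.kern_one_top hp hN hp', K0, if_neg (by omega), K1, K2, hv]
    simp [circleIntegral]
  have hv0 : 0 ≤ Γ.rv := h.2.2.2.2.2.2.2.2.2.2.le
  have h1 : P.K1 Γ p p' = ∑ j, (homSymInt 1 0 (N - p.1) (P.x j - p.2) : ℂ) *
      (P.weight j * (P.topCoef p'.1 p'.2 j - ∑ b, P.dualPoly b (P.xC j) *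
        ∑ l ∈ P.setR, P.weight l * P.cutPoly b (P.xC l) * P.topCoef p'.1 p'.2 l)) := by
    set T : Fin d → ℂ := fun b =>
      ∑ l ∈ P.setR, P.weight l * P.cutPoly b (P.xC l) * P.topCoef p'.1 p'.2 l with hT
    have e : P.K1 Γ p p' = cint Γ.cv Γ.rv fun v => P.vFactor p v *
        (P.outerCauchy Γ p'.1 p'.2 v - ∑ b, P.dualPoly b v * T b) :=
      cint_congr hv0 fun v hv => congrArg (P.vFactor p v * ·)
        (h.cint_inf hG (Metric.sphere_subset_closedBall hv))
    rw [e, h.cint_vFactor hN]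
    · refine Finset.sum_congr rfl fun j _ => ?_
      by_cases hj : p.2 ≤ P.x j
      · rw [h.outerCauchy_root (h.2.2.2.2.2.1 (Metric.ball_subset_closedBall (h.2.2.1 j hj)))]
      · rw [homSymInt_of_neg (by omega), Complex.ofReal_zero, zero_mul, zero_mul]
    · refine h.differentiableOn_outerCauchy.sub (Differentiable.differentiableOn ?_)
      exact Differentiable.fun_sum fun b _ => (P.differentiable_dualPoly b).mul_const _
  have h2 : P.K2 Γ p p' = ∑ j, (homSymInt 1 0 (N - p.1) (P.x j - p.2) : ℂ) *
      (P.weight j * ∑ b, P.dualPoly b (P.xC j) * (homSymInt 1 0 p'.1 (p'.2 - P.y b) : ℂ)) := by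
    have e : P.K2 Γ p p' = cint Γ.cv Γ.rv fun v => P.vFactor p v *
        ∑ b, P.dualPoly b v * (homSymInt 1 0 p'.1 (p'.2 - P.y b) : ℂ) :=
      cint_congr hv0 fun v _ => congrArg (P.vFactor p v * ·) (h.cint_zero hG v)
    rw [e, h.cint_vFactor hN]
    exact (Differentiable.fun_sum fun b _ =>
      (P.differentiable_dualPoly b).mul_const _).differentiableOn
  have h0 : K0 p p' = ((-(if p.1 < p'.1 then homSymInt 1 0 (p'.1 - p.1) (p'.2 - p.2) else 0) :
      ℝ) : ℂ) := by
    rw [K0]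
    by_cases hlt : p.1 < p'.1
    · rw [if_pos hlt, Complex.ofReal_neg, homSymInt_one_eq_rising (by omega)]
      simp only [hlt, true_and, sub_nonneg]
      split_ifs
      · push_cast; rfl
      · rw [neg_zero]
    · simp [hlt]
  rw [kern_one, h0, h1, h2, Complex.ofReal_add, add_assoc, ← Finset.sum_add_distrib]
  push_cast
  congr 1
  refine Finset.sum_congr rfl fun j _ => ?_
  rw [P.coef_eq hdet hp']
  ring

end CutPolygon

end RedDot

end

theorem proposition7p1 {d N : ℕ} (P : RedDot.CutPolygon d N) (hP : P.configs.Nonempty) :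
    ∃ K : ℕ × ℤ → ℕ × ℤ → ℝ,
      -- the kernel is the limit of the kernels of the weighted processes
      (∀ p ∈ P.points, ∀ p' ∈ P.points,
        Tendsto (fun q : ℝ => P.qKernel q p p') (𝓝[<] 1) (𝓝 (K p p'))) ∧
      -- it is a correlation kernel of the uniform red-dot process
      P.IsCorrelationKernelOn P.points K ∧
      -- it has the stated contour integral form, and the integrals are not degenerate
      (∀ p ∈ P.points, ∀ p' ∈ P.points,
        (∃ Γ : RedDot.Contours, P.Admissible Γ p.2 p'.1 p'.2) ∧
        ∀ Γ : RedDot.Contours, P.Admissible Γ p.2 p'.1 p'.2 →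
          P.Omega0 Γ ≠ 0 ∧
          (K p p' : ℂ) =
            RedDot.CutPolygon.K0 p p' + P.K1 Γ p p' + P.K2 Γ p p') := by
  have hdet : (P.H 1).det ≠ 0 := (P.det_H_one_pos hP).ne'
  refine ⟨P.kern 1, fun p _ p' hp' => P.tendsto_qKernel hP p hp'.1, P.isCorrelationKernelOn hP,
    fun p hp p' hp' => ⟨P.exists_admissible _ _ _, fun Γ hΓ => ⟨?_, hΓ.kern_eq hdet hp hp'.1⟩⟩⟩
  exact hΓ.enclosesR.Omega0_ne_zero (P.det_gram_ne_zero hdet)
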